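/- **Conventions.** All $\omega$-categories are strict globular $\omega$-categories in which every morphism has finite dimension; $s_n,t_n$ are the $n$-dimensional source and target, $*_n$ is the composition defined on pairs with $t_nx=s_ny$, and $\dim x$ is the least $n$ with $s_nx=x=t_nx$. $C_0$ is the set of $0$-dimensional morphisms. $C$ is *non-contracting* if $\dim s_1x=\dim t_1x=1$ whenever $\dim x\ge 1$; an $\omega$-functor is non-contracting if it preserves $1$-dimensional morphisms. For a non-contracting $C$, the *path $\omega$-category* $\mathbb PC$ consists of the morphisms of $C$ of dimension $\ge1$, with $s_n,t_n,*_n$ on $\mathbb PC$ being $s_{n+1},t_{n+1},*_{n+1}$ of $C$. An $\omega$-category is a groupoid if for each $r\ge 0$ every morphism $x$ of dimension $\ge 1$ has an inverse $y$ for $*_r$, i.e. $t_rx=s_ry$, $t_ry=s_rx$, $x*_ry=s_rx$, $y*_rx=s_ry$. $I^n$ and $\Delta^n$ are the free $\omega$-categories generated by the faces of the $n$-cube and of the $n$-simplex, $\delta_i^\alpha:I^{n-1}\to I^n$ and $\delta_i:\Delta^{n-1}\to\Delta^n$ the face inclusions. The faces of $I^n$ are the words of length $n$ in $-,0,+$;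 the codimension-one face obtained by replacing the $i$-th letter $0$ of a word by $\alpha$ lies in the source if $\alpha=(-)^i$ and in the target otherwise. The codimension-one face of a simplex obtained by removing the $i$-th vertex ($i$ counted from $1$) lies in the source if $i$ is odd and in the target otherwise. For a precubical set $K$, $F(K)$ is the colimit of the $\omega$-categories $I^n$ indexed by the cubes of $K$; it is non-contracting. For a non-contracting $C$, $C\to\widehat C$ is the universal non-contracting $\omega$-functor from $C$ to a non-contracting $\omega$-category whose path $\omega$-category is a groupoid (inverses are freely added to $\mathbb PC$). **Nerves.** Let $C$ be non-contracting. For $n\ge0$ the $n$-simplices of $\mathcal N^{gl}(C)$ are the $\omega$-functors $\Delta^n\to\mathbb PC$, and for $\alpha\in\{-,+\}$ the $n$-simplices of $\mathcal N^{\alpha}(C)$ are the $\omega$-functors $f:I^{n+1}\to C$ that send to a $1$-dimensional morphism every $1$-dimensional $u$ of $I^{n+1}$ starting at the vertex $(-,\dots,-)$ (if $\alpha=-$), respectively ending at $(+,\dots,+)$ (if $\alpha=+$). The faces are given by composition with $\delta_i$, respectively $\delta_i^\alpha$. The $(-1)$-simplices are $C_0\times C_0$, respectively $C_0$; identifying a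 $0$-simplex with the morphism $x$ of $C$ that is its value on the top cell, the augmentation is $x\mapsto(s_0x,t_0x)$ for $\mathcal N^{gl}$, $x\mapsto s_0x$ for $\mathcal N^-$ and $x\mapsto t_0x$ for $\mathcal N^+$. Let $C^{gl}(C)$, $C^\pm(C)$ be the corresponding unnormalized augmented chain complexes of abelian groups: the degree-$n$ group is free on the $(n-1)$-simplices, $n\ge0$, and the differential is the alternating sum of the faces. Non-contracting $\omega$-functors act on them. For $n\geq 2$, a generator of degree $n$ is *thin* if the image in $C$ of the top cell (of $\Delta^{n-1}$, whose image in $\mathbb PC$ is regarded as a morphism of $C$, or of $I^n$) has dimension in $C$ at most $n-1$. Let $M_n\subset C^{\kappa}_n(C)$ be spanned by the thin generators ($M_0=M_1=0$) and let $CR^{\kappa}_n(C)=C^{\kappa}_n(C)/(M_n+\partial M_{n+1})$, for $\kappa\in\{gl,-,+\}$. **Formal complexes.** $CF^{gl}_0(C)=\mathbb Z(C_0\times C_0)$ and $CF^\pm_0(C)=\mathbb ZC_0$. For $n\ge1$, $CF^\kappa_n(C)$ is generated by the morphisms $x$ with $1\le\dim x\le n$, subject to: $x=0$ if $\dim x\le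 n-1$; $x*_py=x+y$ for $1\le p\le n-1$; and moreover $x*_0y=x$ if $\kappa=-$, and $x*_0y=y$ if $\kappa=+$ (whenever these composites exist, $x$, $y$ and the composite having dimension between $1$ and $n$). The differential in degree $1$ is $x\mapsto(s_0x,t_0x)$, $x\mapsto s_0x$, $x\mapsto t_0x$ for $\kappa=gl,-,+$ respectively; in degree $n\ge2$ it is $s_{n-1}-t_{n-1}$ for $\kappa=gl,-$ and $t_{n-1}-s_{n-1}$ for $\kappa=+$. The *folding operator* $\square_n$ sends a generator of $CF^\kappa_n(C)$ to a generator of $C^\kappa_n(C)$. It is the identity for $n=0$. For $n\ge1$ let $G^m$ be the free $\omega$-category generated by an $m$-globe, i.e. by one morphism of dimension $m$; then $\square_n(x)$ is the composite of the $\omega$-functor representing $x$ ($G^{n-1}\to\mathbb PC$ if $\kappa=gl$, $G^n\to C$ if $\kappa=\pm$) with the folding of the cell onto the globe, $\Delta^{n-1}\to G^{n-1}$, respectively $I^n\to G^n$. Here $G^m$ has the $k$-cells $e_k^-$ (source) and $e_k^+$ (target) for $k<m$ besides the top cell, and the folding sends the top cell to the top cell and is as follows on the faces of dimension $k$ below the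 top dimension. For $\Delta^m$ with vertices $0,\dots,m$, a face with vertex set $\{0,\dots,k-1,j\}$, $j\ge k$, is sent to $e_k^{\varepsilon}$ if $j=k$ and to $e_k^{-\varepsilon}$ if $j>k$, where $\varepsilon=(-)^k$, and every other face to (the identity of) a lower-dimensional cell. For $I^n$ and $\kappa=\alpha\in\{-,+\}$, the vertex $(\alpha,\dots,\alpha)$ is sent to $e_0^\alpha$ and every other vertex to $e_0^{-\alpha}$; for $k\ge1$, a face all of whose letters are $0$ or $\alpha$ and whose zeros are in the positions $1,\dots,k-1,j$, $j\ge k$, is sent to $e_k^{\varepsilon}$ if $j=k$ and to $e_k^{-\varepsilon}$ if $j>k$, where $\varepsilon=(-)^{k}\alpha$ (product of signs), and every other face to (the identity of) a lower-dimensional cell. **Theorem.** Let $K$ be a precubical set. Assume: (a) (thin elements conjecture for $F(K)$) the projections $C^{gl}(F(K))\to CR^{gl}(F(K))$ and $C^\pm(F(K))\to CR^\pm(F(K))$ are quasi-isomorphisms; (b) (thin elements conjecture for $\widehat{F(K)}$) the projections $C^{gl}(\widehat{F(K)})\to CR^{gl}(\widehat{F(K)})$ and $C^\pm(\widehat{F(K)})\to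 CR^\pm(\widehat{F(K)})$ are quasi-isomorphisms; (c) (folding quasi-isomorphism conjecture) for $C=F(K)$ and for $C=\widehat{F(K)}$, the folding operators induce quasi-isomorphisms of chain complexes $CF^{gl}(C)\to CR^{gl}(C)$ and $CF^\pm(C)\to CR^\pm(C)$. Then the morphisms of chain complexes $$C^{gl}(F(K))\to C^{gl}(\widehat{F(K)}),\qquad C^-(F(K))\to C^-(\widehat{F(K)}),\qquad C^+(F(K))\to C^+(\widehat{F(K)})$$ induced by the canonical $\omega$-functor $F(K)\to\widehat{F(K)}$ induce isomorphisms in homology. -/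

import Mathlib

open CategoryTheory

universe u v w

namespace HDA

noncomputable section

/-! ### Strict globular omega-categories -/

/-- A strict globular `ω`-category in the one-sorted presentation: `d false n` is the `n`-source
`s_n`, `d true n` is the `n`-target `t_n`, and `comp n x y` is `x *_n y`, which is defined exactly
when `t_n x = s_n y`. -/
structure OmegaCat where
  carrier : Type u
  d : Bool → ℕ → carrier → carrier
  comp : (n : ℕ) → (x y : carrier) → d true n x = d false n y → carrier
  d_d_lt : ∀ (α β : Bool) (m n : ℕ), m < n → ∀ x, d β m (d α n x) = d β m x
  d_d_ge : ∀ (α β : Bool) (m n : ℕ), n ≤ m → ∀ x, d β m (d α n x) = d α n x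
  id_comp : ∀ n x h, comp n (d false n x) x h = x
  comp_id : ∀ n x h, comp n x (d true n x) h = x
  src_comp : ∀ n x y h, d false n (comp n x y h) = d false n x
  tgt_comp : ∀ n x y h, d true n (comp n x y h) = d true n y
  d_comp : ∀ (α : Bool) (m n : ℕ), m ≠ n → ∀ x y h h',
    d α m (comp n x y h) = comp n (d α m x) (d α m y) h'
  assoc : ∀ n x y z hxy hyz h h',
    comp n (comp n x y hxy) z h = comp n x (comp n y z hyz) h'
  interchange : ∀ m n, m ≠ n → ∀ x y z w hxy hzw hxz hyw h h',
    comp m (comp n x y hxy) (comp n z w hzw) h = comp n (comp m x z hxz) (comp m y w hyw) h'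
  finite_dim : ∀ x, ∃ n, d false n x = x ∧ d true n x = x

namespace OmegaCat

instance : CoeSort OmegaCat.{u} (Type u) := ⟨carrier⟩

variable (C : OmegaCat.{u})

/-- The dimension of a morphism: the least `n` with `s_n x = t_n x = x`. -/
def dim (x : C) : ℕ := sInf {n | C.d false n x = x ∧ C.d true n x = x}

theorem d_dim (α : Bool) (x : C) : C.d α (C.dim x) x = x := by
  have h : C.dim x ∈ {n | C.d false n x = x ∧ C.d true n x = x} :=
    Nat.sInf_mem (C.finite_dim x)
  cases α
  · exact h.1
  · exact h.2

theorem dim_le_iff (α : Bool) (n : ℕ) (x : C) : C.dim x ≤ n ↔ C.d α n x = x := by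
  constructor
  · intro h
    have := C.d_d_ge true α n (C.dim x) h x
    rwa [C.d_dim] at this
  · intro h
    have key : ∀ β, C.d β n x = x := by
      intro β
      have := C.d_d_ge α β n n le_rfl x
      rwa [h] at this
    exact Nat.sInf_le ⟨key false, key true⟩

theorem dim_d_le (α : Bool) (n : ℕ) (x : C) : C.dim (C.d α n x) ≤ n :=
  (C.dim_le_iff false n _).2 (C.d_d_ge α false n n le_rfl x)

theorem dim_d_le_dim (α : Bool) (n : ℕ) (x : C) : C.dim (C.d α n x) ≤ C.dim x := by
  rcases le_total n (C.dim x) with h | h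
  · exact (C.dim_d_le α n x).trans h
  · rw [(C.dim_le_iff α n x).1 h]

theorem dim_comp_le {k n : ℕ} {x y : C} (h : C.d true n x = C.d false n y)
    (hx : C.dim x ≤ k) (hy : C.dim y ≤ k) : C.dim (C.comp n x y h) ≤ k := by
  rw [C.dim_le_iff false] at hx hy ⊢
  rcases eq_or_ne k n with rfl | hkn
  · have hx' : C.d true k x = x := (C.dim_le_iff true k x).1 ((C.dim_le_iff false k x).2 hx)
    obtain rfl : x = y := by rw [← hx', h, hy]
    rw [C.src_comp, hx]
    have := C.comp_id k x (by rw [hx', hx])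
    simpa only [hx'] using this.symm
  · rw [C.d_comp false k n hkn x y h (by rw [hx, hy]; exact h)]
    simp only [hx, hy]

/-- `ω`-functors. -/
@[ext]
structure Functor (C : OmegaCat.{u}) (D : OmegaCat.{v}) where
  map : C → D
  map_d : ∀ α n x, map (C.d α n x) = D.d α n (map x)
  map_comp : ∀ n x y h h', map (C.comp n x y h) = D.comp n (map x) (map y) h'

variable {C}

/-- Composition of `ω`-functors, `G` after `F`. -/
def Functor.comp {D : OmegaCat.{v}} {E : OmegaCat.{w}} (G : Functor D E) (F : Functor C D) :
    Functor C E where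
  map x := G.map (F.map x)
  map_d α n x := by rw [F.map_d, G.map_d]
  map_comp n x y h h' := by
    have h'' : D.d true n (F.map x) = D.d false n (F.map y) := by
      rw [← F.map_d, ← F.map_d, h]
    rw [F.map_comp n x y h h'', G.map_comp n _ _ h'' h']

theorem Functor.dim_map_le {D : OmegaCat.{v}} (F : Functor C D) (x : C) :
    D.dim (F.map x) ≤ C.dim x := by
  rw [D.dim_le_iff false, ← F.map_d, C.d_dim]

/-- An `ω`-category is non-contracting if `s_1 x` and `t_1 x` are `1`-dimensional for every
morphism `x` of dimension at least `1`. -/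
def NonContracting (C : OmegaCat.{u}) : Prop :=
  ∀ x : C, 1 ≤ C.dim x → C.dim (C.d false 1 x) = 1 ∧ C.dim (C.d true 1 x) = 1

/-- An `ω`-functor is non-contracting if it maps `1`-dimensional morphisms to `1`-dimensional
morphisms. -/
def Functor.NonContracting {D : OmegaCat.{v}} (F : Functor C D) : Prop :=
  ∀ x : C, C.dim x = 1 → D.dim (F.map x) = 1

theorem NonContracting.dim_d (hC : C.NonContracting) {x : C} (hx : 1 ≤ C.dim x) (α : Bool) :
    C.dim (C.d α 1 x) = 1 := by
  cases α
  · exact (hC x hx).1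
  · exact (hC x hx).2

/-- In any `ω`-category, if `s_1 x` or `t_1 x` is `1`-dimensional, then `x` is at least
`1`-dimensional. -/
theorem one_le_dim_of_d {α : Bool} {n : ℕ} {x : C} (h : 1 ≤ C.dim (C.d α n x)) : 1 ≤ C.dim x :=
  h.trans (C.dim_d_le_dim α n x)

theorem NonContracting.one_le_dim_d (hC : C.NonContracting) {x : C} (hx : 1 ≤ C.dim x)
    (α : Bool) (n : ℕ) : 1 ≤ C.dim (C.d α (n + 1) x) := by
  rcases Nat.eq_zero_or_pos n with rfl | hn
  · exact (hC.dim_d hx α).ge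
  · apply one_le_dim_of_d (α := α) (n := 1)
    rw [C.d_d_lt α α 1 (n + 1) (by omega)]
    exact (hC.dim_d hx α).ge

theorem NonContracting.one_le_dim_comp (hC : C.NonContracting) {x y : C} (hx : 1 ≤ C.dim x)
    (n : ℕ) (h : C.d true (n + 1) x = C.d false (n + 1) y) : 1 ≤ C.dim (C.comp (n + 1) x y h) := by
  apply one_le_dim_of_d (α := false) (n := n + 1)
  rw [C.src_comp]
  exact hC.one_le_dim_d hx false n

theorem Functor.NonContracting.one_le_dim {D : OmegaCat.{v}} {F : Functor C D}
    (hF : F.NonContracting) (hC : C.NonContracting) {x : C} (hx : 1 ≤ C.dim x) :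
    1 ≤ D.dim (F.map x) := by
  apply one_le_dim_of_d (α := false) (n := 1)
  rw [← F.map_d]
  exact (hF _ (hC.dim_d hx false)).ge

/-- The path `ω`-category of a non-contracting `ω`-category: its morphisms are the morphisms of
dimension at least `1`, with all operations shifted by one. -/
def path (C : OmegaCat.{u}) (hC : C.NonContracting) : OmegaCat.{u} where
  carrier := {x : C // 1 ≤ C.dim x}
  d α n x := ⟨C.d α (n + 1) x.1, hC.one_le_dim_d x.2 α n⟩
  comp n x y h := ⟨C.comp (n + 1) x.1 y.1 (congrArg Subtype.val h),
    hC.one_le_dim_comp x.2 n _⟩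
  d_d_lt α β m n h x := Subtype.ext (C.d_d_lt α β _ _ (by omega) x.1)
  d_d_ge α β m n h x := Subtype.ext (C.d_d_ge α β _ _ (by omega) x.1)
  id_comp n x _ := Subtype.ext (C.id_comp _ x.1 _)
  comp_id n x _ := Subtype.ext (C.comp_id _ x.1 _)
  src_comp n x y _ := Subtype.ext (C.src_comp _ x.1 y.1 _)
  tgt_comp n x y _ := Subtype.ext (C.tgt_comp _ x.1 y.1 _)
  d_comp α m n _ x y _ h' :=
    Subtype.ext (C.d_comp α _ _ (by omega) x.1 y.1 _ (congrArg Subtype.val h'))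
  assoc n x y z _ _ _ _ := Subtype.ext (C.assoc _ x.1 y.1 z.1 _ _ _ _)
  interchange m n _ x y z w _ _ _ _ _ _ :=
    Subtype.ext (C.interchange _ _ (by omega) x.1 y.1 z.1 w.1 _ _ _ _ _ _)
  finite_dim x := ⟨C.dim x.1,
    Subtype.ext ((C.dim_le_iff _ _ _).1 (Nat.le_succ _)),
    Subtype.ext ((C.dim_le_iff _ _ _).1 (Nat.le_succ _))⟩

/-- The action of a non-contracting `ω`-functor on path `ω`-categories. -/
def Functor.path {D : OmegaCat.{v}} (F : Functor C D) (hF : F.NonContracting)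
    (hC : C.NonContracting) (hD : D.NonContracting) : Functor (C.path hC) (D.path hD) where
  map x := ⟨F.map x.1, hF.one_le_dim hC x.2⟩
  map_d α n x := Subtype.ext (F.map_d α (n + 1) x.1)
  map_comp n x y h h' := Subtype.ext (F.map_comp (n + 1) x.1 y.1 _ (congrArg Subtype.val h'))

/-- `y` is an inverse of `x` for the composition law `*_r`:
`x *_r y = s_r x = t_r y` and `y *_r x = s_r y = t_r x`. -/
def IsInverse (C : OmegaCat.{u}) (r : ℕ) (x y : C) : Prop :=
  ∃ (h : C.d true r x = C.d false r y) (h' : C.d true r y = C.d false r x),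
    C.comp r x y h = C.d false r x ∧ C.comp r y x h' = C.d false r y

/-- A strict globular `ω`-groupoid: every morphism of dimension at least `1` has an inverse for
each composition law. -/
def IsGroupoid (C : OmegaCat.{u}) : Prop :=
  ∀ x : C, 1 ≤ C.dim x → ∀ r, ∃ y, C.IsInverse r x y

end OmegaCat

/-- Non-contracting `ω`-categories. -/
structure NCat where
  cat : OmegaCat.{u}
  nc : cat.NonContracting

/-- Non-contracting `ω`-functors. -/
structure NFunctor (C D : NCat.{u}) where
  fn : OmegaCat.Functor C.cat D.cat
  nc : fn.NonContracting

/-- The path `ω`-category of a non-contracting `ω`-category. -/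
def NCat.P (C : NCat.{u}) : OmegaCat.{u} := C.cat.path C.nc

/-- The functor induced on path `ω`-categories. -/
def NFunctor.P {C D : NCat.{u}} (F : NFunctor C D) : OmegaCat.Functor C.P D.P :=
  F.fn.path F.nc C.nc D.nc

/-! ### The `ω`-category of a directed complex -/

/-- A chain complex of free abelian groups with a chosen finite basis `Cell`, graded by `deg`; the
boundary of a basis element `a` is `∑ b, inc a b • b`. -/
structure DirectedComplex where
  Cell : Type
  [fintype : Fintype Cell]
  [decEq : DecidableEq Cell]
  deg : Cell → ℤ
  inc : Cell → Cell → ℤ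

attribute [instance] DirectedComplex.fintype DirectedComplex.decEq

namespace DirectedComplex

/-- An element of the `ω`-category of a directed complex: a double sequence of positive chains
`(x_k^-, x_k^+)`, with `x_k^±` of degree `k`, eventually zero, with `x_0^±` of augmentation one
and `∂ x_{k+1}^± = x_k^+ - x_k^-`. Here `coeff k α c` is the coefficient of `c` in `x_k^α`. -/
@[ext]
structure Table (A : DirectedComplex) where
  coeff : ℕ → Bool → A.Cell → ℕ
  deg_eq : ∀ k α c, coeff k α c ≠ 0 → A.deg c = k
  bdry : ∀ (k : ℕ) α c, A.deg c = k →
    ∑ b, (coeff (k + 1) α b : ℤ) * A.inc b c = (coeff k true c : ℤ) - coeff k false c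
  aug : ∀ α, ∑ c, coeff 0 α c = 1
  finite : ∃ n, ∀ k, n ≤ k → ∀ α c, coeff k α c = 0

variable {A : DirectedComplex}

/-- `s_n` and `t_n`: truncation of the double sequence above level `n`. -/
def Table.d (β : Bool) (n : ℕ) (x : A.Table) : A.Table where
  coeff k α c := if k < n then x.coeff k α c else if k = n then x.coeff k β c else 0
  deg_eq k α c h := by
    split_ifs at h with h1 h2
    · exact x.deg_eq k α c h
    · exact x.deg_eq k β c h
    · exact absurd rfl h
  bdry k α c hc := by
    rcases lt_trichotomy (k + 1) n with h | h | h
    · simpa [h, show k < n by omega] using x.bdry k α c hc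
    · simpa [h, show ¬ k + 1 < n by omega, show k < n by omega] using x.bdry k β c hc
    · by_cases h2 : k = n
      · simp [h2]
      · simp [show ¬ k < n by omega, h2, show ¬ k + 1 < n by omega, show k + 1 ≠ n by omega]
  aug α := by
    rcases Nat.eq_zero_or_pos n with rfl | h
    · simpa using x.aug β
    · simpa [h] using x.aug α
  finite := ⟨n + 1, fun k hk α c => by
    simp [show ¬ k < n by omega, show k ≠ n by omega]⟩

theorem Table.lower_eq {n : ℕ} {x y : A.Table} (h : x.d true n = y.d false n) {k : ℕ} (hk : k < n)
    (α : Bool) (c : A.Cell) : x.coeff k α c = y.coeff k α c := by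
  have := congrFun (congrFun (congrFun (congrArg Table.coeff h) k) α) c
  simpa [Table.d, hk] using this

theorem Table.middle_eq {n : ℕ} {x y : A.Table} (h : x.d true n = y.d false n) (c : A.Cell) :
    x.coeff n true c = y.coeff n false c := by
  have := congrFun (congrFun (congrFun (congrArg Table.coeff h) n) true) c
  simpa [Table.d] using this

/-- `x *_n y`, that is `x - t_n x + y`. -/
def Table.comp (n : ℕ) (x y : A.Table) (h : x.d true n = y.d false n) : A.Table where
  coeff k α c :=
    if k < n then x.coeff k α c
    else if k = n then (if α then y.coeff k α c else x.coeff k α c)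
    else x.coeff k α c + y.coeff k α c
  deg_eq k α c h' := by
    split_ifs at h' with h1 h2 h3
    · exact x.deg_eq k α c h'
    · exact y.deg_eq k α c h'
    · exact x.deg_eq k α c h'
    · rcases Nat.eq_zero_or_pos (x.coeff k α c) with h4 | h4
      · exact y.deg_eq k α c (by omega)
      · exact x.deg_eq k α c (by omega)
  bdry k α c hc := by
    rcases lt_trichotomy (k + 1) n with h1 | h1 | h1
    · simpa [h1, show k < n by omega] using x.bdry k α c hc
    · have hk : k < n := by omega
      cases α
      · simpa [h1, hk] using x.bdry k false c hc
      · have := y.bdry k true c hc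
        rw [← Table.lower_eq h hk, ← Table.lower_eq h hk] at this
        simpa [h1, hk] using this
    · rw [show (∑ b, _ : ℤ) = ∑ b, ((x.coeff (k + 1) α b : ℤ) * A.inc b c
          + (y.coeff (k + 1) α b : ℤ) * A.inc b c) from Finset.sum_congr rfl fun b _ => by
        rw [if_neg (by omega), if_neg (by omega)]; push_cast; ring]
      rw [Finset.sum_add_distrib, x.bdry k α c hc, y.bdry k α c hc]
      by_cases h2 : k = n
      · subst h2
        have := Table.middle_eq h c
        simp [this]
      · simp [show ¬ k < n by omega, h2]
        ring
  aug α := by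
    rcases Nat.eq_zero_or_pos n with rfl | h'
    · cases α
      · simpa using x.aug false
      · simpa using y.aug true
    · simpa [h'] using x.aug α
  finite := by
    obtain ⟨a, ha⟩ := x.finite
    obtain ⟨b, hb⟩ := y.finite
    refine ⟨max (max a b) (n + 1), fun k hk α c => ?_⟩
    rw [if_neg (by omega), if_neg (by omega), ha k (by omega), hb k (by omega)]

/-- The strict `ω`-category of a directed complex. -/
def nu (A : DirectedComplex) : OmegaCat.{0} where
  carrier := A.Table
  d := Table.d
  comp := Table.comp
  d_d_lt α β m n h x := by
    ext k γ c
    simp only [Table.d]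
    split_ifs <;> first | rfl | omega
  d_d_ge α β m n h x := by
    ext k γ c
    simp only [Table.d]
    split_ifs <;> first | rfl | omega
  id_comp n x h := by
    ext k γ c
    simp only [Table.d, Table.comp]
    split_ifs <;> first | rfl | omega | simp_all
  comp_id n x h := by
    ext k γ c
    simp only [Table.d, Table.comp]
    split_ifs <;> first | rfl | omega | simp_all
  src_comp n x y h := by
    ext k γ c
    simp only [Table.d, Table.comp]
    split_ifs <;> first | rfl | omega | simp_all
  tgt_comp n x y h := by
    ext k γ c
    simp only [Table.d, Table.comp]
    split_ifs with h1 h2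
    · exact Table.lower_eq h h1 _ _
    · rfl
    · rfl
  d_comp α m n hmn x y h h' := by
    ext k γ c
    simp only [Table.d, Table.comp]
    split_ifs <;> first | rfl | omega
  assoc n x y z _ _ _ _ := by
    ext k γ c
    simp only [Table.comp]
    split_ifs <;> first | rfl | omega
  interchange m n hmn x y z w _ _ _ _ _ _ := by
    ext k γ c
    simp only [Table.comp]
    split_ifs <;> first | rfl | omega
  finite_dim x := by
    obtain ⟨n, hn⟩ := x.finite
    refine ⟨n, ?_, ?_⟩ <;>
    · ext k γ c
      simp only [Table.d]
      split_ifs with h1 h2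
      · rfl
      · rw [hn k (by omega), hn k (by omega)]
      · rw [hn k (by omega)]

/-- A map of directed complexes that sends every basis element to a basis element of the same
degree or to zero (`none`). -/
structure Hom (A B : DirectedComplex) where
  toFun : A.Cell → Option B.Cell
  deg_eq : ∀ a b, toFun a = some b → B.deg b = A.deg a
  vertex : ∀ a, A.deg a = 0 → (toFun a).isSome
  chain : ∀ (k : ℕ) a, A.deg a = k + 1 → ∀ b, B.deg b = k →
    ∑ v, (if toFun v = some b then A.inc a v else 0) =
      (toFun a).elim 0 (fun a' => B.inc a' b)

variable {B : DirectedComplex}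

/-- The image of a double sequence of chains under a map of directed complexes. -/
def Hom.push (f : Hom A B) (x : A.Table) : B.Table where
  coeff k α b := ∑ a, if f.toFun a = some b then x.coeff k α a else 0
  deg_eq k α b h := by
    obtain ⟨a, -, ha⟩ := Finset.exists_ne_zero_of_sum_ne_zero h
    split_ifs at ha with h'
    · rw [f.deg_eq a b h', x.deg_eq k α a ha]
    · exact absurd rfl ha
  bdry k α c hc := by
    have e1 : ∀ b, ((∑ a, if f.toFun a = some b then x.coeff (k + 1) α a else 0 : ℕ) : ℤ) *
        B.inc b c = ∑ a, if f.toFun a = some b then (x.coeff (k + 1) α a : ℤ) * B.inc b c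
          else 0 := by
      intro b
      push_cast
      rw [Finset.sum_mul]
      exact Finset.sum_congr rfl fun a _ => by split_ifs <;> simp
    have e2 : ∀ a, (∑ b, if f.toFun a = some b then (x.coeff (k + 1) α a : ℤ) * B.inc b c else 0)
        = ∑ v, if f.toFun v = some c then (x.coeff (k + 1) α a : ℤ) * A.inc a v else 0 := by
      intro a
      by_cases ha : x.coeff (k + 1) α a = 0
      · simp [ha]
      have h1 := f.chain k a (by simpa using x.deg_eq _ _ _ ha) c hc
      have h2 : (∑ v, if f.toFun v = some c then (x.coeff (k + 1) α a : ℤ) * A.inc a v else 0)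
          = (x.coeff (k + 1) α a : ℤ) * ∑ v, (if f.toFun v = some c then A.inc a v else 0) := by
        rw [Finset.mul_sum]
        exact Finset.sum_congr rfl fun v _ => by split_ifs <;> simp
      rw [h2, h1]
      cases hfa : f.toFun a with
      | none => simp
      | some a' => simp
    simp_rw [e1]
    rw [Finset.sum_comm]
    simp_rw [e2]
    rw [Finset.sum_comm]
    push_cast
    rw [← Finset.sum_sub_distrib]
    refine Finset.sum_congr rfl fun v _ => ?_
    split_ifs with hv
    · exact x.bdry k α v (by rw [← f.deg_eq v c hv, hc])
    · simp
  aug α := by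
    rw [Finset.sum_comm, ← x.aug α]
    refine Finset.sum_congr rfl fun a _ => ?_
    by_cases ha : x.coeff 0 α a = 0
    · simp [ha]
    obtain ⟨b, hb⟩ := Option.isSome_iff_exists.1 (f.vertex a (x.deg_eq 0 α a ha))
    simp [hb]
  finite := by
    obtain ⟨n, hn⟩ := x.finite
    exact ⟨n, fun k hk α c => Finset.sum_eq_zero fun a _ => by simp [hn k hk]⟩

/-- The `ω`-functor induced by a map of directed complexes. -/
def Hom.functor (f : Hom A B) : OmegaCat.Functor A.nu B.nu where
  map := f.push
  map_d α n x := by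
    apply Table.ext
    funext k γ c
    change (∑ a, if f.toFun a = some c then (x.d α n).coeff k γ a else 0) = _
    simp only [Table.d, Hom.push, nu]
    split_ifs <;> simp
  map_comp n x y h h' := by
    apply Table.ext
    funext k γ c
    change (∑ a, if f.toFun a = some c then (x.comp n y h).coeff k γ a else 0) = _
    simp only [Table.comp, Hom.push, nu]
    split_ifs <;> first | rfl | skip
    rw [← Finset.sum_add_distrib]
    exact Finset.sum_congr rfl fun a _ => by split_ifs <;> simp

theorem Hom.push_push {C D : DirectedComplex} (f : Hom A B) (g : Hom B D) (f' : Hom A C)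
    (g' : Hom C D) (h : ∀ a, (f.toFun a).bind g.toFun = (f'.toFun a).bind g'.toFun)
    (x : A.Table) : g.push (f.push x) = g'.push (f'.push x) := by
  have key : ∀ (B : DirectedComplex) (f : Hom A B) (g : Hom B D) k α c,
      (g.push (f.push x)).coeff k α c
        = ∑ a, if (f.toFun a).bind g.toFun = some c then x.coeff k α a else 0 := by
    intro B f g k α c
    change (∑ b, if g.toFun b = some c then
      (∑ a, if f.toFun a = some b then x.coeff k α a else 0) else 0) = _
    have : ∀ b, (if g.toFun b = some c then
        (∑ a, if f.toFun a = some b then x.coeff k α a else 0) else 0)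
        = ∑ a, if f.toFun a = some b then (if g.toFun b = some c then x.coeff k α a else 0)
          else 0 := by
      intro b
      split_ifs <;> simp
    simp_rw [this]
    rw [Finset.sum_comm]
    refine Finset.sum_congr rfl fun a _ => ?_
    cases f.toFun a <;> simp
  apply Table.ext
  funext k α c
  rw [key, key]
  simp_rw [h]

/-- The `0`-dimensional element given by a basis element of degree zero. -/
def point (A : DirectedComplex) (c : A.Cell) (hc : A.deg c = 0) : A.Table where
  coeff k _ b := if k = 0 ∧ b = c then 1 else 0
  deg_eq k α b h := by
    have : k = 0 ∧ b = c := by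
      by_contra h'
      simp [h'] at h
    rw [this.1, this.2, hc]; rfl
  bdry k α b _ := by simp
  aug α := by simp
  finite := ⟨1, fun k hk α b => by simp [show k ≠ 0 by omega]⟩

theorem push_point (f : Hom A B) (c : A.Cell) (hc : A.deg c = 0) (c' : B.Cell)
    (hc' : B.deg c' = 0) (h : f.toFun c = some c') :
    f.push (A.point c hc) = B.point c' hc' := by
  apply Table.ext
  funext k α b
  change (∑ a, if f.toFun a = some b then (if k = 0 ∧ a = c then 1 else 0) else 0) = _
  simp only [point]
  rw [Finset.sum_eq_single c (fun a _ ha => by simp [ha]) (by simp)]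
  rw [h]
  by_cases hk : k = 0 <;> simp [hk, eq_comm]

theorem dim_point (c : A.Cell) (hc : A.deg c = 0) : A.nu.dim (A.point c hc) = 0 := by
  apply Nat.le_zero.1
  refine (A.nu.dim_le_iff false 0 _).2 ?_
  apply Table.ext
  funext k α b
  change ((A.point c hc).d false 0).coeff k α b = _
  by_cases hk : k = 0 <;> simp [hk, point, Table.d]

end DirectedComplex

/-! ### Cubes and simplices -/

/-- The sign `(-1)^q`, where `q` is the number of elements `j < i` of the subset `Z`. -/
def parity {n : ℕ} (Z : Fin n → Bool) (i : Fin n) : ℤ :=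
  ∏ j, if j < i ∧ Z j = true then -1 else 1

/-- An alphabet with a distinguished letter `o` (for the cubes: the letter `0`; for the simplices:
"this vertex belongs to the face") and a weight `±1` for each other letter. -/
structure Alphabet where
  L : Type
  [fintype : Fintype L]
  [decEq : DecidableEq L]
  o : L
  wt : L → ℤ
  wt_o : wt o = 0
  wt_unit : ∀ l, l ≠ o → wt l = 1 ∨ wt l = -1

attribute [instance] Alphabet.fintype Alphabet.decEq

namespace Alphabet

variable (S : Alphabet)

/-- The set of positions of the distinguished letter in a word. -/
def zeros {n : ℕ} (w : Fin n → S.L) : Fin n → Bool := fun i => decide (w i = S.o)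

/-- The number of distinguished letters in a word. -/
def count {n : ℕ} (w : Fin n → S.L) : ℤ := ∑ i, if w i = S.o then 1 else 0

/-- The coefficient of the word `v` in
`∂ w = ∑_{i, w_i = o} (-1)^{#{j < i, w_j = o}} ∑_l wt(l) • w[w_i := l]`. -/
def incidence {n : ℕ} (w v : Fin n → S.L) : ℤ :=
  ∑ i, ∑ l, if w i = S.o ∧ v = Function.update w i l then
    S.wt l * parity (S.zeros w) i else 0

/-- The directed complex of words of length `n`. The degree of a word is the number of its
distinguished letters plus a shift. -/
def words (shift : ℤ) (n : ℕ) : DirectedComplex where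
  Cell := Fin n → S.L
  deg w := S.count w + shift
  inc := S.incidence

variable {S}

theorem parity_insertNth {n : ℕ} (p : Fin (n + 1)) (l : S.L) (hl : l ≠ S.o) (w : Fin n → S.L)
    (i : Fin n) : parity (S.zeros (p.insertNth (α := fun _ => S.L) l w)) (p.succAbove i)
      = parity (S.zeros w) i := by
  simp [parity, zeros, Fin.prod_univ_succAbove _ p, hl]

theorem count_insertNth {n : ℕ} (p : Fin (n + 1)) (l : S.L) (hl : l ≠ S.o) (w : Fin n → S.L) :
    S.count (p.insertNth (α := fun _ => S.L) l w) = S.count w := by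
  simp only [count, Fin.sum_univ_succAbove _ p, Fin.insertNth_apply_same,
    Fin.insertNth_apply_succAbove, hl, if_false, zero_add]

theorem sum_incidence {n : ℕ} (g : (Fin n → S.L) → ℤ) (w : Fin n → S.L) :
    ∑ v, g v * S.incidence w v = ∑ i, ∑ l, if w i = S.o then
      S.wt l * parity (S.zeros w) i * g (Function.update w i l) else 0 := by
  simp only [incidence, Finset.mul_sum]
  rw [Finset.sum_comm]
  refine Finset.sum_congr rfl fun i _ => ?_
  rw [Finset.sum_comm]
  refine Finset.sum_congr rfl fun l _ => ?_
  rw [Finset.sum_eq_single (Function.update w i l) (fun v _ hv => by simp [hv]) (by simp)]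
  by_cases h : w i = S.o <;> simp [h, mul_comm]

theorem sum_incidence_ite {n : ℕ} (p : (Fin n → S.L) → Prop) [DecidablePred p]
    (w : Fin n → S.L) :
    (∑ v, if p v then S.incidence w v else 0) = ∑ i, ∑ l, if w i = S.o then
      (if p (Function.update w i l) then S.wt l * parity (S.zeros w) i else 0) else 0 := by
  have := sum_incidence (fun v => if p v then 1 else 0) w
  simpa using this

theorem incidence_insertNth {n : ℕ} (p : Fin (n + 1)) (l : S.L) (hl : l ≠ S.o)
    (w : Fin n → S.L) (b : Fin (n + 1) → S.L) :
    (∑ v, if p.insertNth (α := fun _ => S.L) l v = b then S.incidence w v else 0)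
      = S.incidence (p.insertNth (α := fun _ => S.L) l w) b := by
  rw [sum_incidence_ite, incidence, Fin.sum_univ_succAbove _ p]
  simp only [Fin.insertNth_apply_same, Fin.insertNth_apply_succAbove, hl, false_and, if_false,
    Finset.sum_const_zero, zero_add, parity_insertNth p l hl, ← Fin.insertNth_update]
  refine Finset.sum_congr rfl fun i _ => Finset.sum_congr rfl fun l' _ => ?_
  by_cases h1 : w i = S.o
  · simp [h1, eq_comm]
  · simp [h1]

/-- Inserting a fixed non-distinguished letter `l` at the position `p`. -/
def insert (shift : ℤ) {n : ℕ} (p : Fin (n + 1)) (l : S.L) (hl : l ≠ S.o) :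
    DirectedComplex.Hom (S.words shift n) (S.words shift (n + 1)) where
  toFun w := some (p.insertNth (α := fun _ => S.L) l w)
  deg_eq w v h := by
    obtain rfl := Option.some.inj h
    exact congrArg (· + shift) (count_insertNth p l hl w)
  vertex _ _ := rfl
  chain k a _ b _ := by
    refine Eq.trans ?_ (incidence_insertNth p l hl a b)
    refine Finset.sum_congr rfl fun v _ => ?_
    by_cases h : p.insertNth (α := fun _ => S.L) l v = b
    · rw [if_pos h]; exact if_pos (congrArg some h)
    · rw [if_neg h]; exact if_neg fun h' => h (Option.some.inj h')

theorem insertNth_comm {n : ℕ} {L : Type} (i j : Fin (n + 1)) (hij : i ≤ j) (a b : L)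
    (w : Fin n → L) :
    j.succ.insertNth (α := fun _ => L) b (i.insertNth (α := fun _ => L) a w)
      = i.castSucc.insertNth (α := fun _ => L) a (j.insertNth (α := fun _ => L) b w) := by
  have h1 : i.castSucc.succAbove j = j.succ := Fin.succAbove_castSucc_of_le i j hij
  have h2 : j.predAbove i.castSucc = i := Fin.predAbove_castSucc_of_le j i hij
  funext k
  rcases Fin.eq_self_or_eq_succAbove j.succ k with rfl | ⟨m, rfl⟩
  · rw [Fin.insertNth_apply_same, ← h1, Fin.insertNth_apply_succAbove, Fin.insertNth_apply_same]
  rw [Fin.insertNth_apply_succAbove]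
  rcases Fin.eq_self_or_eq_succAbove i m with rfl | ⟨m, rfl⟩
  · have h3 := Fin.succAbove_succAbove_predAbove m.castSucc j
    rw [h1, h2] at h3
    rw [h3, Fin.insertNth_apply_same, Fin.insertNth_apply_same]
  · have h3 := Fin.succAbove_succAbove_succAbove_predAbove i.castSucc j m
    rw [h1, h2] at h3
    rw [h3]
    simp only [Fin.insertNth_apply_succAbove]

/-- `T_α(w)`: every letter `w_i ≠ o` satisfies `wt(w_i) (-1)^{#{j < i, w_j = o}} = α`. -/
def Extreme (S : Alphabet) {n : ℕ} (α : Bool) (w : Fin n → S.L) : Prop :=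
  ∀ i, w i ≠ S.o → S.wt (w i) * parity (S.zeros w) i = if α then 1 else -1

instance {n : ℕ} (α : Bool) (w : Fin n → S.L) : Decidable (S.Extreme α w) := by
  unfold Extreme; infer_instance

theorem parity_cons_succ {n : ℕ} (l : S.L) (w : Fin n → S.L) (i : Fin n) :
    parity (S.zeros (Fin.cons (α := fun _ => S.L) l w)) i.succ
      = (if l = S.o then -1 else 1) * parity (S.zeros w) i := by
  simp [parity, zeros, Fin.prod_univ_succ]

theorem parity_zero {n : ℕ} (Z : Fin (n + 1) → Bool) : parity Z 0 = 1 := by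
  simp [parity]

theorem count_cons {n : ℕ} (l : S.L) (w : Fin n → S.L) :
    S.count (Fin.cons (α := fun _ => S.L) l w) = (if l = S.o then 1 else 0) + S.count w := by
  simp only [count, Fin.sum_univ_succ, Fin.cons_zero, Fin.cons_succ]

theorem extreme_cons_o {n : ℕ} (α : Bool) (w : Fin n → S.L) :
    S.Extreme α (Fin.cons (α := fun _ => S.L) S.o w) ↔ S.Extreme (!α) w := by
  simp only [Extreme, Fin.forall_fin_succ, Fin.cons_zero, Fin.cons_succ, parity_cons_succ]
  cases α <;> simp <;> constructor <;> intro h i hi <;> linarith [h i hi]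

theorem extreme_cons {n : ℕ} (α : Bool) (l : S.L) (hl : l ≠ S.o) (w : Fin n → S.L) :
    S.Extreme α (Fin.cons (α := fun _ => S.L) l w) ↔
      S.wt l = (if α then 1 else -1) ∧ S.Extreme α w := by
  simp only [Extreme, Fin.forall_fin_succ, Fin.cons_zero, Fin.cons_succ, parity_cons_succ,
    parity_zero, hl, if_false, one_mul, mul_one, ne_eq, not_false_eq_true, true_implies]

/-- Reindexing: the sum over `w` of the coefficients of `v` in `∂ w`. -/
theorem sum_incidence' {n : ℕ} (g : (Fin n → S.L) → ℤ) (v : Fin n → S.L) :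
    ∑ w, g w * S.incidence w v
      = ∑ i, g (Function.update v i S.o) * (S.wt (v i) * parity (S.zeros v) i) := by
  simp only [incidence, Finset.mul_sum]
  rw [Finset.sum_comm]
  refine Finset.sum_congr rfl fun i _ => ?_
  rw [Finset.sum_eq_single (Function.update v i S.o)]
  · rw [Finset.sum_eq_single (v i)]
    · have : parity (S.zeros (Function.update v i S.o)) i = parity (S.zeros v) i := by
        refine Finset.prod_congr rfl fun j _ => ?_
        by_cases hj : j < i
        · simp [zeros, Function.update_of_ne hj.ne]
        · simp [hj]
      simp [this]
    · intro l _ hl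
      rw [if_neg, mul_zero]
      rintro ⟨-, h⟩
      apply hl
      have := congrFun h i
      simpa using this.symm
    · simp
  · intro w _ hw
    refine Finset.sum_eq_zero fun l _ => ?_
    rw [if_neg, mul_zero]
    rintro ⟨h, rfl⟩
    apply hw
    rw [Function.update_idem, ← h, Function.update_eq_self]
  · simp

theorem sum_extreme {n : ℕ} (β : Bool) (v : Fin n → S.L) :
    ∑ i, (if S.Extreme β (Function.update v i S.o) then (1 : ℤ) else 0) *
        (S.wt (v i) * parity (S.zeros v) i)
      = (if S.Extreme true v then 1 else 0) - (if S.Extreme false v then 1 else 0) := by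
  induction n generalizing β with
  | zero => simp [Extreme]
  | succ n ih =>
    obtain ⟨l, v, rfl⟩ : ∃ l v', v = Fin.cons (α := fun _ => S.L) l v' :=
      ⟨v 0, Fin.tail v, (Fin.cons_self_tail v).symm⟩
    rw [Fin.sum_univ_succ]
    simp only [Fin.cons_zero, Fin.cons_succ, Fin.update_cons_zero, parity_zero,
      parity_cons_succ, mul_one]
    simp only [← Fin.cons_update]
    by_cases hl : l = S.o
    · subst hl
      simp only [extreme_cons_o, S.wt_o, mul_zero, zero_add, if_true, Bool.not_true,
        Bool.not_false]
      have := ih (!β) v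
      simp only [neg_mul, one_mul, mul_neg, Finset.sum_neg_distrib, this]
      ring
    · simp only [extreme_cons _ _ hl, extreme_cons_o, hl, if_false, one_mul]
      have := ih β v
      rcases S.wt_unit l hl with h | h <;> cases β <;>
        (simp_all; try ring)

/-- The sum of the words of degree `0` satisfying `T_α` is a single word. -/
def HasEnds (S : Alphabet) (shift : ℤ) (n : ℕ) : Prop :=
  ∀ α, (∑ w : Fin n → S.L, if S.count w + shift = (0 : ℕ) ∧ S.Extreme α w then 1 else 0) = 1

theorem count_update {n : ℕ} (v : Fin n → S.L) (i : Fin n) (hi : v i ≠ S.o) :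
    S.count (Function.update v i S.o) = S.count v + 1 := by
  have h : ∀ w : Fin n → S.L, S.count w = (if w i = S.o then 1 else 0)
      + ∑ j ∈ Finset.univ.erase i, if w j = S.o then 1 else 0 := fun w =>
    (Finset.add_sum_erase _ _ (Finset.mem_univ i)).symm
  rw [h v, h (Function.update v i S.o), if_neg hi, Function.update_self, if_pos rfl,
    Finset.sum_congr rfl fun j hj => by rw [Function.update_of_ne (Finset.ne_of_mem_erase hj)]]
  ring

theorem count_nonneg {n : ℕ} (w : Fin n → S.L) : 0 ≤ S.count w :=
  Finset.sum_nonneg fun i _ => by split_ifs <;> simp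

theorem count_le {n : ℕ} (w : Fin n → S.L) : S.count w ≤ n := by
  refine (Finset.sum_le_card_nsmul _ _ 1 fun i _ => by split_ifs <;> simp).trans ?_
  simp

theorem sum_top {n : ℕ} (shift : ℤ) (k : ℕ) (α : Bool) (v : Fin n → S.L)
    (hv : S.count v + shift = k) :
    ∑ w, ((if S.count w + shift = (k + 1 : ℕ) ∧ S.Extreme α w then 1 else 0 : ℕ) : ℤ) *
        S.incidence w v
      = ((if S.count v + shift = k ∧ S.Extreme true v then 1 else 0 : ℕ) : ℤ)
        - (if S.count v + shift = k ∧ S.Extreme false v then 1 else 0 : ℕ) := by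
  push_cast
  refine (sum_incidence' (fun w => if S.count w + shift = (k : ℤ) + 1 ∧ S.Extreme α w then 1
    else 0) v).trans ?_
  simp only [hv, true_and]
  refine Eq.trans (Finset.sum_congr rfl fun i _ => ?_) (sum_extreme α v)
  by_cases hi : v i = S.o
  · simp [hi, S.wt_o]
  · have : S.count (Function.update v i S.o) + shift = (k : ℤ) + 1 := by
      rw [count_update v i hi]; linarith
    simp only [this, true_and]

/-- The generating element: its `k`-dimensional source and target are the sums of the words of
degree `k` satisfying `T_-` and `T_+` respectively; in degree `n + shift`, it is the word all of
whose letters are distinguished. -/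
def top (S : Alphabet) (shift : ℤ) (n : ℕ) (h : S.HasEnds shift n) :
    (S.words shift n).Table where
  coeff k α := fun w : Fin n → S.L => if S.count w + shift = k ∧ S.Extreme α w then 1 else 0
  deg_eq k α := fun (w : Fin n → S.L) h => by
    by_contra h'
    exact h (if_neg fun h'' => h' h''.1)
  bdry k α v hv := sum_top shift k α v hv
  aug α := h α
  finite := by
    refine ⟨(n + shift).toNat + 1, fun k hk α w => if_neg fun h => ?_⟩
    have := count_le w
    omega

end Alphabet

theorem Alphabet.sum_cons (S : Alphabet) {n : ℕ} (f : (Fin (n + 1) → S.L) → ℕ) :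
    ∑ w, f w = ∑ l, ∑ v : Fin n → S.L, f (Fin.cons (α := fun _ => S.L) l v) := by
  rw [← Fintype.sum_prod_type']
  exact (Fintype.sum_equiv (Fin.consEquiv (fun _ : Fin (n + 1) => S.L)) _ _ fun p => rfl).symm

/-- The number of words with `c` distinguished letters satisfying `T_α`. -/
def Alphabet.numExtreme (S : Alphabet) (n : ℕ) (c : ℤ) (α : Bool) : ℕ :=
  ∑ w : Fin n → S.L, if S.count w = c ∧ S.Extreme α w then 1 else 0

theorem Alphabet.numExtreme_succ (S : Alphabet) (n : ℕ) (c : ℤ) (α : Bool) :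
    S.numExtreme (n + 1) c α = S.numExtreme n (c - 1) (!α) +
      ∑ l, if l ≠ S.o ∧ S.wt l = (if α then 1 else -1) then S.numExtreme n c α else 0 := by
  unfold numExtreme
  rw [S.sum_cons, ← Finset.add_sum_erase _ _ (Finset.mem_univ S.o),
    ← Finset.add_sum_erase (Finset.univ : Finset S.L) (fun l => if l ≠ S.o ∧ _ then _ else 0)
      (Finset.mem_univ S.o), if_neg (fun h => h.1 rfl), zero_add]
  congr 1
  · refine Finset.sum_congr rfl fun v _ => ?_
    simp only [count_cons, extreme_cons_o, if_true]
    congr 2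
    rw [eq_sub_iff_add_eq, add_comm]
  · refine Finset.sum_congr rfl fun l hl => ?_
    have hl' := Finset.ne_of_mem_erase hl
    simp only [count_cons, extreme_cons α l hl', hl', if_false, zero_add]
    by_cases h : S.wt l = (if α then 1 else -1)
    · simp [h, hl']
    · simp [h]

theorem Alphabet.numExtreme_neg (S : Alphabet) (n : ℕ) (c : ℤ) (hc : c < 0) (α : Bool) :
    S.numExtreme n c α = 0 :=
  Finset.sum_eq_zero fun w _ => if_neg fun h => by
    have := count_nonneg w
    omega

theorem Alphabet.numExtreme_zero (S : Alphabet) (c : ℤ) (α : Bool) :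
    S.numExtreme 0 c α = if c = 0 then 1 else 0 := by
  simp [numExtreme, Extreme, count, eq_comm]

/-- The letters `-`, `0`, `+`; the distinguished letter is `0`. -/
def cubeAlphabet : Alphabet where
  L := SignType
  o := 0
  wt l := (l : ℤ)
  wt_o := rfl
  wt_unit := by decide

/-- The directed complex of the `n`-cube: the faces are the words of length `n` in `-`, `0`, `+`;
in the boundary, the `i`-th zero of a face is replaced by `(-)^i` with coefficient `-1` (the source
side) and by `(-)^{i+1}` with coefficient `+1` (the target side). -/
def cube (n : ℕ) : DirectedComplex := cubeAlphabet.words 0 n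

/-- The alphabet for faces of simplices as subsets of the set of vertices: `true` for the vertices
of the face, `false` for the others. -/
def simplexAlphabet : Alphabet where
  L := Bool
  o := true
  wt l := if l then 0 else -1
  wt_o := rfl
  wt_unit := by decide

/-- The directed complex of the `n`-simplex: the faces are the nonempty subsets of `{0, …, n}`
(the empty subset has degree `-1` and does not contribute); in the boundary, removing the `i`-th
element, counted from `1`, has coefficient `(-1)^i`, so that the faces obtained by removing an
element in odd position form the source, and the other ones form the target. -/
def simplex (n : ℕ) : DirectedComplex := simplexAlphabet.words (-1) (n + 1)

theorem cube_hasEnds (n : ℕ) : cubeAlphabet.HasEnds 0 n := by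
  have key : ∀ n α, cubeAlphabet.numExtreme n 0 α = 1 := by
    intro n
    induction n with
    | zero => intro α; simp [Alphabet.numExtreme_zero]
    | succ n ih =>
      intro α
      rw [Alphabet.numExtreme_succ, Alphabet.numExtreme_neg _ _ _ (by norm_num), ih]
      revert α
      decide
  intro α
  simpa [Alphabet.numExtreme] using key n α

theorem simplex_hasEnds (n : ℕ) : simplexAlphabet.HasEnds (-1) (n + 1) := by
  have k0 : ∀ n, simplexAlphabet.numExtreme n 0 false = 1 := by
    intro n
    induction n with
    | zero => simp [Alphabet.numExtreme_zero]
    | succ n ih =>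
      rw [Alphabet.numExtreme_succ, Alphabet.numExtreme_neg _ _ _ (by norm_num), ih]
      decide
  have hs' : ∀ a : ℕ, (∑ l, if l ≠ simplexAlphabet.o ∧
      simplexAlphabet.wt l = (if true = true then 1 else -1) then a else 0) = 0 := by
    intro a
    change (∑ l : Bool, if l ≠ true ∧ (if l then (0 : ℤ) else -1) =
      (if true = true then 1 else -1) then a else 0) = 0
    simp
  have k1 : ∀ n, simplexAlphabet.numExtreme (n + 1) 1 true = 1 := by
    intro n
    rw [Alphabet.numExtreme_succ, sub_self, Bool.not_true, k0 n, hs']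
  have k2 : ∀ n, simplexAlphabet.numExtreme (n + 1) 1 false = 1 := by
    intro n
    rw [Alphabet.numExtreme_succ, sub_self, Bool.not_false]
    have hs : ∀ a : ℕ, (∑ l, if l ≠ simplexAlphabet.o ∧
        simplexAlphabet.wt l = (if false = true then 1 else -1) then a else 0) = a := by
      intro a
      change (∑ l : Bool, if l ≠ true ∧ (if l then (0 : ℤ) else -1) =
        (if false = true then 1 else -1) then a else 0) = a
      simp
    rw [hs]
    induction n with
    | zero => simp [Alphabet.numExtreme_zero]
    | succ n ih =>
      rw [Alphabet.numExtreme_succ _ n 1 false, sub_self, Bool.not_false, hs, ih,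
        Alphabet.numExtreme_succ, Alphabet.numExtreme_neg _ _ _ (by norm_num), hs']
  intro α
  have h : ∀ c : ℤ, c + -1 = (0 : ℕ) ↔ c = 1 := fun c => by
    constructor <;> intro h <;> simp at h ⊢ <;> omega
  simp only [h]
  cases α
  · exact k2 n
  · exact k1 n

/-- The generating morphism `0_n` (the interior) of the `ω`-category `I^n`. -/
def cubeTop (n : ℕ) : (cube n).Table := cubeAlphabet.top 0 n (cube_hasEnds n)

/-- The generating morphism `(0 < 1 < ⋯ < n)` of the `ω`-category `Δ^n`. -/
def simplexTop (n : ℕ) : (simplex n).Table := simplexAlphabet.top (-1) (n + 1) (simplex_hasEnds n)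

/-! ### Globes -/

/-- The directed complex of the `n`-globe: one basis element of degree `n` and two basis elements
`(k, ±)` of each degree `k < n`, with boundary `(k, +) - (k, -)` for every element of degree
`k + 1`. -/
def globe (n : ℕ) : DirectedComplex where
  Cell := Option (Fin n × Bool)
  deg c := c.elim (n : ℤ) fun p => ((p.1 : ℕ) : ℤ)
  inc a b := b.elim 0 fun p =>
    if a.elim (n : ℤ) (fun p => ((p.1 : ℕ) : ℤ)) = (p.1 : ℕ) + 1 then (if p.2 then 1 else -1) else 0

namespace Globe

variable {n : ℕ}

theorem deg_none : (globe n).deg (none : Option (Fin n × Bool)) = n := rfl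

theorem deg_some (p : Fin n × Bool) : (globe n).deg (some p : Option (Fin n × Bool)) = (p.1 : ℕ) :=
  rfl

theorem inc_none (a : (globe n).Cell) : (globe n).inc a (none : Option (Fin n × Bool)) = 0 := rfl

theorem inc_some (a : (globe n).Cell) (p : Fin n × Bool) :
    (globe n).inc a (some p : Option (Fin n × Bool)) =
      if (globe n).deg a = (p.1 : ℕ) + 1 then (if p.2 then 1 else -1) else 0 := rfl

theorem sum_cell (f : (globe n).Cell → ℤ) : ∑ c, f c = f (none : Option (Fin n × Bool)) +
    ∑ k : Fin n, (f (some (k, true) : Option (Fin n × Bool)) +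
      f (some (k, false) : Option (Fin n × Bool))) := by
  refine (Fintype.sum_option f).trans ?_
  congr 1
  refine (Fintype.sum_prod_type _).trans ?_
  exact Finset.sum_congr rfl fun k _ => Fintype.sum_bool _

/-- The sum of the coefficients of `x_k^γ`. -/
def mass (x : (globe n).Table) (k : ℕ) (γ : Bool) : ℤ := ∑ c, (x.coeff k γ c : ℤ)

theorem coeff_eq_zero (x : (globe n).Table) (k : ℕ) (γ : Bool) (c : (globe n).Cell)
    (h : (globe n).deg c ≠ k) : x.coeff k γ c = 0 := by
  by_contra h'
  exact h (x.deg_eq _ _ _ h')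

theorem mass_eq (x : (globe n).Table) (k : Fin n) (γ : Bool) :
    mass x k γ = x.coeff k γ (some (k, true) : Option (Fin n × Bool)) +
      x.coeff k γ (some (k, false) : Option (Fin n × Bool)) := by
  rw [mass, sum_cell, coeff_eq_zero x k γ none (by
    rw [deg_none]; have := k.2; omega), Nat.cast_zero, zero_add,
    Finset.sum_eq_single k]
  · intro b _ hb
    have hb' : ((b : ℕ) : ℤ) ≠ ((k : ℕ) : ℤ) := by
      intro h; exact hb (Fin.ext (by exact_mod_cast h))
    rw [coeff_eq_zero x k γ (some (b, true)) hb', coeff_eq_zero x k γ (some (b, false)) hb']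
    simp
  · simp

theorem bdry (x : (globe n).Table) (k : Fin n) (γ β : Bool) :
    (x.coeff k true (some (k, β) : Option (Fin n × Bool)) : ℤ) -
      x.coeff k false (some (k, β) : Option (Fin n × Bool)) =
      (if β then 1 else -1) * mass x (k + 1) γ := by
  rw [← x.bdry k γ (some (k, β) : Option (Fin n × Bool)) rfl, mass, Finset.mul_sum]
  refine Finset.sum_congr rfl fun c _ => ?_
  by_cases h : (globe n).deg c = ((k + 1 : ℕ) : ℤ)
  · rw [inc_some, if_pos (by rw [h]; push_cast; rfl)]
    ring
  · rw [coeff_eq_zero x _ γ c h]; simp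

theorem coeff_of_mass {x : (globe n).Table} {k : ℕ} {γ : Bool} (h : mass x k γ = 0)
    (c : (globe n).Cell) : x.coeff k γ c = 0 := by
  have := (Finset.sum_eq_zero_iff_of_nonneg (fun c _ => Int.natCast_nonneg _)).1 h c
    (Finset.mem_univ c)
  exact_mod_cast this

/-- The generating morphism of the `n`-globe. -/
def top (n : ℕ) : (globe n).Table where
  coeff k α := fun c : Option (Fin n × Bool) =>
    c.elim (if k = n then 1 else 0) fun p => if (p.1 : ℕ) = k ∧ p.2 = α then 1 else 0
  deg_eq k α := fun (c : Option (Fin n × Bool)) h => by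
    cases c with
    | none =>
      have : k = n := by by_contra h'; simp [h'] at h
      rw [deg_none, this]
    | some p =>
      have : (p.1 : ℕ) = k := by by_contra h'; simp [h'] at h
      rw [deg_some, this]
  bdry k α := fun (c : Option (Fin n × Bool)) hc => by
    cases c with
    | none =>
      simp [inc_none]
    | some p =>
      rw [deg_some] at hc
      have hk : (p.1 : ℕ) = k := by exact_mod_cast hc
      obtain ⟨i, β⟩ := p
      obtain rfl : (i : ℕ) = k := hk
      have e : ∀ b : (globe n).Cell, (((b : Option (Fin n × Bool)).elim
            (if (i : ℕ) + 1 = n then 1 else 0)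
            (fun p => if (p.1 : ℕ) = (i : ℕ) + 1 ∧ p.2 = α then 1 else 0) : ℕ) : ℤ) *
          (globe n).inc b (some (i, β) : Option (Fin n × Bool)) =
          (if β then 1 else -1) * (((b : Option (Fin n × Bool)).elim
            (if (i : ℕ) + 1 = n then 1 else 0)
            (fun p => if (p.1 : ℕ) = (i : ℕ) + 1 ∧ p.2 = α then 1 else 0) : ℕ) : ℤ) := by
        intro b
        rw [inc_some]
        cases b with
        | none =>
          rw [deg_none]
          by_cases h : (i : ℕ) + 1 = n
          · have hi : (n : ℤ) = ((i : ℕ) : ℤ) + 1 := by omega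
            rw [if_pos hi]; ring
          · simp [h]
        | some q =>
          rw [deg_some]
          by_cases h : (q.1 : ℕ) = (i : ℕ) + 1
          · have hi : ((q.1 : ℕ) : ℤ) = ((i : ℕ) : ℤ) + 1 := by omega
            rw [if_pos hi]; ring
          · simp [h]
      refine (Finset.sum_congr rfl fun b _ => e b).trans ?_
      rw [← Finset.mul_sum, sum_cell]
      have h1 : (((if (i : ℕ) + 1 = n then 1 else 0 : ℕ) : ℤ) + ∑ k : Fin n,
          (((if (k : ℕ) = (i : ℕ) + 1 ∧ true = α then 1 else 0 : ℕ) : ℤ) +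
          ((if (k : ℕ) = (i : ℕ) + 1 ∧ false = α then 1 else 0 : ℕ) : ℤ))) = 1 := by
        have h2 : ∀ k : Fin n, (((if (k : ℕ) = (i : ℕ) + 1 ∧ true = α then 1 else 0 : ℕ) : ℤ) +
          ((if (k : ℕ) = (i : ℕ) + 1 ∧ false = α then 1 else 0 : ℕ) : ℤ)) =
            if (k : ℕ) = (i : ℕ) + 1 then 1 else 0 := by
          intro k
          by_cases h : (k : ℕ) = (i : ℕ) + 1 <;> cases α <;> simp [h]
        simp only [h2]
        by_cases h : (i : ℕ) + 1 = n
        · rw [if_pos h, Finset.sum_eq_zero]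
          · rfl
          · intro k _
            rw [if_neg]
            have := k.2
            omega
        · have hi : (i : ℕ) + 1 < n := by have := i.2; omega
          rw [if_neg h, Finset.sum_eq_single (⟨(i : ℕ) + 1, hi⟩ : Fin n)]
          · simp
          · intro b _ hb
            rw [if_neg]
            intro h'
            exact hb (Fin.ext h')
          · simp
      refine (congrArg (fun t : ℤ => (if β = true then (1 : ℤ) else -1) * t) h1).trans ?_
      cases β <;> simp
  aug α := by
    have h := sum_cell (n := n) (fun c => (((c : Option (Fin n × Bool)).elim
      (if 0 = n then 1 else 0) (fun p => if (p.1 : ℕ) = 0 ∧ p.2 = α then 1 else 0) : ℕ) : ℤ))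
    have h' : (((if 0 = n then 1 else 0 : ℕ) : ℤ) + ∑ k : Fin n,
          (((if (k : ℕ) = 0 ∧ true = α then 1 else 0 : ℕ) : ℤ) +
          ((if (k : ℕ) = 0 ∧ false = α then 1 else 0 : ℕ) : ℤ))) = 1 := by
      cases n with
      | zero => simp
      | succ n =>
        rw [Fin.sum_univ_succ]
        cases α <;> simp
    have h'' := h.trans h'
    exact_mod_cast h''
  finite := ⟨n + 1, fun k hk α => fun (c : Option (Fin n × Bool)) => by
    cases c with
    | none => simp; omega
    | some p => have := p.1.2; simp; omega⟩

theorem deg_le (c : (globe n).Cell) : (globe n).deg c ≤ n := by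
  cases c with
  | none => exact le_of_eq deg_none
  | some p => rw [deg_some]; have := p.1.2; omega

theorem mass_succ {x : (globe n).Table} {k : ℕ} (h : ∀ γ, mass x k γ = 0) (γ : Bool) :
    mass x (k + 1) γ = 0 := by
  by_cases hk : k < n
  · have := bdry x ⟨k, hk⟩ γ true
    have e : ∀ β, x.coeff k β (some (⟨k, hk⟩, true) : Option (Fin n × Bool)) = 0 :=
      fun β => coeff_of_mass (h β) _
    dsimp only at this
    erw [e true, e false] at this
    simpa using this.symm
  · refine Finset.sum_eq_zero fun c _ => ?_
    rw [coeff_eq_zero, Nat.cast_zero]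
    have := deg_le c
    omega

theorem mass_above {x : (globe n).Table} {k : ℕ} (h : ∀ γ, mass x k γ = 0) (j : ℕ) :
    ∀ γ, mass x (k + j) γ = 0 := by
  induction j with
  | zero => exact h
  | succ j ih => exact mass_succ ih

theorem coeff_above {x : (globe n).Table} {k : ℕ} (h : ∀ γ, mass x k γ = 0) {j : ℕ} (hj : k ≤ j)
    (γ : Bool) (c : (globe n).Cell) : x.coeff j γ c = 0 := by
  obtain ⟨i, rfl⟩ := Nat.exists_eq_add_of_le hj
  exact coeff_of_mass (mass_above h i γ) c

theorem level_ext {x y : (globe n).Table} {k : ℕ} (hk : k < n) {γ δ : Bool}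
    (h : ∀ β, x.coeff k γ (some (⟨k, hk⟩, β) : Option (Fin n × Bool)) =
      y.coeff k δ (some (⟨k, hk⟩, β) : Option (Fin n × Bool))) (c : (globe n).Cell) :
    x.coeff k γ c = y.coeff k δ c := by
  by_cases hc : (globe n).deg c = k
  · cases c with
    | none => rw [deg_none] at hc; omega
    | some p =>
      obtain ⟨i, β⟩ := p
      rw [deg_some] at hc
      obtain rfl : i = ⟨k, hk⟩ := Fin.ext (by exact_mod_cast hc)
      exact h β
  · rw [coeff_eq_zero _ _ _ _ hc, coeff_eq_zero _ _ _ _ hc]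

theorem top_coeff {k : ℕ} (hk : k < n) (γ β : Bool) :
    (top n).coeff k γ (some (⟨k, hk⟩, β) : Option (Fin n × Bool)) = if β = γ then 1 else 0 := by
  change (if k = k ∧ β = γ then 1 else 0) = _
  simp

theorem top_coeff_none : (top n).coeff n = fun _ c => (c : Option (Fin n × Bool)).elim 1
    fun _ => 0 := by
  funext γ c
  cases c with
  | none => exact if_pos rfl
  | some p =>
    have := p.1.2
    exact if_neg (by omega)

theorem top_above {k : ℕ} (hk : n < k) (γ : Bool) (c : (globe n).Cell) :
    (top n).coeff k γ c = 0 := by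
  apply coeff_eq_zero
  have := deg_le c
  omega

/-- Every morphism of the `n`-globe is an iterated source or target of the generating one. -/
theorem classify_aux (x : (globe n).Table) (j : ℕ) (hj : j ≤ n) :
    (∃ k, k < j ∧ ∃ α, x = (top n).d α k) ∨
      ((∀ k, k < j → ∀ γ c, x.coeff k γ c = (top n).coeff k γ c) ∧ ∀ γ, mass x j γ = 1) := by
  induction j with
  | zero =>
    refine Or.inr ⟨fun k hk => absurd hk (Nat.not_lt_zero k), fun γ => ?_⟩
    have := x.aug γ
    unfold mass
    exact_mod_cast this
  | succ j ih =>
    rcases ih (by omega) with ⟨k, hk, α, h⟩ | ⟨h1, h2⟩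
    · exact Or.inl ⟨k, by omega, α, h⟩
    · have hjn : j < n := by omega
      have m1 := mass_eq x ⟨j, hjn⟩ true
      have m2 := mass_eq x ⟨j, hjn⟩ false
      have b1 := fun γ => bdry x ⟨j, hjn⟩ γ true
      have b2 := fun γ => bdry x ⟨j, hjn⟩ γ false
      have h2t := h2 true
      have h2f := h2 false
      simp only [if_true, Bool.false_eq_true, if_false, one_mul] at m1 m2 b1 b2
      rw [h2t] at m1
      rw [h2f] at m2
      have hm : ∀ γ, mass x (j + 1) γ = mass x (j + 1) true := fun γ => by
        rw [← b1 γ, b1 true]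
      have b1t := b1 true
      have b2t := b2 true
      have hm0 : mass x (j + 1) true = 0 ∨ mass x (j + 1) true = 1 := by
        have : 0 ≤ mass x (j + 1) true := Finset.sum_nonneg fun c _ => Int.natCast_nonneg _
        omega
      rcases hm0 with h0 | h0
      · left
        rw [h0] at b1t b2t
        obtain ⟨α, hα⟩ : ∃ α : Bool, ∀ γ β,
            x.coeff j γ (some (⟨j, hjn⟩, β) : Option (Fin n × Bool)) = if β = α then 1 else 0 := by
          have hc : x.coeff j true (some (⟨j, hjn⟩, true) : Option (Fin n × Bool)) = 0 ∨
              x.coeff j true (some (⟨j, hjn⟩, true) : Option (Fin n × Bool)) = 1 := by omega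
          rcases hc with hc | hc
          · refine ⟨false, fun γ β => ?_⟩
            cases γ <;> cases β <;> simp <;> omega
          · refine ⟨true, fun γ β => ?_⟩
            cases γ <;> cases β <;> simp <;> omega
        refine ⟨j, Nat.lt_succ_self j, α, ?_⟩
        apply DirectedComplex.Table.ext
        funext k γ c
        change _ = if k < j then _ else if k = j then _ else 0
        rcases lt_trichotomy k j with h | rfl | h
        · rw [if_pos h, h1 k h]
        · rw [if_neg (lt_irrefl k), if_pos rfl]
          refine level_ext hjn (fun β => ?_) c
          rw [hα, top_coeff]
        · rw [if_neg (by omega), if_neg (by omega)]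
          exact coeff_above (fun γ => (hm γ).trans h0) h γ c
      · right
        rw [h0] at b1t b2t
        refine ⟨fun k hk γ c => ?_, fun γ => (hm γ).trans h0⟩
        rcases Nat.lt_succ_iff_lt_or_eq.1 hk with h | rfl
        · exact h1 k h γ c
        · refine level_ext hjn (fun β => ?_) c
          rw [top_coeff]
          cases γ <;> cases β <;> simp <;> omega

theorem classify (x : (globe n).Table) : ∃ k, k ≤ n ∧ ∃ α, x = (top n).d α k := by
  rcases classify_aux x n le_rfl with ⟨k, hk, α, h⟩ | ⟨h1, h2⟩
  · exact ⟨k, hk.le, α, h⟩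
  · refine ⟨n, le_rfl, false, ?_⟩
    apply DirectedComplex.Table.ext
    funext k γ c
    change _ = if k < n then _ else if k = n then _ else 0
    rcases lt_trichotomy k n with h | rfl | h
    · rw [if_pos h, h1 k h]
    · rw [if_neg (lt_irrefl k), if_pos rfl, top_coeff_none]
      cases c with
      | none =>
        have h3 : mass x k γ = 1 := h2 γ
        rw [mass, sum_cell, Finset.sum_eq_zero, add_zero] at h3
        · exact_mod_cast h3
        · intro i _
          have := i.2
          rw [coeff_eq_zero x k γ (some (i, true)) (by rw [deg_some]; dsimp only; omega),
            coeff_eq_zero x k γ (some (i, false)) (by rw [deg_some]; dsimp only; omega)]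
          rfl
      | some p =>
        have := p.1.2
        exact coeff_eq_zero x k γ (some p) (by rw [deg_some]; omega)
    · rw [if_neg (by omega), if_neg (by omega)]
      apply coeff_eq_zero
      have := deg_le c
      omega

/-- The only coincidences between the iterated sources and targets of the generating morphism are
the obvious ones. -/
theorem d_top_injective {k l : ℕ} (hk : k ≤ n) (hl : l ≤ n) {α β : Bool}
    (h : (top n).d α k = (top n).d β l) : k = l ∧ (k = n ∨ α = β) := by
  have key : ∀ {k l : ℕ} (_ : k < l) (_ : l ≤ n) {α β : Bool},
      (top n).d α k ≠ (top n).d β l := by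
    intro k l hkl hl α β h
    have h' := congrFun (congrFun (congrArg DirectedComplex.Table.coeff h) k) (!α)
    have h'' := congrFun h' (some (⟨k, by omega⟩, α))
    change (if k < k then _ else if k = k then _ else 0) =
      if k < l then _ else if k = l then _ else 0 at h''
    rw [if_neg (lt_irrefl k), if_pos rfl, if_pos hkl, top_coeff, top_coeff] at h''
    cases α <;> simp at h''
  rcases lt_trichotomy k l with h' | rfl | h'
  · exact absurd h (key h' hl)
  · refine ⟨rfl, ?_⟩
    by_cases hkn : k = n
    · exact Or.inl hkn
    right
    have h'' := congrFun (congrFun (congrFun (congrArg DirectedComplex.Table.coeff h) k) α)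
      (some (⟨k, by omega⟩, α))
    change (if k < k then _ else if k = k then _ else 0) =
      if k < k then _ else if k = k then _ else 0 at h''
    rw [if_neg (lt_irrefl k), if_pos rfl, if_neg (lt_irrefl k), if_pos rfl, top_coeff,
      top_coeff] at h''
    cases α <;> cases β <;> simp at h'' <;> rfl
  · exact absurd h.symm (key h' hk)

/-- The image of a morphism of the `n`-globe under the functor classifying `x`. -/
def val (C : OmegaCat.{u}) (x : C) (X : (globe n).Table) : C :=
  C.d (classify X).choose_spec.2.choose (classify X).choose x

theorem val_d (C : OmegaCat.{u}) {x : C} (hx : C.dim x ≤ n) {k : ℕ} (hk : k ≤ n) (α : Bool) :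
    val C x ((top n).d α k) = C.d α k x := by
  have h := classify ((top n).d α k)
  have h1 := h.choose_spec.1
  have h2 := h.choose_spec.2.choose_spec
  obtain ⟨h3, h4⟩ := d_top_injective hk h1 h2
  change C.d h.choose_spec.2.choose h.choose x = _
  generalize h.choose_spec.2.choose = β at h4 ⊢
  generalize h.choose = l at h3 ⊢
  subst h3
  rcases h4 with h4 | h4
  · rw [(C.dim_le_iff _ k x).1 (by omega), (C.dim_le_iff _ k x).1 (by omega)]
  · rw [← h4]

/-- The `ω`-functor from the `n`-globe that maps the generating morphism to `x`, for a morphism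
`x` of dimension at most `n`. -/
def functor (C : OmegaCat.{u}) (x : C) (hx : C.dim x ≤ n) :
    OmegaCat.Functor (globe n).nu C where
  map := val C x
  map_d α m X := by
    obtain ⟨k, hk, β, rfl⟩ := classify X
    change val C x (((top n).d β k).d α m) = _
    rw [val_d C hx hk]
    rcases lt_or_ge m k with h | h
    · rw [show ((top n).d β k).d α m = (top n).d α m from (globe n).nu.d_d_lt β α m k h _,
        C.d_d_lt _ _ _ _ h, val_d C hx (by omega)]
    · rw [show ((top n).d β k).d α m = (top n).d β k from (globe n).nu.d_d_ge β α m k h _,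
        C.d_d_ge _ _ _ _ h, val_d C hx hk]
  map_comp m X Y h h' := by
    obtain ⟨k, hk, α, rfl⟩ := classify X
    obtain ⟨l, hl, β, rfl⟩ := classify Y
    have hX : val C x ((top n).d α k) = C.d α k x := val_d C hx hk α
    have hY : val C x ((top n).d β l) = C.d β l x := val_d C hx hl β
    rcases lt_or_ge m k with hmk | hmk
    · rcases lt_or_ge m l with hml | hml
      · exfalso
        have e1 : ((top n).d α k).d true m = (top n).d true m :=
          (globe n).nu.d_d_lt α true m k hmk _
        have e2 : ((top n).d β l).d false m = (top n).d false m :=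
          (globe n).nu.d_d_lt β false m l hml _
        have h1 : (top n).d true m = (top n).d false m := e1.symm.trans (Eq.trans h e2)
        have h2 := (d_top_injective (by omega) (by omega) h1).2
        rcases h2 with h2 | h2
        · omega
        · exact absurd h2 (by decide)
      · have e2 : ((top n).d β l).d false m = (top n).d β l :=
          (globe n).nu.d_d_ge β false m l hml _
        have e3 : (top n).d β l = ((top n).d α k).d true m := (Eq.trans h e2).symm
        have key : ∀ (Y : (globe n).nu) (hY : Y = ((top n).d α k).d true m) h,
            (globe n).nu.comp m ((top n).d α k) Y h = (top n).d α k := by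
          rintro _ rfl h
          exact (globe n).nu.comp_id m _ h
        rw [key _ e3 h]
        have key' : ∀ (z : C) (hz : z = C.d true m (val C x ((top n).d α k))) h,
            C.comp m (val C x ((top n).d α k)) z h = val C x ((top n).d α k) := by
          rintro _ rfl h
          exact C.comp_id m _ h
        refine (key' _ ?_ h').symm
        refine Eq.trans ?_ h'.symm
        rw [hY]
        exact (C.d_d_ge β false m l hml x).symm
    · have e1 : ((top n).d α k).d true m = (top n).d α k :=
        (globe n).nu.d_d_ge α true m k hmk _
      have e3 : (top n).d α k = ((top n).d β l).d false m := e1.symm.trans h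
      have key : ∀ (X : (globe n).nu) (hX : X = ((top n).d β l).d false m) h,
          (globe n).nu.comp m X ((top n).d β l) h = (top n).d β l := by
        rintro _ rfl h
        exact (globe n).nu.id_comp m _ h
      rw [key _ e3 h]
      have key' : ∀ (z : C) (hz : z = C.d false m (val C x ((top n).d β l))) h,
          C.comp m z (val C x ((top n).d β l)) h = val C x ((top n).d β l) := by
        rintro _ rfl h
        exact C.id_comp m _ h
      refine (key' _ ?_ h').symm
      rw [← h', hX]
      exact (C.d_d_ge α true m k hmk x).symm

theorem functor_top (C : OmegaCat.{u}) (x : C) (hx : C.dim x ≤ n) :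
    (functor C x hx).map (top n) = x := by
  have h : (top n).d false n = top n := by
    apply DirectedComplex.Table.ext
    funext k γ c
    change (if k < n then _ else if k = n then _ else 0) = _
    rcases lt_trichotomy k n with h | rfl | h
    · rw [if_pos h]
    · rw [if_neg (lt_irrefl k), if_pos rfl, top_coeff_none]
    · rw [if_neg (by omega), if_neg (by omega), top_above h]
  change val C x (top n) = x
  conv_lhs => rw [← h]
  rw [val_d C hx le_rfl, (C.dim_le_iff _ _ _).1 hx]

end Globe

/-! ### The folding maps from simplices and cubes to globes -/

/-- The number of elements of a subset of `{0, …, n-1}`. -/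
def size {n : ℕ} (Z : Fin n → Bool) : ℕ := ∑ i, if Z i = true then 1 else 0

/-- The subset contains `0, …, r-1`. -/
def Initial {n : ℕ} (r : ℕ) (Z : Fin n → Bool) : Prop := ∀ i : Fin n, (i : ℕ) < r → Z i = true

instance {n : ℕ} (r : ℕ) (Z : Fin n → Bool) : Decidable (Initial r Z) := by
  unfold Initial; infer_instance

theorem initial_zero {n : ℕ} (Z : Fin n → Bool) : Initial 0 Z := fun i h =>
  absurd h (Nat.not_lt_zero _)

theorem initial_cons {n : ℕ} (r : ℕ) (z : Bool) (Z : Fin n → Bool) :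
    Initial (r + 1) (Fin.cons (α := fun _ => Bool) z Z) ↔ z = true ∧ Initial r Z := by
  simp [Initial, Fin.forall_fin_succ]

theorem size_cons {n : ℕ} (z : Bool) (Z : Fin n → Bool) :
    size (Fin.cons (α := fun _ => Bool) z Z) = (if z = true then 1 else 0) + size Z := by
  simp only [size, Fin.sum_univ_succ, Fin.cons_zero, Fin.cons_succ]

theorem parity_cons {n : ℕ} (z : Bool) (Z : Fin n → Bool) (i : Fin n) :
    parity (Fin.cons (α := fun _ => Bool) z Z) i.succ
      = (if z = true then -1 else 1) * parity Z i := by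
  simp [parity, Fin.prod_univ_succ]

theorem sum_initial {n : ℕ} (r : ℕ) (Z : Fin n → Bool) :
    ∑ i, (if Z i = true then
      parity Z i * (if Initial r (Function.update Z i false) then 1 else 0) else 0)
      = (if Initial r Z then 1 else 0) * ∑ q ∈ Finset.Ico r (size Z), (-1 : ℤ) ^ q := by
  induction n generalizing r with
  | zero => simp [size]
  | succ n ih =>
    obtain ⟨z, Z, rfl⟩ : ∃ z Z', Z = Fin.cons (α := fun _ => Bool) z Z' :=
      ⟨Z 0, Fin.tail Z, (Fin.cons_self_tail Z).symm⟩
    rw [Fin.sum_univ_succ]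
    simp only [Fin.cons_zero, Fin.cons_succ, Fin.update_cons_zero, ← Fin.cons_update,
      Alphabet.parity_zero, parity_cons, size_cons]
    cases r with
    | zero =>
      have := ih 0 Z
      simp only [initial_zero, if_true, mul_one, one_mul] at this ⊢
      cases z
      · simpa using this
      · simp only [if_true]
        rw [add_comm 1 (size Z), ← Finset.range_eq_Ico, Finset.sum_range_succ']
        rw [← Finset.range_eq_Ico] at this
        simp only [pow_succ, pow_zero, mul_neg, mul_one, Finset.sum_neg_distrib, ← this, neg_mul,
          one_mul]
        rw [add_comm, ← Finset.sum_neg_distrib]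
        congr 1
        refine Finset.sum_congr rfl fun i _ => ?_
        split_ifs <;> simp
    | succ r =>
      have := ih r Z
      simp only [initial_cons]
      cases z
      · simp
      · simp only [if_true, true_and, Bool.false_eq_true, false_and, if_false, mul_zero, zero_add]
        rw [add_comm 1 (size Z), ← Finset.sum_Ico_add' (fun q => (-1 : ℤ) ^ q) r (size Z) 1]
        simp only [pow_succ, mul_neg, mul_one, Finset.sum_neg_distrib, ← this, neg_mul, one_mul]
        rw [← Finset.sum_neg_distrib]
        refine Finset.sum_congr rfl fun i _ => ?_
        split_ifs <;> simp

/-- The side on which a subset with `r` elements is folded. -/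
def foldSign {n : ℕ} (α : Bool) (r : ℕ) (Z : Fin n → Bool) : Bool :=
  xor (xor (decide (Odd r)) α) (!decide (Initial r Z))

theorem sum_foldSign {n : ℕ} (α β : Bool) (r : ℕ) (Z : Fin n → Bool) (hZ : size Z = r + 2) :
    ∑ i, (if Z i = true then parity Z i *
      (if Initial r (Function.update Z i false) ∧
        foldSign α (r + 1) (Function.update Z i false) = β then 1 else 0) else 0)
      = (if Initial (r + 1) Z then 1 else 0) * ((if α then -1 else 1) * if β then -1 else 1) := by
  have e1 := sum_initial (r + 1) Z
  have e0 := sum_initial r Z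
  have i1 : (∑ q ∈ Finset.Ico (r + 1) (size Z), (-1 : ℤ) ^ q) = (-1) ^ (r + 1) := by
    rw [hZ, Finset.sum_Ico_succ_top (by omega)]; simp
  have i0 : (∑ q ∈ Finset.Ico r (size Z), (-1 : ℤ) ^ q) = 0 := by
    rw [hZ, Finset.sum_Ico_succ_top (by omega), Finset.sum_Ico_succ_top (by omega)]
    simp [pow_succ]
  rw [i1] at e1
  rw [i0, mul_zero] at e0
  have hI : ∀ Y : Fin n → Bool, Initial (r + 1) Y → Initial r Y := fun Y h i hi =>
    h i (by omega)
  by_cases hs : xor (decide (Odd (r + 1))) α = β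
  · have : ∀ Y : Fin n → Bool, (Initial r Y ∧ foldSign α (r + 1) Y = β) ↔ Initial (r + 1) Y := by
      intro Y
      unfold foldSign
      rw [hs]
      by_cases h : Initial (r + 1) Y
      · simp [h, hI Y h]
      · cases β <;> simp [h]
    simp only [this]
    rw [e1]
    congr 1
    rcases Nat.even_or_odd (r + 1) with h | h
    · rw [h.neg_one_pow]
      have : ¬ Odd (r + 1) := Nat.not_odd_iff_even.2 h
      rw [← hs, decide_eq_false this]
      cases α <;> simp
    · rw [h.neg_one_pow]
      rw [← hs, decide_eq_true h]
      cases α <;> simp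
  · have : ∀ Y : Fin n → Bool, (if Initial r Y ∧ foldSign α (r + 1) Y = β then (1 : ℤ) else 0) =
        (if Initial r Y then 1 else 0) - if Initial (r + 1) Y then 1 else 0 := by
      intro Y
      have hs' : xor (decide (Odd (r + 1))) α = !β := by
        revert hs; cases xor (decide (Odd (r + 1))) α <;> cases β <;> simp
      unfold foldSign
      rw [hs']
      by_cases h : Initial (r + 1) Y
      · simp [h, hI Y h]
      · cases β <;> simp [h]
    simp only [this]
    have e2 : ∀ i, (if Z i = true then parity Z i *
        ((if Initial r (Function.update Z i false) then 1 else 0) -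
          if Initial (r + 1) (Function.update Z i false) then 1 else 0) else 0) =
        (if Z i = true then
          parity Z i * (if Initial r (Function.update Z i false) then 1 else 0) else 0) -
        (if Z i = true then
          parity Z i * (if Initial (r + 1) (Function.update Z i false) then 1 else 0) else 0) := by
      intro i
      split_ifs <;> simp
    rw [Finset.sum_congr rfl fun i _ => e2 i, Finset.sum_sub_distrib, e0, e1, zero_sub,
      ← mul_neg]
    congr 1
    rcases Nat.even_or_odd (r + 1) with h | h
    · rw [h.neg_one_pow]
      have : ¬ Odd (r + 1) := Nat.not_odd_iff_even.2 h
      rw [decide_eq_false this] at hs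
      revert hs
      cases α <;> cases β <;> simp
    · rw [h.neg_one_pow]
      rw [decide_eq_true h] at hs
      revert hs
      cases α <;> cases β <;> simp

theorem size_update {n : ℕ} (Z : Fin n → Bool) (i : Fin n) (hi : Z i = true) :
    size (Function.update Z i false) + 1 = size Z := by
  have h : ∀ w : Fin n → Bool, size w = (if w i = true then 1 else 0)
      + ∑ j ∈ Finset.univ.erase i, if w j = true then 1 else 0 := fun w =>
    (Finset.add_sum_erase _ _ (Finset.mem_univ i)).symm
  rw [h Z, h (Function.update Z i false), if_pos hi, Function.update_self, if_neg (by simp),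
    Finset.sum_congr rfl fun j hj => by rw [Function.update_of_ne (Finset.ne_of_mem_erase hj)]]
  ring

theorem size_le {n : ℕ} (Z : Fin n → Bool) : size Z ≤ n := by
  refine (Finset.sum_le_card_nsmul _ _ 1 fun i _ => by split_ifs <;> simp).trans ?_
  simp

theorem initial_of_size {n : ℕ} (Z : Fin n → Bool) (h : size Z = n) (r : ℕ) : Initial r Z := by
  intro i _
  by_contra hi
  have h1 : ∑ i, (if Z i = true then 1 else 0) < ∑ _i : Fin n, 1 :=
    Finset.sum_lt_sum (fun j _ => by split_ifs <;> simp) ⟨i, Finset.mem_univ i, by simp [hi]⟩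
  rw [show (∑ i, if Z i = true then 1 else 0) = size Z from rfl, h] at h1
  simp at h1

namespace Alphabet

variable {S : Alphabet}

theorem count_eq_size {n : ℕ} (w : Fin n → S.L) : S.count w = size (S.zeros w) := by
  simp [count, size, zeros]

theorem zeros_update {n : ℕ} (w : Fin n → S.L) (i : Fin n) (l : S.L) (hl : l ≠ S.o) :
    S.zeros (Function.update w i l) = Function.update (S.zeros w) i false := by
  funext j
  by_cases h : j = i
  · subst h; simp [zeros, hl]
  · simp [zeros, Function.update_of_ne h]

end Alphabet

/-- The cell `(k, β)` of the `n`-globe. -/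
def Globe.side {n : ℕ} (k : Fin n) (β : Bool) : (globe n).Cell := (some (k, β) : Option _)

/-- The cell of degree `n` of the `n`-globe. -/
def Globe.interior (n : ℕ) : (globe n).Cell := (none : Option _)

/-- The folding map from the `n`-simplex to the `n`-globe, on the face with vertex set `Z`. A face
of dimension `k < n` is mapped to a `k`-dimensional cell of the globe if `Z` contains the vertices
`0, …, k - 1`, and is degenerate otherwise. -/
def foldSimplexFun (n : ℕ) (Z : Fin (n + 1) → Bool) : Option (globe n).Cell :=
  if size Z = 0 then none
  else if size Z = n + 1 then some (Globe.interior n)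
  else if Initial (size Z - 1) Z then
    if h : size Z - 1 < n then
      some (Globe.side ⟨size Z - 1, h⟩ (foldSign false (size Z) Z))
    else none
  else none

theorem Globe.side_inj {n : ℕ} {k l : Fin n} {α β : Bool} :
    some (Globe.side k α) = some (Globe.side l β) ↔ (k : ℕ) = l ∧ α = β := by
  constructor
  · intro h
    have h' : (k, α) = (l, β) := Option.some.inj (Option.some.inj h)
    rw [Prod.mk.injEq] at h'
    exact ⟨congrArg _ h'.1, h'.2⟩
  · rintro ⟨h, rfl⟩
    obtain rfl := Fin.ext h
    rfl

theorem Globe.interior_ne {n : ℕ} {k : Fin n} {β : Bool} :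
    some (Globe.interior n) ≠ some (Globe.side k β) := by
  intro h
  cases Option.some.inj h

theorem Globe.deg_side {n : ℕ} (k : Fin n) (β : Bool) :
    (globe n).deg (Globe.side k β) = (k : ℕ) := rfl

theorem Globe.deg_interior (n : ℕ) : (globe n).deg (Globe.interior n) = n := rfl

theorem Globe.inc_side {n : ℕ} (a : (globe n).Cell) (k : Fin n) (β : Bool) :
    (globe n).inc a (Globe.side k β) =
      if (globe n).deg a = (k : ℕ) + 1 then (if β then 1 else -1) else 0 := rfl

theorem Globe.cases_cell {n : ℕ} (b : (globe n).Cell) :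
    b = Globe.interior n ∨ ∃ k β, b = Globe.side k β := by
  cases b with
  | none => exact Or.inl rfl
  | some p => exact Or.inr ⟨p.1, p.2, rfl⟩

theorem foldSimplexFun_some {n : ℕ} {Z : Fin (n + 1) → Bool} {r : ℕ} (hZ : size Z = r + 1)
    (hr : r < n) (k : Fin n) (β : Bool) :
    foldSimplexFun n Z = some (Globe.side k β) ↔
      (k : ℕ) = r ∧ Initial r Z ∧ foldSign false (r + 1) Z = β := by
  unfold foldSimplexFun
  rw [if_neg (by omega), if_neg (by omega)]
  by_cases h : Initial (size Z - 1) Z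
  · rw [if_pos h, dif_pos (by omega), Globe.side_inj]
    have h' : Initial r Z := by
      rw [hZ] at h
      exact h
    simp only [hZ, h', true_and, Nat.add_sub_cancel]
    rw [eq_comm]
  · rw [if_neg h]
    have h' : ¬ Initial r Z := by
      rw [hZ] at h
      exact h
    simp [h']

theorem simplex_chain {n k : ℕ} (w : Fin (n + 1) → simplexAlphabet.L)
    (hw : size (simplexAlphabet.zeros w) = k + 2) (b : (globe n).Cell)
    (hb : (globe n).deg b = k) :
    (∑ v, if foldSimplexFun n (simplexAlphabet.zeros v) = some b
      then simplexAlphabet.incidence w v else 0) =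
      (foldSimplexFun n (simplexAlphabet.zeros w)).elim 0 (fun a => (globe n).inc a b) := by
  have hle := size_le (simplexAlphabet.zeros w)
  rcases Globe.cases_cell b with rfl | ⟨⟨k', hk'⟩, β, rfl⟩
  · rw [Globe.deg_interior] at hb
    omega
  · rw [Globe.deg_side] at hb
    obtain rfl : k' = k := by exact_mod_cast hb
    rw [Alphabet.sum_incidence_ite]
    have hl : ∀ i, (∑ l : simplexAlphabet.L, if w i = simplexAlphabet.o then
        (if foldSimplexFun n (simplexAlphabet.zeros (Function.update w i l)) =
            some (Globe.side ⟨k', hk'⟩ β) then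
          simplexAlphabet.wt l * parity (simplexAlphabet.zeros w) i else 0) else 0) =
        - (if simplexAlphabet.zeros w i = true then parity (simplexAlphabet.zeros w) i *
          (if Initial k' (Function.update (simplexAlphabet.zeros w) i false) ∧
            foldSign false (k' + 1) (Function.update (simplexAlphabet.zeros w) i false) = β
            then 1 else 0) else 0) := by
      intro i
      by_cases hi : w i = simplexAlphabet.o
      · have hi' : simplexAlphabet.zeros w i = true := decide_eq_true hi
        have hs := size_update _ i hi'
        refine (Fintype.sum_bool _).trans ?_
        rw [if_pos hi, if_pos hi, if_pos hi', Alphabet.zeros_update w i false Bool.false_ne_true,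
          show simplexAlphabet.wt true = 0 from rfl, show simplexAlphabet.wt false = -1 from rfl]
        rw [zero_mul, ite_self, zero_add]
        have := foldSimplexFun_some (Z := Function.update (simplexAlphabet.zeros w) i false)
          (r := k') (by omega) hk' ⟨k', hk'⟩ β
        simp only [true_and] at this
        by_cases h : Initial k' (Function.update (simplexAlphabet.zeros w) i false) ∧
            foldSign false (k' + 1) (Function.update (simplexAlphabet.zeros w) i false) = β
        · rw [if_pos h, if_pos (this.2 h)]; ring
        · rw [if_neg h, if_neg (fun h' => h (this.1 h'))]; ring
      · have hi' : ¬ simplexAlphabet.zeros w i = true := by simpa [Alphabet.zeros] using hi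
        rw [if_neg hi']
        simp [hi]
    rw [Finset.sum_congr rfl fun i _ => hl i, Finset.sum_neg_distrib, sum_foldSign _ _ _ _ hw]
    have h0 : ¬ size (simplexAlphabet.zeros w) = 0 := by omega
    by_cases hn : size (simplexAlphabet.zeros w) = n + 1
    · rw [if_pos (initial_of_size _ hn _)]
      unfold foldSimplexFun
      rw [if_neg h0, if_pos hn, Option.elim_some, Globe.inc_side, Globe.deg_interior,
        if_pos (show (n : ℤ) = ((k' : ℕ) : ℤ) + 1 by omega)]
      cases β <;> simp
    · by_cases hI : Initial (k' + 1) (simplexAlphabet.zeros w)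
      · have hI' : Initial (size (simplexAlphabet.zeros w) - 1) (simplexAlphabet.zeros w) := by
          rw [hw]; exact hI
        rw [if_pos hI]
        unfold foldSimplexFun
        rw [if_neg h0, if_neg hn, if_pos hI', dif_pos (by omega)]
        rw [Option.elim_some, Globe.inc_side, Globe.deg_side,
          if_pos (show ((size (simplexAlphabet.zeros w) - 1 : ℕ) : ℤ) = ((k' : ℕ) : ℤ) + 1 by omega)]
        cases β <;> simp
      · have hI' : ¬ Initial (size (simplexAlphabet.zeros w) - 1) (simplexAlphabet.zeros w) := by
          rw [hw]; exact hI
        rw [if_neg hI]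
        unfold foldSimplexFun
        rw [if_neg h0, if_neg hn, if_neg hI']
        simp

theorem simplex_deg {n : ℕ} (w : Fin (n + 1) → simplexAlphabet.L) :
    (simplex n).deg w = (size (simplexAlphabet.zeros w) : ℤ) - 1 := by
  change simplexAlphabet.count w + (-1) = _
  rw [Alphabet.count_eq_size]
  rfl

/-- The folding map from the `n`-simplex to the `n`-globe. -/
def foldSimplex (n : ℕ) : DirectedComplex.Hom (simplex n) (globe n) where
  toFun := fun w : Fin (n + 1) → simplexAlphabet.L => foldSimplexFun n (simplexAlphabet.zeros w)
  deg_eq := fun (w : Fin (n + 1) → simplexAlphabet.L) b h => by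
    rw [simplex_deg]
    unfold foldSimplexFun at h
    split_ifs at h with h0 h1 h2 h3
    · obtain rfl := Option.some.inj h
      rw [Globe.deg_interior]
      omega
    · obtain rfl := Option.some.inj h
      rw [Globe.deg_side]
      dsimp only
      omega
  vertex := fun (w : Fin (n + 1) → simplexAlphabet.L) h => by
    rw [simplex_deg] at h
    have h' : size (simplexAlphabet.zeros w) = 1 := by omega
    unfold foldSimplexFun
    split_ifs with h0 h1 h2 h3
    · omega
    · rfl
    · rfl
    · omega
    · exact absurd (by rw [h']; exact initial_zero _) h2
  chain k := fun (w : Fin (n + 1) → simplexAlphabet.L) h b hb => by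
    rw [simplex_deg] at h
    exact simplex_chain w (by omega) b hb

/-- The letter `-` or `+`. -/
def letter (α : Bool) : cubeAlphabet.L := if α then (1 : SignType) else (-1 : SignType)

theorem letter_ne (α : Bool) : letter α ≠ cubeAlphabet.o := by cases α <;> decide +revert

theorem letter_not_ne (α : Bool) : letter α ≠ letter (!α) := by cases α <;> decide +revert

theorem wt_letter (α : Bool) : cubeAlphabet.wt (letter α) = if α then 1 else -1 := by
  cases α <;> rfl

theorem sum_sign (f : SignType → ℤ) : ∑ l, f l = f 0 + (f (-1) + f 1) := by
  rw [SignType.univ_eq, Finset.sum_insert (by decide), Finset.sum_pair (by decide)]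

theorem sum_letter (α : Bool) (f : cubeAlphabet.L → ℤ) :
    ∑ l, f l = f (letter α) + f (letter (!α)) + f cubeAlphabet.o := by
  refine (sum_sign f).trans ?_
  cases α
  · exact add_comm _ _
  · rw [add_comm, add_comm (f (-1 : SignType))]
    rfl

/-- The folding map from the `n`-cube to the `n`-globe at the corner `(α, …, α)`. The vertices
other than the corner are mapped to the vertex `(0, -α)`, and the faces of positive dimension not
containing the corner are degenerate. A face of dimension `k < n` containing the corner, with set
of zeros `Z`, is mapped to a `k`-dimensional cell of the globe if `Z` contains the first `k - 1`
positions, and is degenerate otherwise. -/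
def foldCubeFun (α : Bool) (n : ℕ) (w : Fin n → cubeAlphabet.L) : Option (globe n).Cell :=
  if ∃ i, w i = letter (!α) then
    if h : size (cubeAlphabet.zeros w) = 0 ∧ 0 < n then some (Globe.side ⟨0, h.2⟩ (!α)) else none
  else if h : size (cubeAlphabet.zeros w) < n then
    if Initial (size (cubeAlphabet.zeros w) - 1) (cubeAlphabet.zeros w) then
      some (Globe.side ⟨size (cubeAlphabet.zeros w), h⟩
        (foldSign α (size (cubeAlphabet.zeros w)) (cubeAlphabet.zeros w)))
    else none
  else some (Globe.interior n)

theorem foldSign_zero {n : ℕ} (α : Bool) (Z : Fin n → Bool) : foldSign α 0 Z = α := by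
  simp [foldSign, initial_zero]

theorem foldCube_far {α : Bool} {n : ℕ} {w : Fin n → cubeAlphabet.L}
    (h : ∃ i, w i = letter (!α)) (k : Fin n) (β : Bool) :
    foldCubeFun α n w = some (Globe.side k β) ↔
      size (cubeAlphabet.zeros w) = 0 ∧ (k : ℕ) = 0 ∧ β = !α := by
  have hn : 0 < n := h.choose.pos
  unfold foldCubeFun
  rw [if_pos h]
  by_cases h0 : size (cubeAlphabet.zeros w) = 0
  · rw [dif_pos ⟨h0, hn⟩, Globe.side_inj]
    simp only [h0, true_and]
    rw [eq_comm, eq_comm (a := β)]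
  · rw [dif_neg (fun h => h0 h.1)]
    simp [h0]

theorem foldCube_near {α : Bool} {n : ℕ} {w : Fin n → cubeAlphabet.L}
    (h : ¬ ∃ i, w i = letter (!α)) (hs : size (cubeAlphabet.zeros w) < n) (k : Fin n)
    (β : Bool) :
    foldCubeFun α n w = some (Globe.side k β) ↔
      (k : ℕ) = size (cubeAlphabet.zeros w) ∧
        Initial (size (cubeAlphabet.zeros w) - 1) (cubeAlphabet.zeros w) ∧
        foldSign α (size (cubeAlphabet.zeros w)) (cubeAlphabet.zeros w) = β := by
  unfold foldCubeFun
  rw [if_neg h, dif_pos hs]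
  by_cases h0 : Initial (size (cubeAlphabet.zeros w) - 1) (cubeAlphabet.zeros w)
  · rw [if_pos h0, Globe.side_inj]
    simp only [h0, true_and]
    rw [eq_comm]
  · rw [if_neg h0]
    simp [h0]

theorem foldCube_far_update {α : Bool} {n : ℕ} {w : Fin n → cubeAlphabet.L} (i : Fin n)
    (hi : w i = cubeAlphabet.o) (l : cubeAlphabet.L) (h : ∃ i, w i = letter (!α)) :
    ∃ j, Function.update w i l j = letter (!α) := by
  obtain ⟨j, hj⟩ := h
  refine ⟨j, ?_⟩
  rw [Function.update_of_ne, hj]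
  rintro rfl
  exact letter_ne _ (hj.symm.trans hi)

theorem foldCube_near_update {α : Bool} {n : ℕ} {w : Fin n → cubeAlphabet.L} (i : Fin n)
    (h : ¬ ∃ i, w i = letter (!α)) : ¬ ∃ j, Function.update w i (letter α) j = letter (!α) := by
  rintro ⟨j, hj⟩
  by_cases hji : j = i
  · subst hji
    rw [Function.update_self] at hj
    exact letter_not_ne α hj
  · rw [Function.update_of_ne hji] at hj
    exact h ⟨j, hj⟩

/-- The contribution of the `i`-th position to the boundary of the image of `w`. -/
theorem cube_term {n k : ℕ} (hk : k < n) (α β : Bool) (w : Fin n → cubeAlphabet.L)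
    (hw : size (cubeAlphabet.zeros w) = k + 1) (i : Fin n) :
    (∑ l, if w i = cubeAlphabet.o then
        (if foldCubeFun α n (Function.update w i l) = some (Globe.side ⟨k, hk⟩ β) then
          cubeAlphabet.wt l * parity (cubeAlphabet.zeros w) i else 0) else 0) =
      if cubeAlphabet.zeros w i = true then parity (cubeAlphabet.zeros w) i *
        ((if ∃ j, w j = letter (!α) then
            (if k = 0 ∧ β = !α then (if α then 1 else -1) else 0)
          else if Initial (k - 1) (Function.update (cubeAlphabet.zeros w) i false) ∧
            foldSign α k (Function.update (cubeAlphabet.zeros w) i false) = β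
            then (if α then 1 else -1) else 0) +
          (if k = 0 ∧ β = !α then (if α then -1 else 1) else 0)) else 0 := by
  by_cases hi : w i = cubeAlphabet.o
  · have hi' : cubeAlphabet.zeros w i = true := decide_eq_true hi
    have hs := size_update _ i hi'
    have z1 := Alphabet.zeros_update w i (letter α) (letter_ne α)
    have z2 := Alphabet.zeros_update w i (letter (!α)) (letter_ne (!α))
    have f2 := foldCube_far (α := α) (w := Function.update w i (letter (!α)))
      ⟨i, Function.update_self ..⟩ ⟨k, hk⟩ β
    rw [z2] at f2
    have g2 : size (Function.update (cubeAlphabet.zeros w) i false) = 0 ∧ k = 0 ∧ β = !α ↔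
        k = 0 ∧ β = !α := by
      constructor
      · exact fun h => h.2
      · exact fun h => ⟨by omega, h⟩
    rw [sum_letter α, if_pos hi, if_pos hi, if_pos hi, if_pos hi', cubeAlphabet.wt_o, zero_mul,
      ite_self, add_zero, wt_letter, wt_letter]
    simp only [f2, g2]
    by_cases hf : ∃ j, w j = letter (!α)
    · have f1 := foldCube_far (α := α) (w := Function.update w i (letter α))
        (foldCube_far_update i hi _ hf) ⟨k, hk⟩ β
      rw [z1] at f1
      simp only [f1, g2, if_pos hf]
      cases α <;> split_ifs <;> simp_all
    · have f1 := foldCube_near (foldCube_near_update (α := α) i hf) (by rw [z1]; omega)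
        ⟨k, hk⟩ β
      rw [z1] at f1
      have hs' : size (Function.update (cubeAlphabet.zeros w) i false) = k := by omega
      simp only [hs', true_and] at f1
      simp only [f1, if_neg hf]
      cases α <;> split_ifs <;> simp_all
  · have hi' : ¬ cubeAlphabet.zeros w i = true := by simpa [Alphabet.zeros] using hi
    rw [if_neg hi']
    simp [hi]

theorem cube_chain {n k : ℕ} (α : Bool) (w : Fin n → cubeAlphabet.L)
    (hw : size (cubeAlphabet.zeros w) = k + 1) (b : (globe n).Cell)
    (hb : (globe n).deg b = k) :
    (∑ v, if foldCubeFun α n v = some b then cubeAlphabet.incidence w v else 0) =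
      (foldCubeFun α n w).elim 0 (fun a => (globe n).inc a b) := by
  have hle := size_le (cubeAlphabet.zeros w)
  rcases Globe.cases_cell b with rfl | ⟨⟨k', hk'⟩, β, rfl⟩
  · rw [Globe.deg_interior] at hb
    omega
  rw [Globe.deg_side] at hb
  obtain rfl : k' = k := by exact_mod_cast hb
  rw [Alphabet.sum_incidence_ite, Finset.sum_congr rfl fun i _ => cube_term hk' α β w hw i]
  by_cases hf : ∃ j, w j = letter (!α)
  · simp only [if_pos hf]
    rw [Finset.sum_eq_zero]
    · unfold foldCubeFun
      rw [if_pos hf, dif_neg (fun h => by omega)]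
      rfl
    · intro i _
      cases α <;> split_ifs <;> simp
  simp only [if_neg hf]
  have hr : (foldCubeFun α n w).elim 0 (fun a => (globe n).inc a (Globe.side ⟨k', hk'⟩ β)) =
      (if Initial k' (cubeAlphabet.zeros w) then 1 else 0) * if β then 1 else -1 := by
    unfold foldCubeFun
    rw [if_neg hf]
    by_cases hn : size (cubeAlphabet.zeros w) < n
    · rw [dif_pos hn]
      have e : size (cubeAlphabet.zeros w) - 1 = k' := by omega
      by_cases hI : Initial k' (cubeAlphabet.zeros w)
      · rw [if_pos hI, if_pos (e ▸ hI), Option.elim_some, Globe.inc_side, Globe.deg_side,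
          if_pos (show ((size (cubeAlphabet.zeros w) : ℕ) : ℤ) = ((k' : ℕ) : ℤ) + 1 by omega),
          one_mul]
      · rw [if_neg hI, if_neg (e ▸ hI), zero_mul]
        rfl
    · rw [dif_neg hn, if_pos (initial_of_size _ (by omega) _), Option.elim_some, Globe.inc_side,
        Globe.deg_interior, if_pos (show (n : ℤ) = ((k' : ℕ) : ℤ) + 1 by omega), one_mul]
  rw [hr]
  rcases Nat.eq_zero_or_pos k' with rfl | hk
  · rw [if_pos (initial_zero _)]
    simp only [Nat.zero_sub, initial_zero, foldSign_zero, true_and]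
    have h1 := sum_initial 0 (cubeAlphabet.zeros w)
    simp only [initial_zero, if_true, mul_one, one_mul, hw] at h1
    simp only [zero_add, Nat.Ico_succ_singleton, Finset.sum_singleton, pow_zero] at h1
    rw [one_mul]
    refine Eq.trans ?_ ((congrArg (fun t : ℤ => t * (if β then 1 else -1)) h1).trans
      (one_mul _))
    rw [Finset.sum_mul]
    refine Finset.sum_congr rfl fun i _ => ?_
    by_cases hz : cubeAlphabet.zeros w i = true <;> cases α <;> cases β <;> simp [hz]
  · obtain ⟨r, rfl⟩ : ∃ r, k' = r + 1 := ⟨k' - 1, by omega⟩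
    have h1 := sum_foldSign α β r (cubeAlphabet.zeros w) hw
    have h2 := congrArg (fun t : ℤ => t * (if α then 1 else -1)) h1
    simp only [Nat.add_sub_cancel, Nat.succ_ne_zero, false_and, if_false, add_zero]
    refine Eq.trans ?_ (h2.trans ?_)
    · rw [Finset.sum_mul]
      refine Finset.sum_congr rfl fun i _ => ?_
      split_ifs <;> simp
    · cases α <;> cases β <;> simp

theorem cube_deg {n : ℕ} (w : Fin n → cubeAlphabet.L) :
    (cube n).deg w = (size (cubeAlphabet.zeros w) : ℤ) := by
  change cubeAlphabet.count w + 0 = _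
  rw [Alphabet.count_eq_size, add_zero]

/-- The folding map from the `n`-cube to the `n`-globe at the corner `(α, …, α)`. -/
def foldCube (α : Bool) (n : ℕ) : DirectedComplex.Hom (cube n) (globe n) where
  toFun := foldCubeFun α n
  deg_eq := fun (w : Fin n → cubeAlphabet.L) b h => by
    have hle := size_le (cubeAlphabet.zeros w)
    rw [cube_deg]
    unfold foldCubeFun at h
    split_ifs at h with h1 h2 h3 h4
    · obtain rfl := Option.some.inj h
      rw [Globe.deg_side, h2.1]
    · obtain rfl := Option.some.inj h
      rw [Globe.deg_side]
    · obtain rfl := Option.some.inj h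
      rw [Globe.deg_interior]
      omega
  vertex := fun (w : Fin n → cubeAlphabet.L) h => by
    rw [cube_deg] at h
    have h' : size (cubeAlphabet.zeros w) = 0 := by omega
    unfold foldCubeFun
    split_ifs with h1 h2 h3 h4
    · rfl
    · exact absurd ⟨h', h1.choose.pos⟩ h2
    · rfl
    · exact absurd (by rw [h']; exact initial_zero _) h4
    · rfl
  chain k := fun (w : Fin n → cubeAlphabet.L) h b hb => by
    rw [cube_deg] at h
    exact cube_chain α w (by omega) b hb

/-! ### Positivity in the cubes -/

/-- A weight on the words of the cubes for which the total weight of the boundary of a face of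
dimension `k` is `2 k`. -/
def lam {n : ℕ} (v : Fin n → cubeAlphabet.L) : ℤ :=
  ∑ i, cubeAlphabet.wt (v i) * parity (cubeAlphabet.zeros v) i

theorem parity_update {n : ℕ} (w : Fin n → cubeAlphabet.L) (i : Fin n) (l : cubeAlphabet.L) :
    parity (cubeAlphabet.zeros (Function.update w i l)) i = parity (cubeAlphabet.zeros w) i := by
  refine Finset.prod_congr rfl fun j _ => ?_
  by_cases hj : j < i
  · simp [Alphabet.zeros, Function.update_of_ne hj.ne]
  · simp [hj]

theorem parity_sq {n : ℕ} (Z : Fin n → Bool) (i : Fin n) : parity Z i * parity Z i = 1 := by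
  unfold parity
  rw [← Finset.prod_mul_distrib]
  refine Finset.prod_eq_one fun j _ => ?_
  split_ifs <;> simp

theorem lam_update {n : ℕ} (w : Fin n → cubeAlphabet.L) (i : Fin n) :
    lam (Function.update w i (letter true)) - lam (Function.update w i (letter (!true))) =
      2 * parity (cubeAlphabet.zeros w) i := by
  unfold lam
  rw [← Finset.sum_sub_distrib, Finset.sum_eq_single i]
  · rw [Function.update_self, Function.update_self, parity_update, parity_update, wt_letter,
      wt_letter]
    simp
    ring
  · intro j _ hj
    rw [Function.update_of_ne hj, Function.update_of_ne hj,
      Alphabet.zeros_update _ _ _ (letter_ne _), Alphabet.zeros_update _ _ _ (letter_ne _),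
      sub_self]
  · simp

theorem sum_lam {n k : ℕ} (w : Fin n → cubeAlphabet.L)
    (hw : size (cubeAlphabet.zeros w) = k + 1) :
    ∑ v, (if size (cubeAlphabet.zeros v) = k then lam v else 0) * cubeAlphabet.incidence w v
      = 2 * (k + 1) := by
  rw [Alphabet.sum_incidence]
  have h : ∀ i, (∑ l, if w i = cubeAlphabet.o then
      cubeAlphabet.wt l * parity (cubeAlphabet.zeros w) i *
        (if size (cubeAlphabet.zeros (Function.update w i l)) = k then
          lam (Function.update w i l) else 0) else 0) =
      2 * (if cubeAlphabet.zeros w i = true then 1 else 0) := by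
    intro i
    by_cases hi : w i = cubeAlphabet.o
    · have hi' : cubeAlphabet.zeros w i = true := decide_eq_true hi
      have hs : size (Function.update (cubeAlphabet.zeros w) i false) = k := by
        have := size_update _ i hi'
        omega
      rw [sum_letter true, if_pos hi, if_pos hi, if_pos hi, if_pos hi',
        Alphabet.zeros_update _ _ _ (letter_ne _), Alphabet.zeros_update _ _ _ (letter_ne _),
        if_pos hs, if_pos hs, cubeAlphabet.wt_o, wt_letter, wt_letter]
      have h1 := lam_update w i
      have h2 := parity_sq (cubeAlphabet.zeros w) i
      simp only [if_true, Bool.not_true, Bool.false_eq_true, if_false] at h1 ⊢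
      linear_combination (parity (cubeAlphabet.zeros w) i) * h1 + 2 * h2
    · have hi' : ¬ cubeAlphabet.zeros w i = true := by simpa [Alphabet.zeros] using hi
      rw [if_neg hi']
      simp [hi]
  rw [Finset.sum_congr rfl fun i _ => h i, ← Finset.mul_sum]
  have : ((size (cubeAlphabet.zeros w) : ℕ) : ℤ) = k + 1 := by rw [hw]; push_cast; rfl
  rw [← this]
  unfold size
  push_cast
  rfl

namespace Cube

variable {n : ℕ}

/-- The number of cells of dimension `k` in `x_k^γ`. -/
def mass (x : (cube n).Table) (k : ℕ) (γ : Bool) : ℕ :=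
  ∑ w : Fin n → cubeAlphabet.L, x.coeff k γ w

theorem size_of_coeff {x : (cube n).Table} {k : ℕ} {γ : Bool} {w : Fin n → cubeAlphabet.L}
    (h : x.coeff k γ w ≠ 0) : size (cubeAlphabet.zeros w) = k := by
  have := x.deg_eq k γ w h
  rw [cube_deg] at this
  exact_mod_cast this

theorem mass_succ (x : (cube n).Table) (k : ℕ) (γ : Bool) :
    2 * ((k : ℤ) + 1) * mass x (k + 1) γ = ∑ v : Fin n → cubeAlphabet.L,
      (if size (cubeAlphabet.zeros v) = k then lam v else 0) *
        ((x.coeff k true v : ℤ) - x.coeff k false v) := by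
  have h : ∀ v : Fin n → cubeAlphabet.L, (if size (cubeAlphabet.zeros v) = k then lam v else 0) *
        ((x.coeff k true v : ℤ) - x.coeff k false v) = ∑ w : Fin n → cubeAlphabet.L,
      (x.coeff (k + 1) γ w : ℤ) * ((if size (cubeAlphabet.zeros v) = k then lam v else 0) *
        cubeAlphabet.incidence w v) := by
    intro v
    by_cases hv : size (cubeAlphabet.zeros v) = k
    · rw [← x.bdry k γ v (by rw [cube_deg, hv]), Finset.mul_sum]
      refine Finset.sum_congr rfl fun w _ => ?_
      change _ * (_ * cubeAlphabet.incidence w v) = _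
      ring
    · simp [hv]
  rw [Finset.sum_congr rfl fun v _ => h v, Finset.sum_comm]
  have hm : ((mass x (k + 1) γ : ℕ) : ℤ) =
      ∑ w : Fin n → cubeAlphabet.L, (x.coeff (k + 1) γ w : ℤ) := by
    unfold mass
    exact Nat.cast_sum _ _
  rw [hm]
  refine (Finset.mul_sum _ _ _).trans ?_
  refine Finset.sum_congr rfl fun w _ => ?_
  refine Eq.trans ?_ (Finset.mul_sum _ _ _)
  by_cases hw : x.coeff (k + 1) γ w = 0
  · simp [hw]
  · rw [sum_lam w (size_of_coeff hw)]
    ring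

theorem mass_eq (x : (cube n).Table) (k : ℕ) (γ δ : Bool) :
    mass x (k + 1) γ = mass x (k + 1) δ := by
  have h := (mass_succ x k γ).trans (mass_succ x k δ).symm
  have h2 : (2 * ((k : ℤ) + 1)) ≠ 0 := by positivity
  exact_mod_cast mul_left_cancel₀ h2 h

theorem coeff_of_mass {x : (cube n).Table} {k : ℕ} {γ : Bool} (h : mass x k γ = 0)
    (c : (cube n).Cell) : x.coeff k γ c = 0 :=
  Finset.sum_eq_zero_iff.1 h c (Finset.mem_univ _)

/-- If `x_k^- = x_k^+`, then `x` has no components above the level `k`. -/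
theorem mass_above {x : (cube n).Table} {k : ℕ}
    (h : ∀ c, x.coeff k true c = x.coeff k false c) (j : ℕ) (γ : Bool) :
    mass x (k + j + 1) γ = 0 := by
  induction j generalizing γ with
  | zero =>
    have h1 := mass_succ x k γ
    rw [Finset.sum_eq_zero fun v _ => by rw [h v, sub_self, mul_zero]] at h1
    have h2 : (2 * ((k : ℤ) + 1)) ≠ 0 := by positivity
    exact_mod_cast (mul_eq_zero.1 h1).resolve_left h2
  | succ j ih =>
    have h1 := mass_succ x (k + j + 1) γ
    rw [Finset.sum_eq_zero fun v _ => by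
      rw [show x.coeff (k + j + 1) true v = 0 from coeff_of_mass (ih true) v,
        show x.coeff (k + j + 1) false v = 0 from coeff_of_mass (ih false) v, sub_self,
        mul_zero]] at h1
    have h2 : (2 * (((k + j + 1 : ℕ) : ℤ) + 1)) ≠ 0 := by positivity
    exact_mod_cast (mul_eq_zero.1 h1).resolve_left h2

theorem dim_le {x : (cube n).Table} {k : ℕ}
    (h : ∀ c, x.coeff k true c = x.coeff k false c) : (cube n).nu.dim x ≤ k := by
  refine ((cube n).nu.dim_le_iff false k x).2 ?_
  apply DirectedComplex.Table.ext
  funext m γ c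
  change (if m < k then _ else if m = k then _ else 0) = _
  rcases lt_trichotomy m k with hm | rfl | hm
  · rw [if_pos hm]
  · rw [if_neg (lt_irrefl m), if_pos rfl]
    cases γ
    · rfl
    · exact (h c).symm
  · rw [if_neg (by omega), if_neg (by omega)]
    obtain ⟨j, rfl⟩ := Nat.exists_eq_add_of_lt hm
    exact (coeff_of_mass (mass_above h j γ) c).symm

/-- The length of an element of the cube: the number of edges of its `1`-source. -/
def length (x : (cube n).Table) : ℕ := mass x 1 false

theorem dim_of_length {x : (cube n).Table} (h : length x = 0) : (cube n).nu.dim x = 0 := by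
  have h' : ∀ γ, mass x 1 γ = 0 := fun γ => (mass_eq x 0 γ false).trans h
  have h0 : ∀ c, x.coeff 0 true c = x.coeff 0 false c := by
    intro c
    by_cases hc : (cube n).deg c = (0 : ℕ)
    · have := x.bdry 0 false c hc
      rw [Finset.sum_eq_zero fun b _ => by
        rw [show x.coeff (0 + 1) false b = 0 from coeff_of_mass (h' false) b, Nat.cast_zero,
          zero_mul]] at this
      omega
    · have : ∀ γ, x.coeff 0 γ c = 0 := fun γ => by
        by_contra h''
        exact hc (x.deg_eq 0 γ c h'')
      rw [this, this]
  exact Nat.le_zero.1 (dim_le h0)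

end Cube

/-- The non-contracting `ω`-category with one object, with the natural numbers as `1`-morphisms
(composed by addition) and no morphisms of higher dimension. -/
def natCat : OmegaCat.{u} where
  carrier := ULift.{u} ℕ
  d _ n x := if n = 0 then ⟨0⟩ else x
  comp n x y _ := if n = 0 then ⟨x.down + y.down⟩ else x
  d_d_lt α β m n h x := by
    split_ifs <;> first | rfl | omega
  d_d_ge α β m n h x := by
    split_ifs <;> first | rfl | omega
  id_comp n x h := by
    split_ifs with hn
    · subst hn
      exact ULift.ext _ _ (Nat.zero_add _)
    · rfl
  comp_id n x h := by
    split_ifs with hn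
    · exact ULift.ext _ _ (Nat.add_zero _)
    · rfl
  src_comp n x y h := by
    split_ifs <;> rfl
  tgt_comp n x y h := by
    split_ifs with hn
    · rfl
    · simpa [hn] using h
  d_comp α m n hmn x y h h' := by
    by_cases hm : m = 0
    · subst hm
      simp [Ne.symm hmn]
    · simp [hm]
  assoc n x y z hxy hyz h h' := by
    split_ifs
    · exact ULift.ext _ _ (Nat.add_assoc _ _ _)
    · rfl
  interchange m n hmn x y z w hxy hzw hxz hyw h h' := by
    by_cases hm : m = 0
    · subst hm
      simp [Ne.symm hmn]
    · by_cases hn : n = 0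
      · subst hn
        simp [hm]
      · simp [hm, hn]
  finite_dim x := ⟨1, by simp, by simp⟩

theorem natCat_dim_le (x : natCat.{u}) : natCat.dim x ≤ 1 :=
  (natCat.dim_le_iff false 1 x).2 rfl

theorem natCat_dim_zero {x : natCat.{u}} : natCat.dim x = 0 ↔ x.down = 0 := by
  rw [← Nat.le_zero, natCat.dim_le_iff false 0 x]
  change (⟨0⟩ : ULift ℕ) = x ↔ _
  constructor
  · rintro rfl; rfl
  · intro h; exact ULift.ext _ _ h.symm

theorem natCat_nc : natCat.{u}.NonContracting := by
  intro x hx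
  have : natCat.dim x = 1 := le_antisymm (natCat_dim_le x) hx
  exact ⟨this, this⟩

theorem natCat_groupoid : (natCat.{u}.path natCat_nc).IsGroupoid := by
  intro x hx
  exfalso
  have : (natCat.{u}.path natCat_nc).dim x ≤ 0 :=
    ((natCat.{u}.path natCat_nc).dim_le_iff false 0 x).2 (Subtype.ext rfl)
  omega

/-- The length is functorial on the cubes. -/
def Cube.lengthFunctor (n : ℕ) : OmegaCat.Functor (cube n).nu natCat.{u} where
  map x := ⟨Cube.length x⟩
  map_d α m x := by
    by_cases hm : m = 0
    · subst hm
      refine ULift.ext _ _ (Finset.sum_eq_zero fun w _ => ?_)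
      rfl
    · refine Eq.trans (ULift.ext _ _ ?_) (if_neg hm).symm
      change Cube.length (DirectedComplex.Table.d α m x) = Cube.length x
      rcases Nat.lt_or_ge 1 m with h | h
      · refine Finset.sum_congr rfl fun w _ => ?_
        exact if_pos h
      · obtain rfl : m = 1 := by omega
        refine Eq.trans ?_ (Cube.mass_eq x 0 α false)
        refine Finset.sum_congr rfl fun w _ => ?_
        rfl
  map_comp m x y h h' := by
    by_cases hm : m = 0
    · subst hm
      refine ULift.ext _ _ ?_
      refine Eq.trans ?_ Finset.sum_add_distrib
      rfl
    · refine Eq.trans (ULift.ext _ _ (Finset.sum_congr rfl fun w _ => ?_)) (if_neg hm).symm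
      change (if 1 < m then _ else if 1 = m then _ else _) = _
      rcases Nat.lt_or_ge 1 m with h | h
      · rw [if_pos h]
      · obtain rfl : m = 1 := by omega
        rfl

/-! ### Faces of cubes and simplices -/

/-- The face `δ_i^α : I^n → I^{n+1}`. -/
def cubeFace (n : ℕ) (i : Fin (n + 1)) (α : Bool) : DirectedComplex.Hom (cube n) (cube (n + 1)) :=
  Alphabet.insert 0 i (letter α) (letter_ne α)

/-- The face `δ_i : Δ^n → Δ^{n+1}` omitting the vertex `i`. -/
def simplexFace (n : ℕ) (i : Fin (n + 2)) :
    DirectedComplex.Hom (simplex n) (simplex (n + 1)) :=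
  Alphabet.insert (S := simplexAlphabet) (-1) i false Bool.false_ne_true

/-- The vertex `(α, …, α)` of the `n`-cube. -/
def corner (α : Bool) (n : ℕ) : (cube n).Table :=
  (cube n).point (fun _ : Fin n => letter α) (by
    rw [cube_deg]
    have : size (cubeAlphabet.zeros fun _ : Fin n => letter α) = 0 :=
      Finset.sum_eq_zero fun i _ => if_neg (by simpa [Alphabet.zeros] using letter_ne α)
    rw [this]; rfl)

theorem cubeFace_corner (n : ℕ) (i : Fin (n + 1)) (α : Bool) :
    (cubeFace n i α).push (corner α n) = corner α (n + 1) := by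
  apply DirectedComplex.push_point
  change some _ = some _
  congr 1
  funext j
  rcases Fin.eq_self_or_eq_succAbove i j with rfl | ⟨j, rfl⟩
  · exact Fin.insertNth_apply_same (α := fun _ => cubeAlphabet.L) _ _ _
  · exact Fin.insertNth_apply_succAbove (α := fun _ => cubeAlphabet.L) _ _ _ _

theorem cubeFace_coeff {n : ℕ} (i : Fin (n + 1)) (α : Bool) (x : (cube n).Table) (k : ℕ)
    (γ : Bool) (w : Fin n → cubeAlphabet.L) :
    ((cubeFace n i α).push x).coeff k γ
      (i.insertNth (α := fun _ => cubeAlphabet.L) (letter α) w) = x.coeff k γ w := by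
  refine (Finset.sum_eq_single (M := ℕ) (ι := Fin n → cubeAlphabet.L) w (fun v _ hv => ?_)
    (fun h => absurd (Finset.mem_univ _) h)).trans ?_
  · refine if_neg fun h => hv ?_
    exact Fin.insertNth_injective2 (α := fun _ => cubeAlphabet.L) (Option.some.inj h) |>.2
  · exact if_pos rfl

theorem cubeFace_injective {n : ℕ} (i : Fin (n + 1)) (α : Bool) :
    Function.Injective (cubeFace n i α).push := by
  intro x y h
  apply DirectedComplex.Table.ext
  funext k γ w
  have h' := congrFun (congrFun (congrFun (congrArg DirectedComplex.Table.coeff h) k) γ)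
    (i.insertNth (α := fun _ => cubeAlphabet.L) (letter α) w)
  exact (cubeFace_coeff i α x k γ w).symm.trans (h'.trans (cubeFace_coeff i α y k γ w))

theorem OmegaCat.Functor.dim_map_eq {C : OmegaCat.{u}} {D : OmegaCat.{v}} (F : Functor C D)
    (hF : Function.Injective F.map) (x : C) : D.dim (F.map x) = C.dim x := by
  refine le_antisymm (F.dim_map_le x) ?_
  rw [C.dim_le_iff false]
  apply hF
  rw [F.map_d, D.d_dim]

theorem cubeFace_length {n : ℕ} (i : Fin (n + 1)) (α : Bool) (x : (cube n).Table) :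
    Cube.length ((cubeFace n i α).push x) = Cube.length x := by
  refine Finset.sum_comm.trans (Finset.sum_congr rfl fun w _ => ?_)
  refine (Finset.sum_eq_single (M := ℕ) (ι := Fin (n + 1) → cubeAlphabet.L)
    (i.insertNth (α := fun _ => cubeAlphabet.L) (letter α) w) (fun v _ hv => ?_)
    (fun h => absurd (Finset.mem_univ _) h)).trans ?_
  · exact if_neg fun h => hv (Option.some.inj h).symm
  · exact if_pos rfl

theorem cubeFace_comm {n : ℕ} (i j : Fin (n + 1)) (hij : i ≤ j) (α β : Bool)
    (x : (cube n).Table) :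
    (cubeFace (n + 1) j.succ β).push ((cubeFace n i α).push x) =
      (cubeFace (n + 1) i.castSucc α).push ((cubeFace n j β).push x) := by
  apply DirectedComplex.Hom.push_push
  intro w
  exact congrArg some (Alphabet.insertNth_comm i j hij (letter α) (letter β) w)

theorem simplexFace_comm {n : ℕ} (i j : Fin (n + 2)) (hij : i ≤ j) (x : (simplex n).Table) :
    (simplexFace (n + 1) j.succ).push ((simplexFace n i).push x) =
      (simplexFace (n + 1) i.castSucc).push ((simplexFace n j).push x) := by
  apply DirectedComplex.Hom.push_push
  intro w
  exact congrArg some (Alphabet.insertNth_comm (n := n + 1) (L := simplexAlphabet.L) i j hij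
    false false w)

/-- An `ω`-functor on the `n`-cube is a corner functor if it maps every `1`-dimensional morphism
starting at the corner `(-, …, -)` for `α = false` (ending at the corner `(+, …, +)` for
`α = true`) to a `1`-dimensional morphism. -/
def IsCorner (α : Bool) {n : ℕ} {C : OmegaCat.{u}} (f : OmegaCat.Functor (cube n).nu C) : Prop :=
  ∀ u : (cube n).nu, (cube n).nu.dim u = 1 → (cube n).nu.d α 0 u = corner α n →
    C.dim (f.map u) = 1

theorem IsCorner.face {α : Bool} {n : ℕ} {C : OmegaCat.{u}}
    {f : OmegaCat.Functor (cube (n + 1)).nu C} (hf : IsCorner α f) (i : Fin (n + 1)) :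
    IsCorner α (f.comp (cubeFace n i α).functor) := by
  intro u hu hc
  apply hf ((cubeFace n i α).functor.map u)
  · rw [OmegaCat.Functor.dim_map_eq _ (cubeFace_injective i α), hu]
  · rw [← (cubeFace n i α).functor.map_d, hc]
    exact cubeFace_corner n i α

theorem IsCorner.comp {α : Bool} {n : ℕ} {C : OmegaCat.{u}} {D : OmegaCat.{v}}
    {f : OmegaCat.Functor (cube n).nu C} (hf : IsCorner α f) {F : OmegaCat.Functor C D}
    (hF : F.NonContracting) : IsCorner α (F.comp f) :=
  fun u hu hc => hF _ (hf u hu hc)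

/-! ### The folding operators -/

theorem foldCube_isSome {α : Bool} {n : ℕ} {b : Fin n → cubeAlphabet.L}
    (h1 : size (cubeAlphabet.zeros b) = 1)
    (h2 : cubeAlphabet.incidence b (fun _ => letter α) ≠ 0) :
    ∃ c, foldCubeFun α n b = some c := by
  have hf : ¬ ∃ j, b j = letter (!α) := by
    rintro ⟨j, hj⟩
    obtain ⟨i, -, hi⟩ := Finset.exists_ne_zero_of_sum_ne_zero h2
    obtain ⟨l, -, hl⟩ := Finset.exists_ne_zero_of_sum_ne_zero hi
    have h : b i = cubeAlphabet.o ∧ (fun _ => letter α) = Function.update b i l := by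
      by_contra h
      exact hl (if_neg h)
    by_cases hji : j = i
    · subst hji
      exact letter_ne _ (hj.symm.trans h.1)
    · have := congrFun h.2 j
      rw [Function.update_of_ne hji, hj] at this
      exact letter_not_ne α this
  unfold foldCubeFun
  rw [if_neg hf]
  split_ifs with h3 h4
  · exact ⟨_, rfl⟩
  · exact absurd (by rw [h1]; exact initial_zero _) h4
  · exact ⟨_, rfl⟩

theorem exists_edge {α : Bool} {n : ℕ} {u : (cube n).Table} (hu : (cube n).nu.dim u = 1)
    (hc : (cube n).nu.d α 0 u = corner α n) :
    ∃ (b : Fin n → cubeAlphabet.L) (c : (globe n).Cell), u.coeff 1 false b ≠ 0 ∧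
      foldCubeFun α n b = some c := by
  have h0 : ∀ c : Fin n → cubeAlphabet.L, u.coeff 0 α c =
      if c = (fun _ => letter α) then 1 else 0 := by
    intro c
    have h := congrFun (congrFun (congrFun (congrArg DirectedComplex.Table.coeff hc) 0) α) c
    refine Eq.trans ?_ (h.trans ?_)
    · rfl
    · change (if 0 = 0 ∧ c = _ then 1 else 0) = _
      simp
  have h1 : u.coeff 0 (!α) (fun _ : Fin n => letter α) = 0 := by
    by_contra hne
    have hs : ∑ c : Fin n → cubeAlphabet.L, u.coeff 0 (!α) c = 1 := u.aug (!α)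
    have h2 : ∀ c : Fin n → cubeAlphabet.L, c ≠ (fun _ => letter α) →
        u.coeff 0 (!α) c = 0 := by
      intro c hc'
      have h3 := Finset.add_sum_erase Finset.univ (fun c : Fin n → cubeAlphabet.L =>
        u.coeff 0 (!α) c) (Finset.mem_univ (fun _ : Fin n => letter α))
      have h4 : ∑ c ∈ Finset.univ.erase (fun _ : Fin n => letter α), u.coeff 0 (!α) c = 0 := by
        have h5 : u.coeff 0 (!α) (fun _ : Fin n => letter α) +
            ∑ c ∈ Finset.univ.erase (fun _ : Fin n => letter α), u.coeff 0 (!α) c = 1 :=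
          h3.trans hs
        omega
      exact Finset.sum_eq_zero_iff.1 h4 c (Finset.mem_erase.2 ⟨hc', Finset.mem_univ _⟩)
    have h3 : ∀ c : Fin n → cubeAlphabet.L, u.coeff 0 (!α) c = u.coeff 0 α c := by
      intro c
      rw [h0]
      split_ifs with hc'
      · subst hc'
        rw [Finset.sum_eq_single_of_mem (fun _ : Fin n => letter α) (Finset.mem_univ _)
          (fun c _ hc' => h2 c hc')] at hs
        exact hs
      · exact h2 c hc'
    have h4 : (cube n).nu.dim u ≤ 0 := Cube.dim_le (x := u) (fun c => by
      cases α
      · exact h3 c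
      · exact (h3 c).symm)
    omega
  have h2 := u.bdry 0 false (fun _ : Fin n => letter α) (by
    have := u.deg_eq 0 α (fun _ : Fin n => letter α) (by
      rw [h0, if_pos rfl]
      exact one_ne_zero)
    exact this)
  have h3 : (∑ b : Fin n → cubeAlphabet.L, (u.coeff (0 + 1) false b : ℤ) *
      cubeAlphabet.incidence b (fun _ => letter α)) ≠ 0 := by
    refine fun h => ?_
    have h4 := h2.symm.trans h
    have h5 := h0 (fun _ => letter α)
    rw [if_pos rfl] at h5
    cases α
    · simp only [Bool.not_false] at h1
      omega
    · simp only [Bool.not_true] at h1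
      omega
  obtain ⟨b, -, hb⟩ := Finset.exists_ne_zero_of_sum_ne_zero h3
  have hb1 : u.coeff 1 false b ≠ 0 := fun h => hb (by
    rw [show u.coeff (0 + 1) false b = 0 from h, Nat.cast_zero, zero_mul])
  obtain ⟨c, hc'⟩ := foldCube_isSome (Cube.size_of_coeff hb1) (right_ne_zero_of_mul hb)
  exact ⟨b, c, hb1, hc'⟩

/-- The globular folding operator, on a morphism `x` of dimension at most `n` of an
`ω`-category. -/
def globFold {C : OmegaCat.{u}} {n : ℕ} (x : C) (hx : C.dim x ≤ n) :
    OmegaCat.Functor (simplex n).nu C :=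
  (Globe.functor C x hx).comp (foldSimplex n).functor

/-- The corner folding operator, on a morphism `x` of dimension at most `n` of an `ω`-category. -/
def cornerFold (α : Bool) {C : OmegaCat.{u}} {n : ℕ} (x : C) (hx : C.dim x ≤ n) :
    OmegaCat.Functor (cube n).nu C :=
  (Globe.functor C x hx).comp (foldCube α n).functor

theorem cornerFold_isCorner (α : Bool) {C : OmegaCat.{u}} (hC : C.NonContracting) {n : ℕ} (x : C)
    (h : 1 ≤ C.dim x) (hx : C.dim x ≤ n) : IsCorner α (cornerFold α x hx) := by
  intro u hu hc
  refine le_antisymm (hu ▸ OmegaCat.Functor.dim_map_le (cornerFold α x hx) u) ?_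
  change 1 ≤ C.dim (Globe.val C x ((foldCube α n).push u))
  obtain ⟨k, hk, β, hX⟩ := Globe.classify ((foldCube α n).push u)
  rcases Nat.eq_zero_or_pos k with rfl | hk0
  · exfalso
    obtain ⟨b, c, hb, hbc⟩ := exists_edge hu hc
    have h1 : ((foldCube α n).push u).coeff 1 false c = 0 := by
      rw [hX]
      rfl
    have h2 := (Finset.sum_eq_zero_iff (ι := Fin n → cubeAlphabet.L)).1 h1 b (Finset.mem_univ _)
    refine hb (Eq.trans ?_ h2)
    exact (if_pos hbc).symm
  · obtain ⟨k, rfl⟩ : ∃ k', k = k' + 1 := ⟨k - 1, by omega⟩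
    rw [hX, Globe.val_d C hx hk]
    exact hC.one_le_dim_d h β k

/-! ### Chain complexes presented by generators and relations -/

/-- A chain complex of abelian groups given in each degree by generators and relations. -/
structure PresentedComplex where
  G : ℕ → Type u
  rel : (n : ℕ) → Submodule ℤ (G n →₀ ℤ)
  d : (n : ℕ) → (G (n + 1) →₀ ℤ) →ₗ[ℤ] (G n →₀ ℤ)
  d_rel : ∀ n, rel (n + 1) ≤ (rel n).comap (d n)
  d_d : ∀ n x, d n (d (n + 1) x) ∈ rel n

namespace PresentedComplex

/-- The chain complex with the groups `ℤ[G n] / rel n`. -/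
def complex (A : PresentedComplex.{u}) : ChainComplex (ModuleCat.{u} ℤ) ℕ :=
  ChainComplex.of (fun n => ModuleCat.of ℤ ((A.G n →₀ ℤ) ⧸ A.rel n))
    (fun n => ModuleCat.ofHom (Submodule.mapQ (A.rel (n + 1)) (A.rel n) (A.d n) (A.d_rel n)))
    (fun n => by
      rw [← ModuleCat.ofHom_comp]
      ext x
      exact (Submodule.Quotient.mk_eq_zero _).2 (A.d_d n _))

theorem complex_d (A : PresentedComplex.{u}) (n : ℕ) : A.complex.d (n + 1) n =
    ModuleCat.ofHom (Submodule.mapQ (A.rel (n + 1)) (A.rel n) (A.d n) (A.d_rel n)) :=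
  ChainComplex.of_d (fun n => ModuleCat.of ℤ ((A.G n →₀ ℤ) ⧸ A.rel n)) (fun n => ModuleCat.ofHom
    (Submodule.mapQ (A.rel (n + 1)) (A.rel n) (A.d n) (A.d_rel n))) n

/-- Maps between generators induce a morphism of chain complexes if they are compatible with the
relations and, modulo the relations, with the differentials. -/
structure Induces (A B : PresentedComplex.{u}) (φ : (n : ℕ) → A.G n → B.G n) : Prop where
  rel : ∀ n, A.rel n ≤ (B.rel n).comap (Finsupp.lmapDomain ℤ ℤ (φ n))
  comm : ∀ n x, Finsupp.lmapDomain ℤ ℤ (φ n) (A.d n x) -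
    B.d n (Finsupp.lmapDomain ℤ ℤ (φ (n + 1)) x) ∈ B.rel n

/-- The morphism of chain complexes induced by maps between generators. -/
def Induces.map {A B : PresentedComplex.{u}} {φ : (n : ℕ) → A.G n → B.G n}
    (h : Induces A B φ) : A.complex ⟶ B.complex :=
  ChainComplex.ofHom
    (fun n => ModuleCat.ofHom
      (Submodule.mapQ (A.rel n) (B.rel n) (Finsupp.lmapDomain ℤ ℤ (φ n)) (h.rel n)))
    (fun n => by
      rw [complex_d, complex_d]
      refine (ModuleCat.ofHom_comp _ _).symm.trans (Eq.trans ?_ (ModuleCat.ofHom_comp _ _))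
      refine congrArg ModuleCat.ofHom ?_
      refine Submodule.linearMap_qext _ (LinearMap.ext fun x => ?_)
      exact ((Submodule.Quotient.eq _).2 (h.comm n x)).symm)

end PresentedComplex

/-! ### Augmented nerves, thin elements, reduced complexes -/

/-- The part of an augmented simplicial set that is needed for its chain complex: the sets and the
face maps. There is a shift by one: `X 0` is the set of `(-1)`-simplices and `X (n + 1)` is the set
of `n`-simplices. In addition, there is a set of simplices called thin. -/
structure Nerve where
  X : ℕ → Type u
  face : (n : ℕ) → Fin (n + 1) → X (n + 1) → X n
  face_face : ∀ n (i j : Fin (n + 1)), i ≤ j → ∀ x : X (n + 2),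
    face n i (face (n + 1) j.succ x) = face n j (face (n + 1) i.castSucc x)
  thin : (n : ℕ) → Set (X n)

namespace Nerve

variable (N : Nerve.{u})

/-- The alternating sum of the face maps. -/
def bdry (n : ℕ) : (N.X (n + 1) →₀ ℤ) →ₗ[ℤ] (N.X n →₀ ℤ) :=
  ∑ i : Fin (n + 1), (-1 : ℤ) ^ (i : ℕ) • Finsupp.lmapDomain ℤ ℤ (N.face n i)

theorem bdry_single (n : ℕ) (x : N.X (n + 1)) :
    N.bdry n (Finsupp.single x 1) =
      ∑ i : Fin (n + 1), (-1 : ℤ) ^ (i : ℕ) • Finsupp.single (N.face n i x) 1 := by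
  simp [bdry, LinearMap.sum_apply, Finsupp.mapDomain_single]

theorem bdry_bdry (n : ℕ) (x : N.X (n + 2) →₀ ℤ) : N.bdry n (N.bdry (n + 1) x) = 0 := by
  have key : N.bdry n ∘ₗ N.bdry (n + 1) = 0 := by
    refine Finsupp.lhom_ext' fun x => LinearMap.ext_ring ?_
    change N.bdry n (N.bdry (n + 1) (Finsupp.single x 1)) = 0
    rw [bdry_single, map_sum]
    simp only [map_smul, bdry_single, Finset.smul_sum, smul_smul, ← pow_add]
    rw [← Finset.sum_product' (f := fun (j : Fin (n + 2)) (i : Fin (n + 1)) =>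
      (-1 : ℤ) ^ ((j : ℕ) + (i : ℕ)) •
        Finsupp.single (N.face n i (N.face (n + 1) j x)) (1 : ℤ))]
    let S : Finset (Fin (n + 2) × Fin (n + 1)) := {p | (p.1 : ℕ) ≤ (p.2 : ℕ)}
    rw [Finset.univ_product_univ, ← Finset.sum_add_sum_compl S, ← eq_neg_iff_add_eq_zero,
      ← Finset.sum_neg_distrib]
    let φ : ∀ p : Fin (n + 2) × Fin (n + 1), p ∈ S → Fin (n + 2) × Fin (n + 1) := fun p hp =>
      (p.2.succ, Fin.castLT p.1 (lt_of_le_of_lt (Finset.mem_filter.mp hp).right p.2.is_lt))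
    apply Finset.sum_bij φ
    · intro p hp
      simp only [S, Finset.mem_compl, Finset.mem_filter, Finset.mem_univ, true_and] at hp ⊢
      simp only [φ, Fin.val_succ, Fin.val_castLT]
      omega
    · rintro ⟨j, i⟩ hp ⟨j', i'⟩ hp' h
      simp only [φ, Prod.mk.injEq, Fin.ext_iff, Fin.val_castLT, Fin.val_succ] at h ⊢
      omega
    · rintro ⟨j, i⟩ hp
      simp only [S, Finset.mem_compl, Finset.mem_filter, Finset.mem_univ, true_and] at hp
      have hj : j ≠ 0 := by rintro rfl; simp at hp
      refine ⟨(i.castSucc, j.pred hj), ?_, ?_⟩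
      · simp only [S, Finset.mem_filter, Finset.mem_univ, true_and, Fin.val_castSucc,
          Fin.val_pred]
        omega
      · simp [φ]
    · rintro ⟨j, i⟩ hp
      have hp' := hp
      simp only [S, Finset.mem_filter, Finset.mem_univ, true_and] at hp'
      obtain ⟨j, rfl⟩ : ∃ j' : Fin (n + 1), j = j'.castSucc :=
        ⟨j.castLT (lt_of_le_of_lt hp' i.is_lt), rfl⟩
      have h := N.face_face n j i hp' x
      simp only [φ, Fin.castLT_castSucc, Fin.val_succ, Fin.val_castSucc]
      rw [h, ← neg_smul]
      congr 1
      rw [show (i : ℕ) + 1 + (j : ℕ) = ((j : ℕ) + (i : ℕ)) + 1 by omega, pow_succ]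
      ring
  exact LinearMap.congr_fun key x

/-- The unnormalized chain complex of a nerve: in degree `n`, the free abelian group generated by
the `(n - 1)`-simplices. -/
def chains : PresentedComplex.{u} where
  G := N.X
  rel _ := ⊥
  d := N.bdry
  d_rel _ := bot_le
  d_d n x := by rw [N.bdry_bdry]; exact zero_mem _

/-- The subgroup `M_n` generated by the thin elements. -/
def thinSpan (n : ℕ) : Submodule ℤ (N.X n →₀ ℤ) :=
  Submodule.span ℤ ((fun x => Finsupp.single x 1) '' N.thin n)

/-- The reduced complex: the quotient by the thin elements and their boundaries,
`C_n / (M_n + ∂ M_{n+1})`. -/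
def reduced : PresentedComplex.{u} where
  G := N.X
  rel n := N.thinSpan n ⊔ (N.thinSpan (n + 1)).map (N.bdry n)
  d := N.bdry
  d_rel n := by
    refine sup_le (fun x hx => ?_) ?_
    · exact Submodule.mem_sup_right (Submodule.mem_map_of_mem hx)
    · rintro _ ⟨x, -, rfl⟩
      rw [Submodule.mem_comap, N.bdry_bdry]
      exact Submodule.zero_mem _
  d_d n x := by rw [N.bdry_bdry]; exact Submodule.zero_mem _

theorem induces_reduce : PresentedComplex.Induces N.chains N.reduced (fun _ x => x) where
  rel _ := bot_le
  comm n x := by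
    have : ∀ n, Finsupp.lmapDomain ℤ ℤ (fun x : N.X n => x) = LinearMap.id :=
      fun n => Finsupp.lmapDomain_id ℤ ℤ
    have h : Finsupp.lmapDomain ℤ ℤ (fun x : N.X n => x) (N.bdry n x) -
        N.bdry n (Finsupp.lmapDomain ℤ ℤ (fun x : N.X (n + 1) => x) x) = 0 := by
      rw [this, this]
      exact sub_self _
    exact (congrArg (· ∈ N.reduced.rel n) h).mpr (Submodule.zero_mem _)

/-- The projection to the reduced complex. -/
def reduce : N.chains.complex ⟶ N.reduced.complex := N.induces_reduce.map

theorem induces_map {N N' : Nerve.{u}} (φ : (n : ℕ) → N.X n → N'.X n)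
    (h : ∀ n i x, φ n (N.face n i x) = N'.face n i (φ (n + 1) x)) :
    PresentedComplex.Induces N.chains N'.chains φ where
  rel _ := bot_le
  comm n x := by
    have key : Finsupp.lmapDomain ℤ ℤ (φ n) ∘ₗ N.bdry n =
        N'.bdry n ∘ₗ Finsupp.lmapDomain ℤ ℤ (φ (n + 1)) := by
      refine Finsupp.lhom_ext' fun x => LinearMap.ext_ring ?_
      change Finsupp.lmapDomain ℤ ℤ (φ n) (N.bdry n (Finsupp.single x 1)) =
        N'.bdry n (Finsupp.lmapDomain ℤ ℤ (φ (n + 1)) (Finsupp.single x 1))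
      rw [bdry_single, map_sum, Finsupp.lmapDomain_apply, Finsupp.mapDomain_single, bdry_single]
      refine Finset.sum_congr rfl fun i _ => ?_
      rw [map_smul, Finsupp.lmapDomain_apply, Finsupp.mapDomain_single, h]
    have h' : Finsupp.lmapDomain ℤ ℤ (φ n) (N.bdry n x) -
        N'.bdry n (Finsupp.lmapDomain ℤ ℤ (φ (n + 1)) x) = 0 :=
      sub_eq_zero.2 (LinearMap.congr_fun key x)
    exact (congrArg (· ∈ N'.chains.rel n) h').mpr (Submodule.zero_mem _)

end Nerve

/-! ### The globular nerve and the corner nerves -/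

theorem OmegaCat.path_dim_le {C : OmegaCat.{u}} (hC : C.NonContracting) (n : ℕ) (x : C.path hC) :
    (C.path hC).dim x ≤ n ↔ C.dim x.1 ≤ n + 1 := by
  rw [(C.path hC).dim_le_iff false, C.dim_le_iff false]
  exact Subtype.ext_iff

/-- The set `C_0` of `0`-morphisms. -/
def NCat.Obj (C : NCat.{u}) : Type u := {x : C.cat // C.cat.dim x = 0}

/-- `s_0 x` (for `α = false`) and `t_0 x` (for `α = true`) as `0`-morphisms. -/
def NCat.obj (C : NCat.{u}) (α : Bool) (x : C.cat) : C.Obj :=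
  ⟨C.cat.d α 0 x, Nat.le_zero.1 (C.cat.dim_d_le α 0 x)⟩

theorem NCat.obj_d (C : NCat.{u}) (α β : Bool) (n : ℕ) (x : C.cat) :
    C.obj α (C.cat.d β (n + 1) x) = C.obj α x :=
  Subtype.ext (C.cat.d_d_lt β α 0 (n + 1) n.succ_pos x)

/-- The action of an `ω`-functor on `0`-morphisms. -/
def NFunctor.onObj {C D : NCat.{u}} (F : NFunctor C D) (x : C.Obj) : D.Obj :=
  ⟨F.fn.map x.1, Nat.le_zero.1 ((F.fn.dim_map_le x.1).trans x.2.le)⟩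

theorem NFunctor.onObj_obj {C D : NCat.{u}} (F : NFunctor C D) (α : Bool) (x : C.cat) :
    F.onObj (C.obj α x) = D.obj α (F.fn.map x) :=
  Subtype.ext (F.fn.map_d α 0 x)

theorem simplexFace_vertex (β : Bool) :
    (simplexFace 0 (if β then 1 else 0)).push (simplexTop 0) =
      (simplex 1).nu.d β 0 (simplexTop 1) := by
  apply DirectedComplex.Table.ext
  funext k γ c
  change Fin 2 → simplexAlphabet.L at c
  change (∑ a : Fin 1 → simplexAlphabet.L, if some ((if β then 1 else 0 : Fin 2).insertNth
      (α := fun _ => simplexAlphabet.L) false a) = some c then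
      (if simplexAlphabet.count a + -1 = (k : ℤ) ∧ simplexAlphabet.Extreme γ a
        then 1 else 0) else 0) =
    if k < 0 then (if simplexAlphabet.count c + -1 = (k : ℤ) ∧ simplexAlphabet.Extreme γ c
        then 1 else 0) else if k = 0 then
      (if simplexAlphabet.count c + -1 = (k : ℤ) ∧ simplexAlphabet.Extreme β c
        then 1 else 0) else 0
  rcases Nat.eq_zero_or_pos k with rfl | hk
  · rw [if_neg (lt_irrefl 0), if_pos rfl]
    change Fin 2 → Bool at c
    revert β γ c
    decide
  · rw [if_neg (show ¬ k < 0 by omega), if_neg (show ¬ k = 0 by omega)]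
    refine Finset.sum_eq_zero fun a _ => ?_
    have h := Alphabet.count_le (S := simplexAlphabet) (n := 1) a
    rw [if_neg (c := _ ∧ _) (fun h' => by push_cast at h; omega), ite_self]

theorem cube_corner (α : Bool) : (cube 1).nu.d α 0 (cubeTop 1) = corner α 1 := by
  apply DirectedComplex.Table.ext
  funext k γ c
  change Fin 1 → cubeAlphabet.L at c
  change (if k < 0 then (if cubeAlphabet.count c + 0 = (k : ℤ) ∧ cubeAlphabet.Extreme γ c
        then 1 else 0) else if k = 0 then
      (if cubeAlphabet.count c + 0 = (k : ℤ) ∧ cubeAlphabet.Extreme α c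
        then 1 else 0) else 0) = if k = 0 ∧ c = fun _ : Fin 1 => letter α then 1 else 0
  rcases Nat.eq_zero_or_pos k with rfl | hk
  · rw [if_neg (lt_irrefl 0), if_pos rfl]
    change Fin 1 → SignType at c
    revert α c
    decide
  · rw [if_neg (by omega), if_neg (by omega), if_neg (by omega)]

/-- The simplices of the globular nerve (with a shift by one): the `(-1)`-simplices are the pairs of
`0`-morphisms, and the `n`-simplices are the `ω`-functors from `Δ^n` to the path
`ω`-category. -/
def GlobX (C : NCat.{u}) : ℕ → Type u
  | 0 => C.Obj × C.Obj
  | n + 1 => OmegaCat.Functor (simplex n).nu C.P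

/-- The faces of the globular nerve; the augmentation maps a morphism `x` of dimension `1` to
`(s_0 x, t_0 x)`. -/
def globFace (C : NCat.{u}) : (n : ℕ) → Fin (n + 1) → GlobX C (n + 1) → GlobX C n
  | 0, _, f =>
    (C.obj false (OmegaCat.Functor.map f (simplexTop 0)).1,
      C.obj true (OmegaCat.Functor.map f (simplexTop 0)).1)
  | n + 1, i, f => OmegaCat.Functor.comp f (simplexFace n i).functor

/-- The globular nerve. An `n`-simplex is thin if the image of `(0 < ⋯ < n)` is of dimension less
than `n` in the path `ω`-category, for `n ≥ 1`. -/
def globNerve (C : NCat.{u}) : Nerve.{u} where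
  X := GlobX C
  face := globFace C
  face_face n i j hij x := by
    cases n with
    | zero =>
      obtain rfl : i = 0 := Fin.fin_one_eq_zero i
      obtain rfl : j = 0 := Fin.fin_one_eq_zero j
      change OmegaCat.Functor (simplex 1).nu C.P at x
      have h1 : ∀ (β : Bool) (γ : Bool),
          C.obj γ (x.map ((simplexFace 0 (if β then 1 else 0)).push (simplexTop 0))).1 =
            C.obj γ (x.map (simplexTop 1)).1 := by
        intro β γ
        rw [simplexFace_vertex]
        have h2 := congrArg Subtype.val (x.map_d β 0 (simplexTop 1))
        exact (congrArg (C.obj γ) h2).trans (C.obj_d γ β 0 _)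
      exact Prod.ext ((h1 true false).trans (h1 false false).symm)
        ((h1 true true).trans (h1 false true).symm)
    | succ n =>
      apply OmegaCat.Functor.ext
      funext u
      exact congrArg (OmegaCat.Functor.map x) (simplexFace_comm i j hij u)
  thin
    | 0 => ∅
    | 1 => ∅
    | n + 2 => {f | C.P.dim (OmegaCat.Functor.map f (simplexTop (n + 1))) ≤ n}

/-- The simplices of the corner nerves (with a shift by one): the `(-1)`-simplices are the
`0`-morphisms, and the `n`-simplices are the corner functors from `I^{n+1}`. -/
def CornerX (α : Bool) (C : NCat.{u}) : ℕ → Type u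
  | 0 => C.Obj
  | n + 1 => {f : OmegaCat.Functor (cube (n + 1)).nu C.cat // IsCorner α f}

/-- The faces of the corner nerves; the augmentation maps a morphism of dimension `1` to its
source for the branching nerve (`α = false`) and to its target for the merging nerve
(`α = true`). -/
def cornerFace (α : Bool) (C : NCat.{u}) :
    (n : ℕ) → Fin (n + 1) → CornerX α C (n + 1) → CornerX α C n
  | 0, _, f => C.obj α (f.1.map (cubeTop 1))
  | n + 1, i, f => ⟨f.1.comp (cubeFace (n + 1) i α).functor, f.2.face i⟩

/-- The branching semi-cubical nerve (`α = false`) and the merging semi-cubical nerve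
(`α = true`). An `n`-simplex is thin if the image of the interior of `I^{n+1}` is of dimension at
most `n`, for `n ≥ 1`. -/
def cornerNerve (α : Bool) (C : NCat.{u}) : Nerve.{u} where
  X := CornerX α C
  face := cornerFace α C
  face_face n i j hij x := by
    cases n with
    | zero =>
      change {f : OmegaCat.Functor (cube 2).nu C.cat // IsCorner α f} at x
      have h1 : ∀ i : Fin 2, C.obj α (x.1.map ((cubeFace 1 i α).push (cubeTop 1))) =
          ⟨x.1.map (corner α 2), by
            have := x.1.dim_map_le (corner α 2)
            rw [show (cube 2).nu.dim (corner α 2) = 0 from DirectedComplex.dim_point _ _] at this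
            omega⟩ := by
        intro i
        refine Subtype.ext ?_
        refine (x.1.map_d α 0 ((cubeFace 1 i α).functor.map (cubeTop 1))).symm.trans ?_
        refine congrArg x.1.map (((cubeFace 1 i α).functor.map_d α 0 (cubeTop 1)).symm.trans ?_)
        rw [cube_corner]
        exact cubeFace_corner 1 i α
      exact (h1 _).trans (h1 _).symm
    | succ n =>
      refine Subtype.ext (OmegaCat.Functor.ext ?_)
      funext u
      exact congrArg x.1.map (cubeFace_comm i j hij α α u)
  thin
    | 0 => ∅
    | 1 => ∅
    | n + 2 => {f | C.cat.dim (f.1.map (cubeTop (n + 2))) ≤ n + 1}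

/-- The three homology theories: globular, branching (`corner false`) and merging
(`corner true`). -/
inductive Kind : Type
  | globular
  | corner (α : Bool)

/-- The nerve defining each of the three homology theories. -/
def nerve : Kind → NCat.{u} → Nerve.{u}
  | .globular, C => globNerve C
  | .corner α, C => cornerNerve α C

/-- The map of globular nerves induced by a non-contracting `ω`-functor. -/
def globMap {C D : NCat.{u}} (F : NFunctor C D) : (n : ℕ) → GlobX C n → GlobX D n
  | 0, x => (F.onObj x.1, F.onObj x.2)
  | _ + 1, f => OmegaCat.Functor.comp F.P f

/-- The map of corner nerves induced by a non-contracting `ω`-functor. -/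
def cornerMap (α : Bool) {C D : NCat.{u}} (F : NFunctor C D) :
    (n : ℕ) → CornerX α C n → CornerX α D n
  | 0, x => F.onObj x
  | _ + 1, f => ⟨F.fn.comp f.1, f.2.comp F.nc⟩

/-- The map of nerves induced by a non-contracting `ω`-functor. -/
def nerveMap {C D : NCat.{u}} (F : NFunctor C D) :
    (κ : Kind) → (n : ℕ) → (nerve κ C).X n → (nerve κ D).X n
  | .globular => globMap F
  | .corner α => cornerMap α F

theorem nerveMap_face {C D : NCat.{u}} (F : NFunctor C D) (κ : Kind) (n : ℕ) (i : Fin (n + 1))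
    (x : (nerve κ C).X (n + 1)) :
    nerveMap F κ n ((nerve κ C).face n i x) = (nerve κ D).face n i (nerveMap F κ (n + 1) x) := by
  cases κ with
  | globular =>
    cases n with
    | zero =>
      change OmegaCat.Functor (simplex 0).nu C.P at x
      exact Prod.ext (F.onObj_obj false (x.map (simplexTop 0)).1)
        (F.onObj_obj true (x.map (simplexTop 0)).1)
    | succ n => rfl
  | corner α =>
    cases n with
    | zero =>
      change {f : OmegaCat.Functor (cube 1).nu C.cat // IsCorner α f} at x
      exact F.onObj_obj α (x.1.map (cubeTop 1))
    | succ n => rfl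

/-- The chain complexes `C^{gl}`, `C^-` and `C^+`. -/
def chains (κ : Kind) (C : NCat.{u}) : ChainComplex (ModuleCat.{u} ℤ) ℕ :=
  (nerve κ C).chains.complex

/-- The reduced chain complexes `CR^{gl}`, `CR^-` and `CR^+`. -/
def reducedChains (κ : Kind) (C : NCat.{u}) : ChainComplex (ModuleCat.{u} ℤ) ℕ :=
  (nerve κ C).reduced.complex

/-- The morphism of chain complexes induced by a non-contracting `ω`-functor. -/
def chainsMap (κ : Kind) {C D : NCat.{u}} (F : NFunctor C D) : chains κ C ⟶ chains κ D :=
  (Nerve.induces_map (nerveMap F κ) (nerveMap_face F κ)).map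

/-- The projections `C^{gl} → CR^{gl}`, `C^- → CR^-` and `C^+ → CR^+`. -/
def reduceMap (κ : Kind) (C : NCat.{u}) : chains κ C ⟶ reducedChains κ C :=
  (nerve κ C).reduce

/-! ### The formal complexes and the folding operators -/

/-- The generators of the formal complexes: in degree `0`, the pairs of `0`-morphisms or the
`0`-morphisms; in degree `n + 1`, the morphisms of dimension between `1` and `n + 1`. -/
def FormalG (κ : Kind) (C : NCat.{u}) : ℕ → Type u
  | 0 => (nerve κ C).X 0
  | n + 1 => {x : C.cat // 1 ≤ C.cat.dim x ∧ C.cat.dim x ≤ n + 1}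

/-- The relations of the formal complexes in degree `n + 1`: the morphisms of dimension at most `n`
vanish, `x *_p y = x + y` for `1 ≤ p ≤ n`, and in addition `x *_0 y = x` for the branching complex
and `x *_0 y = y` for the merging complex. -/
def formalRel (κ : Kind) (C : NCat.{u}) (n : ℕ) : Set (FormalG κ C (n + 1) →₀ ℤ) :=
  {v | (∃ x : FormalG κ C (n + 1), C.cat.dim x.1 ≤ n ∧ v = Finsupp.single x 1) ∨
    (∃ x y z : FormalG κ C (n + 1), (∃ p, 1 ≤ p ∧ p ≤ n ∧ ∃ h, z.1 = C.cat.comp p x.1 y.1 h) ∧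
      v = Finsupp.single z 1 - Finsupp.single x 1 - Finsupp.single y 1) ∨
    (∃ α, κ = .corner α ∧ ∃ x y z : FormalG κ C (n + 1),
      (∃ h, z.1 = C.cat.comp 0 x.1 y.1 h) ∧
      v = Finsupp.single z 1 - Finsupp.single (if α then y else x) 1)}

/-- The differential in degree `1`: `x ↦ (s_0 x, t_0 x)`, `x ↦ s_0 x` and `x ↦ t_0 x` for the
globular, branching and merging complexes. -/
def formalAug (C : NCat.{u}) : (κ : Kind) → FormalG κ C 1 → FormalG κ C 0
  | .globular, x => (C.obj false x.1, C.obj true x.1)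
  | .corner α, x => C.obj α x.1

/-- `s_{n+1}` and `t_{n+1}` on the generators of degree `n + 2`. -/
def formalFace (κ : Kind) (C : NCat.{u}) (n : ℕ) (β : Bool) (x : FormalG κ C (n + 2)) :
    FormalG κ C (n + 1) :=
  ⟨C.cat.d β (n + 1) x.1, C.nc.one_le_dim_d x.2.1 β n, C.cat.dim_d_le β (n + 1) x.1⟩

/-- The sign of the differential: the differential is `s_{n-1} - t_{n-1}` for the globular and the
branching complexes, and `t_{n-1} - s_{n-1}` for the merging complex. -/
def Kind.sign : Kind → ℤ
  | .corner true => -1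
  | _ => 1

/-- The differential of the formal complexes, on generators. -/
def formalBdry (κ : Kind) (C : NCat.{u}) :
    (n : ℕ) → (FormalG κ C (n + 1) →₀ ℤ) →ₗ[ℤ] (FormalG κ C n →₀ ℤ)
  | 0 => Finsupp.lmapDomain ℤ ℤ (formalAug C κ)
  | n + 1 => κ.sign • (Finsupp.lmapDomain ℤ ℤ (formalFace κ C n false) -
      Finsupp.lmapDomain ℤ ℤ (formalFace κ C n true))

theorem formalBdry_zero (κ : Kind) (C : NCat.{u}) (x : FormalG κ C 1) :
    formalBdry κ C 0 (Finsupp.single x 1) = Finsupp.single (formalAug C κ x) 1 := by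
  simp [formalBdry, Finsupp.mapDomain_single]

theorem formalBdry_succ (κ : Kind) (C : NCat.{u}) (n : ℕ) (x : FormalG κ C (n + 2)) :
    formalBdry κ C (n + 1) (Finsupp.single x 1) = κ.sign •
      (Finsupp.single (formalFace κ C n false x) 1 -
        Finsupp.single (formalFace κ C n true x) 1) := by
  simp [formalBdry, Finsupp.mapDomain_single]

/-- The submodule of relations in degree `n`. -/
def formalSpan (κ : Kind) (C : NCat.{u}) : (n : ℕ) → Submodule ℤ (FormalG κ C n →₀ ℤ)
  | 0 => ⊥
  | n + 1 => Submodule.span ℤ (formalRel κ C n)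

theorem formalFace_comp (κ : Kind) (C : NCat.{u}) (n p : ℕ) (hp : p ≠ n + 1) (β : Bool)
    {x y z : FormalG κ C (n + 2)} (h : ∃ h, z.1 = C.cat.comp p x.1 y.1 h) :
    ∃ h, (formalFace κ C n β z).1 =
      C.cat.comp p (formalFace κ C n β x).1 (formalFace κ C n β y).1 h := by
  obtain ⟨h, hz⟩ := h
  have h' : C.cat.d true p (C.cat.d β (n + 1) x.1) = C.cat.d false p (C.cat.d β (n + 1) y.1) := by
    rcases lt_or_gt_of_ne hp with hp | hp
    · rw [C.cat.d_d_lt _ _ _ _ hp, C.cat.d_d_lt _ _ _ _ hp, h]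
    · have h1 : C.cat.d β (n + 1) (C.cat.d true p x.1) =
          C.cat.d β (n + 1) (C.cat.d false p y.1) := by rw [h]
      rw [C.cat.d_d_lt _ _ _ _ hp, C.cat.d_d_lt _ _ _ _ hp] at h1
      rw [C.cat.d_d_ge _ _ _ _ hp.le, C.cat.d_d_ge _ _ _ _ hp.le, h1]
  refine ⟨h', ?_⟩
  change C.cat.d β (n + 1) z.1 = _
  rw [hz]
  exact C.cat.d_comp β (n + 1) p (Ne.symm hp) x.1 y.1 h h'

theorem formalFace_rel (κ : Kind) (C : NCat.{u}) (n : ℕ) :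
    Submodule.span ℤ (formalRel κ C (n + 1)) ≤
      (Submodule.span ℤ (formalRel κ C n)).comap (formalBdry κ C (n + 1)) := by
  rw [Submodule.span_le]
  rintro v (⟨x, hx, rfl⟩ | ⟨x, y, z, ⟨p, hp, hp', h⟩, rfl⟩ | ⟨α, hα, x, y, z, h, rfl⟩)
  · rw [SetLike.mem_coe, Submodule.mem_comap, formalBdry_succ]
    have : formalFace κ C n false x = formalFace κ C n true x :=
      Subtype.ext (((C.cat.dim_le_iff false _ _).1 hx).trans
        ((C.cat.dim_le_iff true _ _).1 hx).symm)
    rw [this, sub_self, smul_zero]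
    exact Submodule.zero_mem _
  · rw [SetLike.mem_coe, Submodule.mem_comap, map_sub, map_sub, formalBdry_succ, formalBdry_succ,
      formalBdry_succ, ← smul_sub, ← smul_sub]
    refine Submodule.smul_mem _ _ ?_
    rcases eq_or_ne p (n + 1) with rfl | hpn
    · obtain ⟨h, hz⟩ := h
      have e1 : formalFace κ C n false z = formalFace κ C n false x := by
        refine Subtype.ext ?_
        change C.cat.d false (n + 1) z.1 = _
        rw [hz]
        exact C.cat.src_comp _ _ _ h
      have e2 : formalFace κ C n true z = formalFace κ C n true y := by
        refine Subtype.ext ?_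
        change C.cat.d true (n + 1) z.1 = _
        rw [hz]
        exact C.cat.tgt_comp _ _ _ h
      have e3 : formalFace κ C n true x = formalFace κ C n false y := Subtype.ext h
      rw [e1, e2, e3]
      convert Submodule.zero_mem (Submodule.span ℤ (formalRel κ C n)) using 1
      abel
    · have key : ∀ β, (Finsupp.single (formalFace κ C n β z) (1 : ℤ) -
          Finsupp.single (formalFace κ C n β x) 1 - Finsupp.single (formalFace κ C n β y) 1) ∈
          Submodule.span ℤ (formalRel κ C n) := fun β =>
        Submodule.subset_span (Or.inr (Or.inl ⟨_, _, _,
          ⟨p, hp, by omega, formalFace_comp κ C n p hpn β h⟩, rfl⟩))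
      convert Submodule.sub_mem _ (key false) (key true) using 1
      abel
  · rw [SetLike.mem_coe, Submodule.mem_comap, map_sub, formalBdry_succ, formalBdry_succ,
      ← smul_sub]
    refine Submodule.smul_mem _ _ ?_
    have key : ∀ β, (Finsupp.single (formalFace κ C n β z) (1 : ℤ) -
        Finsupp.single (formalFace κ C n β (if α then y else x)) 1) ∈
        Submodule.span ℤ (formalRel κ C n) := fun β => by
      refine Submodule.subset_span (Or.inr (Or.inr ⟨α, hα, _, _, _,
        formalFace_comp κ C n 0 (by omega) β h, ?_⟩))
      cases α <;> rfl
    convert Submodule.sub_mem _ (key false) (key true) using 1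
    abel

theorem formalAug_rel (κ : Kind) (C : NCat.{u}) :
    Submodule.span ℤ (formalRel κ C 0) ≤ (⊥ : Submodule ℤ _).comap (formalBdry κ C 0) := by
  rw [Submodule.span_le]
  rintro v (⟨x, hx, rfl⟩ | ⟨x, y, z, ⟨p, hp, hp', h⟩, rfl⟩ | ⟨α, rfl, x, y, z, ⟨h, hz⟩, rfl⟩)
  · have := x.2.1
    omega
  · omega
  · rw [SetLike.mem_coe, Submodule.mem_comap, map_sub, formalBdry_zero, formalBdry_zero,
      Submodule.mem_bot, sub_eq_zero]
    congr 1
    change C.obj α z.1 = C.obj α _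
    refine Subtype.ext ?_
    change C.cat.d α 0 z.1 = _
    rw [hz]
    cases α
    · exact C.cat.src_comp _ _ _ h
    · exact C.cat.tgt_comp _ _ _ h

/-- The formal globular, branching and merging complexes `CF^{gl}`, `CF^-` and `CF^+`. -/
def formal (κ : Kind) (C : NCat.{u}) : PresentedComplex.{u} where
  G := FormalG κ C
  rel := formalSpan κ C
  d := formalBdry κ C
  d_rel n := by
    cases n with
    | zero => exact formalAug_rel κ C
    | succ n => exact formalFace_rel κ C n
  d_d n x := by
    have key : formalBdry κ C n ∘ₗ formalBdry κ C (n + 1) = 0 := by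
      refine Finsupp.lhom_ext' fun x => LinearMap.ext_ring ?_
      change formalBdry κ C n (formalBdry κ C (n + 1) (Finsupp.single x 1)) = 0
      rw [formalBdry_succ, map_smul, map_sub]
      cases n with
      | zero =>
        rw [formalBdry_zero, formalBdry_zero]
        have : formalAug C κ (formalFace κ C 0 false x) =
            formalAug C κ (formalFace κ C 0 true x) := by
          cases κ with
          | globular =>
            exact Prod.ext ((C.obj_d false false 0 x.1).trans (C.obj_d false true 0 x.1).symm)
              ((C.obj_d true false 0 x.1).trans (C.obj_d true true 0 x.1).symm)
          | corner α => exact (C.obj_d α false 0 x.1).trans (C.obj_d α true 0 x.1).symm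
        rw [this, sub_self, smul_zero]
      | succ n =>
        rw [formalBdry_succ, formalBdry_succ]
        have : ∀ β, formalFace κ C n β (formalFace κ C (n + 1) false x) =
            formalFace κ C n β (formalFace κ C (n + 1) true x) := fun β =>
          Subtype.ext ((C.cat.d_d_lt false β (n + 1) (n + 2) (by omega) x.1).trans
            (C.cat.d_d_lt true β (n + 1) (n + 2) (by omega) x.1).symm)
        rw [this, this, sub_self, smul_zero]
    have h : formalBdry κ C n (formalBdry κ C (n + 1) x) = 0 := LinearMap.congr_fun key x
    exact (congrArg (· ∈ formalSpan κ C n) h).mpr (Submodule.zero_mem _)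

/-- The folding operators `□_n`: the identity in degree `0`, and in degree `n + 1` the map from
morphisms to `n`-simplices given by the folding maps onto the globe. -/
def box (C : NCat.{u}) : (κ : Kind) → (n : ℕ) → FormalG κ C n → (nerve κ C).X n
  | _, 0, x => x
  | .globular, n + 1, x => globFold (C := C.P) (n := n) ⟨x.1, x.2.1⟩
      ((OmegaCat.path_dim_le C.nc n _).2 x.2.2)
  | .corner α, _ + 1, x => ⟨cornerFold α x.1 x.2.2, cornerFold_isCorner α C.nc x.1 x.2.1 x.2.2⟩

/-- The thin elements conjecture for `C`: the projections of the globular, branching and merging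
chain complexes onto the reduced complexes are quasi-isomorphisms. -/
def ThinElementsConjecture (C : NCat.{u}) : Prop :=
  ∀ κ, QuasiIso (reduceMap κ C)

/-- The folding conjecture for `C`: the folding operators induce quasi-isomorphisms from the formal
complexes to the reduced complexes. -/
def FoldingConjecture (C : NCat.{u}) : Prop :=
  ∀ κ, ∃ h : PresentedComplex.Induces (formal κ C) (nerve κ C).reduced (box C κ), QuasiIso h.map

/-! ### `ω`-categories presented by generators and models -/

theorem OmegaCat.IsInverse.unique {C : OmegaCat.{u}} {r : ℕ} {x y z : C}
    (hy : C.IsInverse r x y) (hz : C.IsInverse r x z) : y = z := by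
  obtain ⟨a, b, -, hyx⟩ := hy
  obtain ⟨a', b', hxz, -⟩ := hz
  have key1 : ∀ (w : C) (e : C.comp r x z a' = w) h, C.comp r y (C.comp r x z a') h =
      C.comp r y w (by rw [← e]; exact h) := by
    rintro _ rfl h; rfl
  have key2 : ∀ (w : C) (e : C.comp r y x b = w) h, C.comp r (C.comp r y x b) z h =
      C.comp r w z (by rw [← e]; exact h) := by
    rintro _ rfl h; rfl
  have h1 : C.d true r y = C.d false r (C.comp r x z a') := by rw [C.src_comp, b]
  have h2 : C.d true r (C.comp r y x b) = C.d false r z := by rw [C.tgt_comp, a']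
  have h3 := C.assoc r y x z b a' h2 h1
  rw [key1 _ hxz, key2 _ hyx] at h3
  have e1 : ∀ (w : C) (e : w = C.d true r y) h, C.comp r y w h = y := by
    rintro _ rfl h; exact C.comp_id r y h
  have e2 : ∀ (w : C) (e : w = C.d false r z) h, C.comp r w z h = z := by
    rintro _ rfl h; exact C.id_comp r z h
  rw [e1 _ b.symm, e2 _ (a.symm.trans a')] at h3
  exact h3.symm

theorem OmegaCat.IsInverse.dim_le {C : OmegaCat.{u}} {r N : ℕ} {x y : C} (hrN : r < N)
    (hx : C.dim x ≤ N) (h : C.IsInverse r x y) : C.dim y ≤ N := by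
  have h0 := h
  obtain ⟨a, b, hxy, hyx⟩ := h
  rw [C.dim_le_iff false]
  have hx' := (C.dim_le_iff false N x).1 hx
  have a' : C.d true r x = C.d false r (C.d false N y) := by rw [C.d_d_lt _ _ _ _ hrN, a]
  have b' : C.d true r (C.d false N y) = C.d false r x := by rw [C.d_d_lt _ _ _ _ hrN, b]
  refine OmegaCat.IsInverse.unique ⟨a', b', ?_, ?_⟩ h0
  · have h1 := C.d_comp false N r (by omega) x y a (by rw [hx']; exact a')
    rw [hxy, C.d_d_ge _ _ _ _ hrN.le] at h1
    rw [h1]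
    congr 1
    exact hx'.symm
  · have h1 := C.d_comp false N r (by omega) y x b (by rw [hx']; exact b')
    rw [hyx, C.d_d_ge _ _ _ _ hrN.le] at h1
    rw [C.d_d_lt _ _ _ _ hrN, h1]
    congr 1
    exact hx'.symm

/-- Formal expressions in the operations of `ω`-categories and in inverses. -/
inductive Term (X : Type u) : Type u
  | gen (x : X)
  | d (α : Bool) (n : ℕ) (t : Term X)
  | comp (n : ℕ) (s t : Term X)
  | inv (r : ℕ) (t : Term X)

/-- The data for presenting an `ω`-category: generators, and the class of those maps from the
generators to `ω`-categories (the models) through which the presented `ω`-category should factor.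
If `inverses` holds, then inverses for the composition laws `*_r`, `r ≥ 1`, exist in all models
and are added to the presented `ω`-category. -/
structure Presentation where
  X : Type u
  IsModel : (D : OmegaCat.{u}) → (X → D) → Prop
  inverses : Prop
  bound : ∀ x, ∃ N, ∀ D f, IsModel D f → D.dim (f x) ≤ N
  exists_inverse : inverses → ∀ D f, IsModel D f → ∀ (x : D) r, 1 ≤ r → ∃ y, D.IsInverse r x y

namespace Presentation

variable (P : Presentation.{u})

open Classical in
/-- The value of an expression (a junk value if a composite or an inverse does not exist). -/
def eval (D : OmegaCat.{u}) (f : P.X → D) : Term P.X → D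
  | .gen x => f x
  | .d α n t => D.d α n (eval D f t)
  | .comp n s t =>
    if h : D.d true n (eval D f s) = D.d false n (eval D f t) then
      D.comp n (eval D f s) (eval D f t) h
    else eval D f s
  | .inv r t => if h : ∃ y, D.IsInverse r (eval D f t) y then h.choose else eval D f t

/-- An expression is valid if its composites exist in all models, and if only inverses that should
be added occur. -/
def Valid : Term P.X → Prop
  | .gen _ => True
  | .d _ _ t => Valid t
  | .comp n s t => Valid s ∧ Valid t ∧ ∀ D f, P.IsModel D f →
      D.d true n (P.eval D f s) = D.d false n (P.eval D f t)
  | .inv r t => Valid t ∧ P.inverses ∧ 1 ≤ r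

/-- Two valid expressions are equivalent if they have the same value in all models. -/
def setoid : Setoid {t : Term P.X // P.Valid t} where
  r s t := ∀ D f, P.IsModel D f → P.eval D f s.1 = P.eval D f t.1
  iseqv :=
    { refl := fun _ _ _ _ => rfl
      symm := fun h D f hf => (h D f hf).symm
      trans := fun h h' D f hf => (h D f hf).trans (h' D f hf) }

/-- The morphisms of the presented `ω`-category. -/
def Carrier : Type u := Quotient P.setoid

variable {P}

/-- The value of a morphism of the presented `ω`-category in a model. -/
def ev {D : OmegaCat.{u}} {f : P.X → D} (hf : P.IsModel D f) (q : P.Carrier) : D :=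
  Quotient.lift (s := P.setoid) (fun t => P.eval D f t.1) (fun _ _ h => h D f hf) q

theorem ev_ext {q q' : P.Carrier}
    (h : ∀ (D : OmegaCat.{u}) (f : P.X → D) (hf : P.IsModel D f), ev hf q = ev hf q') : q = q' := by
  induction q using Quotient.inductionOn
  induction q' using Quotient.inductionOn
  exact Quotient.sound (s := P.setoid) h

theorem ev_out {D : OmegaCat.{u}} {f : P.X → D} (hf : P.IsModel D f) (q : P.Carrier) :
    P.eval D f (Quotient.out (s := P.setoid) q).1 = ev hf q :=
  congrArg (ev hf) (Quotient.out_eq (s := P.setoid) q)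

/-- The morphism given by a generator. -/
def ofGen (x : P.X) : P.Carrier := Quotient.mk P.setoid ⟨.gen x, trivial⟩

theorem ev_ofGen {D : OmegaCat.{u}} {f : P.X → D} (hf : P.IsModel D f) (x : P.X) :
    ev hf (ofGen x) = f x := rfl

/-- `s_n` and `t_n` in the presented `ω`-category. -/
def dd (α : Bool) (n : ℕ) (q : P.Carrier) : P.Carrier :=
  Quotient.mk P.setoid ⟨.d α n (Quotient.out (s := P.setoid) q).1,
    (Quotient.out (s := P.setoid) q).2⟩

theorem ev_dd {D : OmegaCat.{u}} {f : P.X → D} (hf : P.IsModel D f) (α : Bool) (n : ℕ)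
    (q : P.Carrier) : ev hf (dd α n q) = D.d α n (ev hf q) :=
  congrArg (D.d α n) (ev_out hf q)

theorem ev_composable {D : OmegaCat.{u}} {f : P.X → D} (hf : P.IsModel D f) {n : ℕ}
    {p q : P.Carrier} (h : dd true n p = dd false n q) :
    D.d true n (ev hf p) = D.d false n (ev hf q) := by
  rw [← ev_dd, ← ev_dd, h]

/-- Composition in the presented `ω`-category. -/
def cc (n : ℕ) (p q : P.Carrier) (h : dd true n p = dd false n q) : P.Carrier :=
  Quotient.mk P.setoid
    ⟨.comp n (Quotient.out (s := P.setoid) p).1 (Quotient.out (s := P.setoid) q).1,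
      (Quotient.out (s := P.setoid) p).2, (Quotient.out (s := P.setoid) q).2, fun D f hf => by
        rw [ev_out hf, ev_out hf]
        exact ev_composable hf h⟩

theorem ev_cc {D : OmegaCat.{u}} {f : P.X → D} (hf : P.IsModel D f) (n : ℕ) (p q : P.Carrier)
    (h : dd true n p = dd false n q) :
    ev hf (cc n p q h) = D.comp n (ev hf p) (ev hf q) (ev_composable hf h) := by
  have key : ∀ (x y x' y' : D) (_ : x = x') (_ : y = y')
      (h' : D.d true n x' = D.d false n y') [Decidable (D.d true n x = D.d false n y)],
      (if h : D.d true n x = D.d false n y then D.comp n x y h else x) = D.comp n x' y' h' := by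
    rintro x y _ _ rfl rfl h' _
    exact dif_pos h'
  exact @key _ _ _ _ (ev_out hf p) (ev_out hf q) _ (Classical.propDecidable _)

theorem eval_bound (t : Term P.X) (ht : P.Valid t) :
    ∃ N, ∀ D f, P.IsModel D f → D.dim (P.eval D f t) ≤ N := by
  induction t with
  | gen x => exact P.bound x
  | d α n t ih =>
    obtain ⟨N, hN⟩ := ih ht
    exact ⟨N, fun D f hf => (D.dim_d_le_dim α n _).trans (hN D f hf)⟩
  | comp n s t ihs iht =>
    obtain ⟨N, hN⟩ := ihs ht.1
    obtain ⟨M, hM⟩ := iht ht.2.1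
    refine ⟨max N M, fun D f hf => ?_⟩
    have h := ht.2.2 D f hf
    rw [eval, dif_pos h]
    exact D.dim_comp_le h ((hN D f hf).trans (le_max_left _ _))
      ((hM D f hf).trans (le_max_right _ _))
  | inv r t ih =>
    obtain ⟨N, hN⟩ := ih ht.1
    refine ⟨max N (r + 1), fun D f hf => ?_⟩
    have h := P.exists_inverse ht.2.1 D f hf (P.eval D f t) r ht.2.2
    rw [eval, dif_pos h]
    exact OmegaCat.IsInverse.dim_le (by omega) ((hN D f hf).trans (le_max_left _ _))
      h.choose_spec

variable (P)

/-- The presented `ω`-category. -/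
def cat : OmegaCat.{u} where
  carrier := P.Carrier
  d := dd
  comp := cc
  d_d_lt α β m n h x := ev_ext fun D f hf => by
    simp only [ev_dd]; exact D.d_d_lt α β m n h _
  d_d_ge α β m n h x := ev_ext fun D f hf => by
    simp only [ev_dd]; exact D.d_d_ge α β m n h _
  id_comp n x h := ev_ext fun D f hf => by
    simp only [ev_cc, ev_dd]; exact D.id_comp n _ _
  comp_id n x h := ev_ext fun D f hf => by
    simp only [ev_cc, ev_dd]; exact D.comp_id n _ _
  src_comp n x y h := ev_ext fun D f hf => by
    simp only [ev_cc, ev_dd]; exact D.src_comp n _ _ _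
  tgt_comp n x y h := ev_ext fun D f hf => by
    simp only [ev_cc, ev_dd]; exact D.tgt_comp n _ _ _
  d_comp α m n hmn x y h h' := ev_ext fun D f hf => by
    simp only [ev_cc, ev_dd]; exact D.d_comp α m n hmn _ _ _ _
  assoc n x y z hxy hyz h h' := ev_ext fun D f hf => by
    simp only [ev_cc]; exact D.assoc n _ _ _ _ _ _ _
  interchange m n hmn x y z w hxy hzw hxz hyw h h' := ev_ext fun D f hf => by
    simp only [ev_cc]; exact D.interchange m n hmn _ _ _ _ _ _ _ _ _ _
  finite_dim x := by
    obtain ⟨N, hN⟩ := eval_bound (Quotient.out (s := P.setoid) x).1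
      (Quotient.out (s := P.setoid) x).2
    have h : ∀ α, dd α N x = x := fun α => ev_ext fun D f hf => by
      rw [ev_dd, ← D.dim_le_iff, ← ev_out hf]
      exact hN D f hf
    exact ⟨N, h false, h true⟩

variable {P}

/-- The functor from the presented `ω`-category to a model. -/
def toModel {D : OmegaCat.{u}} {f : P.X → D} (hf : P.IsModel D f) : OmegaCat.Functor P.cat D where
  map := ev hf
  map_d α n x := ev_dd hf α n x
  map_comp n x y h _ := ev_cc hf n x y h

/-- A morphism is of dimension at most `n` if this is so in all models. -/
theorem dim_le {n : ℕ} {q : P.cat}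
    (h : ∀ (D : OmegaCat.{u}) (f : P.X → D) (hf : P.IsModel D f), D.dim (ev hf q) ≤ n) :
    P.cat.dim q ≤ n := by
  rw [P.cat.dim_le_iff false]
  refine ev_ext fun D f hf => ?_
  refine (ev_dd hf false n q).trans ?_
  exact (D.dim_le_iff false n _).1 (h D f hf)

end Presentation

/-! ### The free `ω`-category generated by a precubical set -/

/-- A precubical set: the sets of `n`-cubes and the face maps `∂_i^α`, with
`∂_i^α ∂_j^β = ∂_{j-1}^β ∂_i^α` for `i < j`. -/
structure PrecubicalSet where
  cells : ℕ → Type u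
  face : (n : ℕ) → Fin (n + 1) → Bool → cells (n + 1) → cells n
  face_face : ∀ n (i j : Fin (n + 1)), i ≤ j → ∀ (α β : Bool) (k : cells (n + 2)),
    face n i α (face (n + 1) j.succ β k) = face n j β (face (n + 1) i.castSucc α k)

/-- The free `ω`-category generated by a precubical set `K` is the colimit of the cubes `I^n`
indexed by the cubes of `K`: its generators are the elements of one copy of `I^n` for each `n`-cube
of `K`, and a model is a family of `ω`-functors from these copies that is compatible with the
faces. -/
def freePresentation (K : PrecubicalSet.{u}) : Presentation.{u} where
  X := Σ n, K.cells n × (cube n).Table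
  IsModel D f :=
    (∀ n k, ∃ F : OmegaCat.Functor (cube n).nu D, ∀ x, F.map x = f ⟨n, k, x⟩) ∧
    ∀ n i α k x, f ⟨n, K.face n i α k, x⟩ = f ⟨n + 1, k, (cubeFace n i α).push x⟩
  inverses := False
  bound := by
    rintro ⟨n, k, x⟩
    refine ⟨(cube n).nu.dim x, fun D f hf => ?_⟩
    obtain ⟨F, hF⟩ := hf.1 n k
    exact (congrArg D.dim (hF x)).symm.le.trans (F.dim_map_le x)
  exists_inverse h := h.elim

theorem length_isModel (K : PrecubicalSet.{u}) :
    (freePresentation K).IsModel natCat.{u} (fun x => ⟨Cube.length x.2.2⟩) :=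
  ⟨fun n _ => ⟨Cube.lengthFunctor n, fun _ => rfl⟩,
    fun _ i α _ x => ULift.ext _ _ (cubeFace_length i α x).symm⟩

theorem free_dim_zero (K : PrecubicalSet.{u}) (t : Term (freePresentation K).X)
    (ht : (freePresentation K).Valid t)
    (h : ((freePresentation K).eval natCat.{u} (fun x => ⟨Cube.length x.2.2⟩) t).down = 0)
    (D : OmegaCat.{u}) (f : (freePresentation K).X → D) (hf : (freePresentation K).IsModel D f) :
    D.dim ((freePresentation K).eval D f t) ≤ 0 := by
  induction t with
  | gen x =>
    obtain ⟨n, k, x⟩ := x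
    obtain ⟨F, hF⟩ := hf.1 n k
    exact (congrArg D.dim (hF x)).symm.le.trans
      ((F.dim_map_le x).trans (Cube.dim_of_length h).le)
  | d α n t ih =>
    rcases Nat.eq_zero_or_pos n with rfl | hn
    · exact D.dim_d_le α 0 _
    · refine (D.dim_d_le_dim α n _).trans (ih ht ?_)
      have e : (freePresentation K).eval natCat.{u} (fun x => ⟨Cube.length x.2.2⟩) (.d α n t) =
          (freePresentation K).eval natCat.{u} (fun x => ⟨Cube.length x.2.2⟩) t :=
        if_neg hn.ne'
      rwa [e] at h
  | comp n s t ihs iht =>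
    have h1 := ht.2.2 _ _ (length_isModel K)
    have h2 : (freePresentation K).eval natCat.{u} (fun x => ⟨Cube.length x.2.2⟩) (.comp n s t) =
        natCat.comp n _ _ h1 := dif_pos h1
    rw [h2] at h
    have h3 := ht.2.2 D f hf
    have h4 : (freePresentation K).eval D f (.comp n s t) = D.comp n _ _ h3 := dif_pos h3
    rw [h4]
    rcases Nat.eq_zero_or_pos n with rfl | hn
    · have h5 : ((freePresentation K).eval natCat.{u} (fun x => ⟨Cube.length x.2.2⟩) s).down +
          ((freePresentation K).eval natCat.{u} (fun x => ⟨Cube.length x.2.2⟩) t).down = 0 := h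
      exact D.dim_comp_le h3 (ihs ht.1 (by omega)) (iht ht.2.1 (by omega))
    · have h5 : natCat.comp n _ _ h1 =
          (freePresentation K).eval natCat.{u} (fun x => ⟨Cube.length x.2.2⟩) s := if_neg hn.ne'
      rw [h5] at h
      have h6 : (freePresentation K).eval natCat.{u} (fun x => ⟨Cube.length x.2.2⟩) s =
          (freePresentation K).eval natCat.{u} (fun x => ⟨Cube.length x.2.2⟩) t :=
        (if_neg hn.ne').symm.trans (h1.trans (if_neg hn.ne'))
      exact D.dim_comp_le h3 (ihs ht.1 h) (iht ht.2.1 (by rwa [h6] at h))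
  | inv r t _ => exact ht.2.1.elim

/-- The length functor, which is additive for the composition `*_0` and constant on the
composites `*_n`, `n ≥ 1`. -/
def lengthFunctor (K : PrecubicalSet.{u}) :
    OmegaCat.Functor (freePresentation K).cat natCat.{u} :=
  Presentation.toModel (length_isModel K)

theorem lengthFunctor_eq_zero (K : PrecubicalSet.{u}) (q : (freePresentation K).cat) :
    natCat.dim ((lengthFunctor K).map q) = 0 ↔ (freePresentation K).cat.dim q = 0 := by
  constructor
  · intro h
    rw [natCat_dim_zero] at h
    refine Nat.le_zero.1 (Presentation.dim_le fun D f hf => ?_)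
    refine (congrArg D.dim (Presentation.ev_out hf q)).symm.le.trans ?_
    refine free_dim_zero K _ (Quotient.out (s := (freePresentation K).setoid) q).2 ?_ D f hf
    exact (congrArg ULift.down (Presentation.ev_out (length_isModel K) q)).trans h
  · intro h
    exact Nat.le_zero.1 (((lengthFunctor K).dim_map_le q).trans h.le)

theorem lengthFunctor_nc (K : PrecubicalSet.{u}) : (lengthFunctor K).NonContracting := by
  intro x hx
  refine le_antisymm (natCat_dim_le _) (Nat.pos_of_ne_zero fun h => ?_)
  rw [lengthFunctor_eq_zero] at h
  omega

/-- The free non-contracting `ω`-category `F(K)` generated by a precubical set `K`. -/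
def free (K : PrecubicalSet.{u}) : NCat.{u} where
  cat := (freePresentation K).cat
  nc x hx := by
    have key : ∀ α, (freePresentation K).cat.dim ((freePresentation K).cat.d α 1 x) = 1 := by
      intro α
      refine le_antisymm ((freePresentation K).cat.dim_d_le α 1 x)
        (Nat.pos_of_ne_zero fun h => ?_)
      rw [← lengthFunctor_eq_zero, (lengthFunctor K).map_d] at h
      have h' : natCat.dim ((lengthFunctor K).map x) = 0 := h
      rw [lengthFunctor_eq_zero] at h'
      omega
    exact ⟨key false, key true⟩

/-! ### Adding inverses to the path `ω`-category -/

theorem exists_inverse_of_path {D : OmegaCat.{u}} (hD : D.NonContracting)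
    (hg : (D.path hD).IsGroupoid) (x : D) (r : ℕ) (hr : 1 ≤ r) : ∃ y, D.IsInverse r x y := by
  obtain ⟨r, rfl⟩ : ∃ r', r = r' + 1 := ⟨r - 1, by omega⟩
  have triv : D.dim x ≤ r + 1 → ∃ y, D.IsInverse (r + 1) x y := by
    intro h
    have h0 := (D.dim_le_iff false (r + 1) x).1 h
    have h1 := (D.dim_le_iff true (r + 1) x).1 h
    have h2 : D.d true (r + 1) x = D.d false (r + 1) x := by rw [h0, h1]
    have h3 : D.comp (r + 1) x x h2 = x := by
      have key : ∀ (y : D) (e : y = D.d true (r + 1) x) h, D.comp (r + 1) x y h = x := by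
        rintro _ rfl h; exact D.comp_id _ x h
      exact key x h1.symm h2
    exact ⟨x, h2, h2, by rw [h3, h0], by rw [h3, h0]⟩
  by_cases hx : 2 ≤ D.dim x
  · have h1 : 1 ≤ (D.path hD).dim ⟨x, by omega⟩ := by
      by_contra h
      have h2 := (OmegaCat.path_dim_le hD 0 ⟨x, by omega⟩).1 (by omega)
      dsimp only at h2
      omega
    obtain ⟨y, a, b, h2, h3⟩ := hg _ h1 r
    exact ⟨y.1, congrArg Subtype.val a, congrArg Subtype.val b, congrArg Subtype.val h2,
      congrArg Subtype.val h3⟩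
  · exact triv (by omega)

/-- The presentation of the `ω`-category obtained from `C` by adding inverses to its path
`ω`-category in a universal way: the generators are the morphisms of `C`, and the models are the
non-contracting `ω`-functors from `C` to non-contracting `ω`-categories whose path `ω`-category is
a groupoid. -/
def hatPresentation (C : NCat.{u}) : Presentation.{u} where
  X := C.cat
  IsModel D f := ∃ hD : D.NonContracting, (D.path hD).IsGroupoid ∧
    ∃ F : OmegaCat.Functor C.cat D, F.NonContracting ∧ ∀ x, F.map x = f x
  inverses := True
  bound x := ⟨C.cat.dim x, by
    rintro D f ⟨hD, -, F, -, hF⟩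
    rw [← hF]
    exact F.dim_map_le x⟩
  exists_inverse := by
    rintro - D f ⟨hD, hg, -⟩ x r hr
    exact exists_inverse_of_path hD hg x r hr

/-- The non-contracting `ω`-category obtained from `C` by making its path `ω`-category a groupoid
in a universal way. -/
def hat (C : NCat.{u}) : NCat.{u} where
  cat := (hatPresentation C).cat
  nc x hx := by
    have key : ∀ α, (hatPresentation C).cat.dim ((hatPresentation C).cat.d α 1 x) = 1 := by
      intro α
      refine le_antisymm ((hatPresentation C).cat.dim_d_le α 1 x)
        (Nat.pos_of_ne_zero fun h => ?_)
      have h1 : (hatPresentation C).cat.dim x ≤ 0 := by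
        refine Presentation.dim_le fun D f hf => ?_
        have hf' := hf
        obtain ⟨hD, -⟩ := hf'
        by_contra h2
        have h3 := hD.dim_d (x := Presentation.ev hf x) (by omega) α
        have h5 := congrArg D.dim (Presentation.ev_dd hf α 1 x)
        have h4 := (Presentation.toModel hf).dim_map_le ((hatPresentation C).cat.d α 1 x)
        rw [h] at h4
        change D.dim (Presentation.ev hf (Presentation.dd α 1 x)) ≤ 0 at h4
        omega
      omega
    exact ⟨key false, key true⟩

/-- The canonical `ω`-functor from `C` to the `ω`-category with inverses. -/
def hatFunctor (C : NCat.{u}) : OmegaCat.Functor C.cat (hat C).cat where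
  map x := Presentation.ofGen (P := hatPresentation C) x
  map_d α n x := Presentation.ev_ext (P := hatPresentation C) fun D f hf => by
    have hf' := hf
    obtain ⟨hD, hg, F, hnc, hF⟩ := hf'
    refine Eq.trans ?_ (Presentation.ev_dd hf α n _).symm
    exact (hF _).symm.trans ((F.map_d α n x).trans (congrArg (D.d α n) (hF x)))
  map_comp n x y h h' := Presentation.ev_ext (P := hatPresentation C) fun D f hf => by
    have hf' := hf
    obtain ⟨hD, hg, F, hnc, hF⟩ := hf'
    refine Eq.trans ?_ (Presentation.ev_cc hf n _ _ h').symm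
    have key : ∀ (x' y' : D) (_ : F.map x = x') (_ : F.map y = y') h'',
        F.map (C.cat.comp n x y h) = D.comp n x' y' h'' := by
      rintro _ _ rfl rfl h''
      exact F.map_comp n x y h h''
    exact (hF _).symm.trans (key _ _ (hF x) (hF y) _)

/-- The canonical non-contracting `ω`-functor from `F(K)` to the `ω`-category with inverses. -/
def toHat (K : PrecubicalSet.{u}) : NFunctor (free K) (hat (free K)) where
  fn := hatFunctor (free K)
  nc x hx := by
    refine le_antisymm (hx ▸ (hatFunctor (free K)).dim_map_le x) ?_
    have hm : (hatPresentation (free K)).IsModel natCat.{u} (lengthFunctor K).map :=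
      ⟨natCat_nc, natCat_groupoid, lengthFunctor K, lengthFunctor_nc K, fun _ => rfl⟩
    have h1 : natCat.dim ((lengthFunctor K).map x) = 1 := lengthFunctor_nc K x hx
    have h2 := (Presentation.toModel hm).dim_map_le ((hatFunctor (free K)).map x)
    exact h1.symm.le.trans h2

end

end HDA

/-! Write `C` for `F(K)` and `Ĉ` for `hat C`. For each of the three kinds there are natural maps
from the chain complex to the reduced complex and from the formal complex to the reduced complex. By
the hypotheses they are quasi-isomorphisms for `C` and for `Ĉ`. By two out of three
(`quasiIso_chainsMap`) it is enough to treat the formal complexes, and there the map `CF(C) → CF(Ĉ)`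
is even an isomorphism in every degree (`formalHat_bijective`). The only further property of `F(K)`
that enters is `UnitFree`: a composite for `*_0` is an identity only if both factors are. It follows
from additivity of the length.

In degrees `0` and `1`, `C` and `Ĉ` have the same morphisms of dimension at most one: inverses are
added only for `*_r` with `r ≥ 1`, and these create no new one-dimensional faces (`hat_exists`,
`hatFunctor_injective`).

Surjectivity in degree `n ≥ 2`. The class is additive for `*_p`, `1 ≤ p < n`, so an inverse for such
a law has the opposite class. A composite for `*_0` is, by the exchange law, a composite for `*_1`
of two morphisms whiskered by `1`-morphisms. Hence an induction on the construction of a morphism of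
`Ĉ`, carried out for all its whiskerings at once, expresses its class through classes of morphisms
of `C` (`hat_whisk_mem`).

Injectivity in degree `n ≥ 2`. The universal property of `Ĉ` is tested on an `ω`-category made from
the group `A = CF_n(C)` itself, the `model`. A cell consists of two `1`-morphisms `x`, `y` of `C`
and two labels `a`, `b` in `A`, to be read as the classes of the `n`-dimensional source and target
of something going from `x` to `y`. The laws `*_p`, `1 ≤ p < n`, add labels, and `*_0` acts on them
by whiskering. The path `ω`-category of the model is a groupoid since labels can be negated, so the
functor `C → model` that remembers classes extends to `Ĉ`. Reading off a label then gives a left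
inverse of `CF_n(C) → CF_n(Ĉ)`.

The delicate point is that unit and interchange laws fail for arbitrary labels in `A`. They hold for
labels obtained from classes of actual morphisms of `C` by composition, formal inversion and
whiskering. The predicate `Span` records such labels together with their ends, and `Span.unit_left`,
`Span.unit_right` and `Span.comm` prove what the model needs. Non-contraction of the model is
`Span.of_dim_zero`, where `UnitFree` is used. -/

namespace HDA

noncomputable section

/-! ### Total composition -/

namespace OmegaCat

variable (C : OmegaCat.{u})

/-- `x` and `y` are composable for `*_n`. -/
abbrev Cmp (n : ℕ) (x y : C) : Prop := C.d true n x = C.d false n y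

open Classical in
/-- The composite `x *_n y`, with the value `x` if it is not defined. -/
def mul (n : ℕ) (x y : C) : C := if h : C.Cmp n x y then C.comp n x y h else x

variable {C}

theorem comp_eq_mul {n : ℕ} {x y : C} (h : C.d true n x = C.d false n y) :
    C.comp n x y h = C.mul n x y := (dif_pos (c := C.Cmp n x y) h).symm

/-- Composability is needed: two morphisms that are not composable may become so after applying `F`,
and then the default value of `mul` is not preserved. -/
theorem Functor.map_mul {D : OmegaCat.{v}} (F : Functor C D) {n : ℕ} {x y : C}
    (h : C.Cmp n x y) : F.map (C.mul n x y) = D.mul n (F.map x) (F.map y) := by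
  have h' : D.d true n (F.map x) = D.d false n (F.map y) := by
    rw [← F.map_d, ← F.map_d]; exact congrArg F.map h
  rw [← comp_eq_mul h, ← comp_eq_mul h', F.map_comp]

theorem Functor.map_cmp {D : OmegaCat.{v}} (F : Functor C D) {n : ℕ} {x y : C}
    (h : C.Cmp n x y) : D.Cmp n (F.map x) (F.map y) := by
  unfold Cmp
  rw [← F.map_d, ← F.map_d]; exact congrArg F.map h

theorem d_eq_self {α : Bool} {n : ℕ} {x : C} (h : C.dim x ≤ n) : C.d α n x = x :=
  (C.dim_le_iff α n x).1 h

theorem cmp_src (n : ℕ) (x : C) : C.Cmp n (C.d false n x) x := C.d_d_ge _ _ _ _ le_rfl x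

theorem cmp_tgt (n : ℕ) (x : C) : C.Cmp n x (C.d true n x) := (C.d_d_ge _ _ _ _ le_rfl x).symm

theorem src_mul (n : ℕ) (x : C) : C.mul n (C.d false n x) x = x := by
  rw [← comp_eq_mul (C.cmp_src n x), C.id_comp]

theorem mul_tgt (n : ℕ) (x : C) : C.mul n x (C.d true n x) = x := by
  rw [← comp_eq_mul (C.cmp_tgt n x), C.comp_id]

theorem mul_self {n : ℕ} {x : C} (h : C.dim x ≤ n) : C.mul n x x = x := by
  have := mul_tgt n x
  rwa [d_eq_self h] at this

theorem cmp_self {n : ℕ} {x : C} (h : C.dim x ≤ n) : C.Cmp n x x :=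
  (d_eq_self h).trans (d_eq_self h).symm

theorem Cmp.eq {n : ℕ} {x y : C} (h : C.Cmp n x y) (hx : C.dim x ≤ n) (hy : C.dim y ≤ n) :
    x = y := by
  unfold Cmp at h
  rwa [d_eq_self hx, d_eq_self hy] at h

theorem d_d_same (α β : Bool) (n : ℕ) (x : C) : C.d β n (C.d α n x) = C.d α n x :=
  C.d_d_ge α β n n le_rfl x

theorem Cmp.d_lt {n m : ℕ} {x y : C} (h : C.Cmp n x y) (hmn : m < n) (α : Bool) :
    C.d α m x = C.d α m y := by
  rw [← C.d_d_lt true α m n hmn x, h, C.d_d_lt _ _ _ _ hmn]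

/-- If `m < n`, then `x` and `y` have the same `m`-faces, and equal signs make the two faces
identical. If `n < m`, taking `m`-faces does not change `n`-faces, so the signs may differ. -/
theorem Cmp.face {n m : ℕ} {x y : C} (h : C.Cmp n x y) (hmn : m ≠ n) (α β : Bool)
    (hαβ : α = β ∨ n < m) : C.Cmp n (C.d α m x) (C.d β m y) := by
  unfold Cmp
  rcases lt_or_gt_of_ne hmn with h' | h'
  · obtain rfl : α = β := hαβ.resolve_right (by omega)
    rw [C.d_d_ge _ _ _ _ h'.le, C.d_d_ge _ _ _ _ h'.le, h.d_lt h']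
  · rw [C.d_d_lt _ _ _ _ h', C.d_d_lt _ _ _ _ h']
    exact h

theorem src_of_mul {n : ℕ} {x y : C} (h : C.Cmp n x y) : C.d false n (C.mul n x y) = C.d false n x := by
  rw [← comp_eq_mul h, C.src_comp]

theorem tgt_of_mul {n : ℕ} {x y : C} (h : C.Cmp n x y) : C.d true n (C.mul n x y) = C.d true n y := by
  rw [← comp_eq_mul h, C.tgt_comp]

theorem d_mul {n m : ℕ} {x y : C} (h : C.Cmp n x y) (hmn : m ≠ n) (α : Bool) :
    C.d α m (C.mul n x y) = C.mul n (C.d α m x) (C.d α m y) := by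
  have h' := h.face hmn α α (Or.inl rfl)
  rw [← comp_eq_mul h, ← comp_eq_mul h', C.d_comp α m n hmn x y h h']

theorem d_mul_lt {n m : ℕ} {x y : C} (h : C.Cmp n x y) (hmn : m < n) (α : Bool) :
    C.d α m (C.mul n x y) = C.d α m x := by
  rw [← C.d_d_lt false α m n hmn, src_of_mul h, C.d_d_lt false α m n hmn]

theorem dim_mul_le {n k : ℕ} {x y : C} (h : C.Cmp n x y) (hx : C.dim x ≤ k) (hy : C.dim y ≤ k) :
    C.dim (C.mul n x y) ≤ k := by
  rw [← comp_eq_mul h]; exact C.dim_comp_le h hx hy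

theorem mul_assoc {n : ℕ} {x y z : C} (h : C.Cmp n x y) (h' : C.Cmp n y z) :
    C.mul n (C.mul n x y) z = C.mul n x (C.mul n y z) := by
  have h1 : C.Cmp n (C.mul n x y) z := (tgt_of_mul h).trans h'
  have h2 : C.Cmp n x (C.mul n y z) := Eq.trans h (src_of_mul h').symm
  have e1 := comp_eq_mul h
  have e2 := comp_eq_mul h'
  rw [← comp_eq_mul h1, ← comp_eq_mul h2]
  simp only [← e1, ← e2]
  exact C.assoc n x y z h h' _ _

theorem Cmp.mul_left {n : ℕ} {x y z : C} (h : C.Cmp n x y) (h' : C.Cmp n y z) :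
    C.Cmp n (C.mul n x y) z := (tgt_of_mul h).trans h'

theorem Cmp.mul_right {n : ℕ} {x y z : C} (h : C.Cmp n x y) (h' : C.Cmp n y z) :
    C.Cmp n x (C.mul n y z) := Eq.trans h (src_of_mul h').symm

theorem Cmp.mul_mul {m n : ℕ} (hmn : m ≠ n) {x y z w : C} (hxy : C.Cmp n x y) (hzw : C.Cmp n z w)
    (hxz : C.Cmp m x z) (hyw : C.Cmp m y w) : C.Cmp m (C.mul n x y) (C.mul n z w) := by
  unfold Cmp
  rw [d_mul hxy hmn, d_mul hzw hmn, hxz, hyw]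

theorem mul_interchange {m n : ℕ} (hmn : m ≠ n) {x y z w : C} (hxy : C.Cmp n x y)
    (hzw : C.Cmp n z w) (hxz : C.Cmp m x z) (hyw : C.Cmp m y w) :
    C.mul m (C.mul n x y) (C.mul n z w) = C.mul n (C.mul m x z) (C.mul m y w) := by
  have h1 := Cmp.mul_mul hmn hxy hzw hxz hyw
  have h2 := Cmp.mul_mul hmn.symm hxz hyw hxy hzw
  rw [← comp_eq_mul h1, ← comp_eq_mul h2]
  simp only [← comp_eq_mul hxy, ← comp_eq_mul hzw, ← comp_eq_mul hxz, ← comp_eq_mul hyw]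
  exact C.interchange m n hmn x y z w hxy hzw hxz hyw _ _

/-! ### Whiskering by `1`-morphisms and the exchange law. -/

theorem Cmp.whisker_left {p : ℕ} (hp : 1 ≤ p) {w x y : C} (h : C.Cmp p x y) (hw : C.Cmp 0 w x)
    (hd : C.dim w ≤ 1) : C.Cmp p (C.mul 0 w x) (C.mul 0 w y) :=
  Cmp.mul_mul (by omega) hw (Eq.trans hw (h.d_lt hp false)) (cmp_self (hd.trans hp)) h

theorem Cmp.whisker_right {p : ℕ} (hp : 1 ≤ p) {w x y : C} (h : C.Cmp p x y) (hw : C.Cmp 0 x w)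
    (hd : C.dim w ≤ 1) : C.Cmp p (C.mul 0 x w) (C.mul 0 y w) :=
  Cmp.mul_mul (by omega) hw (Eq.trans (h.d_lt hp true).symm hw) h (cmp_self (hd.trans hp))

/-- A morphism `w` of dimension at most one satisfies `w = w *_p w` for `p ≥ 1`, so this is the
interchange law with `w` written twice. -/
theorem whisker_left_mul {p : ℕ} (hp : 1 ≤ p) {w x y : C} (h : C.Cmp p x y) (hw : C.Cmp 0 w x)
    (hd : C.dim w ≤ 1) : C.mul 0 w (C.mul p x y) = C.mul p (C.mul 0 w x) (C.mul 0 w y) := by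
  have := mul_interchange (m := 0) (n := p) (by omega) (cmp_self (hd.trans hp)) h hw
    (Eq.trans hw (h.d_lt hp false))
  rwa [mul_self (hd.trans hp)] at this

theorem whisker_right_mul {p : ℕ} (hp : 1 ≤ p) {w x y : C} (h : C.Cmp p x y) (hw : C.Cmp 0 x w)
    (hd : C.dim w ≤ 1) : C.mul 0 (C.mul p x y) w = C.mul p (C.mul 0 x w) (C.mul 0 y w) := by
  have := mul_interchange (m := 0) (n := p) (by omega) h (cmp_self (hd.trans hp)) hw
    (Eq.trans (h.d_lt hp true).symm hw)
  rwa [mul_self (hd.trans hp)] at this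

theorem d_zero_d_one (α β : Bool) (x : C) : C.d α 0 (C.d β 1 x) = C.d α 0 x :=
  C.d_d_lt β α 0 1 Nat.one_pos x

theorem cmp_d_one_right {x y : C} (h : C.Cmp 0 x y) (α : Bool) : C.Cmp 0 x (C.d α 1 y) :=
  Eq.trans h (d_zero_d_one _ _ _).symm

theorem cmp_d_one_left {x y : C} (h : C.Cmp 0 x y) (α : Bool) : C.Cmp 0 (C.d α 1 x) y :=
  (d_zero_d_one _ _ _).trans h

theorem cmp_exchange {x y : C} (h : C.Cmp 0 x y) :
    C.Cmp 1 (C.mul 0 x (C.d false 1 y)) (C.mul 0 (C.d true 1 x) y) :=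
  Cmp.mul_mul (by omega) (cmp_d_one_right h _) (cmp_d_one_left h _) (cmp_tgt 1 x) (cmp_src 1 y)

/-- Interchange applied to `x = x *_1 t_1 x` and `y = s_1 y *_1 y`. Together with `mul_exchange'` it
gives two decompositions of `x *_0 y` for `*_1`. Comparing their classes produces the relation on
which the model rests. -/
theorem mul_exchange {x y : C} (h : C.Cmp 0 x y) :
    C.mul 1 (C.mul 0 x (C.d false 1 y)) (C.mul 0 (C.d true 1 x) y) = C.mul 0 x y := by
  have := mul_interchange (m := 0) (n := 1) (by omega) (cmp_tgt 1 x) (cmp_src 1 y)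
    (cmp_d_one_right h _) (cmp_d_one_left h _)
  rwa [mul_tgt, src_mul, eq_comm] at this

theorem cmp_exchange' {x y : C} (h : C.Cmp 0 x y) :
    C.Cmp 1 (C.mul 0 (C.d false 1 x) y) (C.mul 0 x (C.d true 1 y)) :=
  Cmp.mul_mul (by omega) (cmp_d_one_left h _) (cmp_d_one_right h _) (cmp_src 1 x) (cmp_tgt 1 y)

theorem mul_exchange' {x y : C} (h : C.Cmp 0 x y) :
    C.mul 1 (C.mul 0 (C.d false 1 x) y) (C.mul 0 x (C.d true 1 y)) = C.mul 0 x y := by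
  have := mul_interchange (m := 0) (n := 1) (by omega) (cmp_src 1 x) (cmp_tgt 1 y)
    (cmp_d_one_left h _) (cmp_d_one_right h _)
  rwa [mul_tgt, src_mul, eq_comm] at this

theorem eq_of_cmp_of_dim_le {n : ℕ} {x y : C} (h : C.Cmp n x y) (hx : C.dim x ≤ n)
    (hy : C.dim y ≤ n) : C.mul n x y = x := by
  obtain rfl := h.eq hx hy
  exact mul_self hx

theorem mul_of_dim_zero_left {x y : C} (h : C.Cmp 0 x y) (hx : C.dim x ≤ 0) : C.mul 0 x y = y := by
  unfold Cmp at h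
  rw [d_eq_self hx] at h
  rw [h, src_mul]

theorem mul_of_dim_zero_right {x y : C} (h : C.Cmp 0 x y) (hy : C.dim y ≤ 0) :
    C.mul 0 x y = x := by
  unfold Cmp at h
  rw [d_eq_self hy] at h
  rw [← h, mul_tgt]

variable (C) in
/-- Only composites of `0`-dimensional morphisms for `*_0` are `0`-dimensional. -/
def UnitFree : Prop :=
  ∀ x y : C, C.Cmp 0 x y → C.dim (C.mul 0 x y) = 0 → C.dim x = 0 ∧ C.dim y = 0

end OmegaCat

/-! ### Whiskering structures -/

/-- An abelian group acted on by the morphisms of dimension at most `1`, with a class `cl x` for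
every morphism `x` of dimension at most `n`; the class is additive for `*_p`, `1 ≤ p < n`, and
the actions describe the composites for `*_0` with morphisms of dimension at most `1`. -/
structure Whiskering (C : OmegaCat.{u}) (n : ℕ) where
  A : Type u
  [grp : AddCommGroup A]
  cl : C → A
  L : C → A →+ A
  R : C → A →+ A
  cl_low : ∀ x, C.dim x < n → cl x = 0
  cl_mul : ∀ p x y, C.Cmp p x y → 1 ≤ p → p < n → C.dim x ≤ n → C.dim y ≤ n →
    cl (C.mul p x y) = cl x + cl y
  cl_L : ∀ w x, C.Cmp 0 w x → C.dim w ≤ 1 → C.dim x ≤ n → cl (C.mul 0 w x) = L w (cl x)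
  cl_R : ∀ x w, C.Cmp 0 x w → C.dim w ≤ 1 → C.dim x ≤ n → cl (C.mul 0 x w) = R w (cl x)
  -- The action laws hold on all of `A`, but no unit law is required: in the globular case an
  -- identity kills the classes of the morphisms with which it is not composable. The unit laws are
  -- recovered for spans only.
  L_mul : ∀ w w', C.Cmp 0 w w' → C.dim w ≤ 1 → C.dim w' ≤ 1 →
    ∀ a, L (C.mul 0 w w') a = L w (L w' a)
  R_mul : ∀ w w', C.Cmp 0 w w' → C.dim w ≤ 1 → C.dim w' ≤ 1 →
    ∀ a, R (C.mul 0 w w') a = R w' (R w a)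
  L_R : ∀ w w', C.dim w ≤ 1 → C.dim w' ≤ 1 → ∀ a, L w (R w' a) = R w' (L w a)

attribute [instance] Whiskering.grp

namespace Whiskering

variable {C : OmegaCat.{u}} {n : ℕ}

/-- The triples `(s_1 x, t_1 x, cl x)`, and those that arise from them by composition, inversion
and whiskering. -/
inductive Span (W : Whiskering C n) : C → C → W.A → Prop
  | gen (x) (hx : C.dim x ≤ n) : Span W (C.d false 1 x) (C.d true 1 x) (W.cl x)
  | comp (x y z a b) : Span W x y a → Span W y z b → Span W x z (a + b)
  | inv (x y a) : Span W x y a → Span W y x (-a)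
  | left (w x y a) (hw : C.dim w ≤ 1) (hx : C.Cmp 0 w x) (hy : C.Cmp 0 w y) : Span W x y a →
      Span W (C.mul 0 w x) (C.mul 0 w y) (W.L w a)
  | right (w x y a) (hw : C.dim w ≤ 1) (hx : C.Cmp 0 x w) (hy : C.Cmp 0 y w) : Span W x y a →
      Span W (C.mul 0 x w) (C.mul 0 y w) (W.R w a)

variable {W : Whiskering C n}

/-! ### Ends, units and exchange for spans. -/

theorem Span.dim_le {x y : C} {a : W.A} (h : W.Span x y a) : C.dim x ≤ 1 ∧ C.dim y ≤ 1 := by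
  induction h with
  | gen x hx => exact ⟨C.dim_d_le _ _ _, C.dim_d_le _ _ _⟩
  | comp x y z a b _ _ h1 h2 => exact ⟨h1.1, h2.2⟩
  | inv x y a _ h => exact h.symm
  | left w x y a hw hx hy _ h =>
    exact ⟨OmegaCat.dim_mul_le hx hw h.1, OmegaCat.dim_mul_le hy hw h.2⟩
  | right w x y a hw hx hy _ h =>
    exact ⟨OmegaCat.dim_mul_le hx h.1 hw, OmegaCat.dim_mul_le hy h.2 hw⟩

/-- For generators this is globularity, and every construction preserves it. It transfers
composability for `*_0` from one end of a span to the other. -/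
theorem Span.parallel {x y : C} {a : W.A} (h : W.Span x y a) (β : Bool) :
    C.d β 0 x = C.d β 0 y := by
  induction h with
  | gen x hx => rw [OmegaCat.d_zero_d_one, OmegaCat.d_zero_d_one]
  | comp x y z a b _ _ h1 h2 => exact h1.trans h2
  | inv x y a _ h => exact h.symm
  | left w x y a hw hx hy _ h =>
    cases β
    · rw [OmegaCat.src_of_mul hx, OmegaCat.src_of_mul hy]
    · rw [OmegaCat.tgt_of_mul hx, OmegaCat.tgt_of_mul hy, h]
  | right w x y a hw hx hy _ h =>
    cases β
    · rw [OmegaCat.src_of_mul hx, OmegaCat.src_of_mul hy, h]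
    · rw [OmegaCat.tgt_of_mul hx, OmegaCat.tgt_of_mul hy]

/-- On the class of a morphism `x` this is the class of `s_0 x *_0 x = x`. Parallel ends carry it
through composition and inversion. A left whiskering absorbs the identity into `w`, and a right
whiskering commutes with the left action. -/
theorem Span.unit_left {x y : C} {a : W.A} (h : W.Span x y a) : W.L (C.d false 0 x) a = a := by
  induction h with
  | gen x hx =>
    rw [OmegaCat.d_zero_d_one, ← W.cl_L _ _ (OmegaCat.cmp_src 0 x)
      ((C.dim_d_le _ _ _).trans Nat.one_pos.le) hx, OmegaCat.src_mul]
  | comp x y z a b h _ h1 h2 => rw [map_add, h1, h.parallel, h2]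
  | inv x y a h h' => rw [map_neg, ← h.parallel, h']
  | left w x y a hw hx hy _ h =>
    rw [OmegaCat.src_of_mul hx, ← W.L_mul _ _ (OmegaCat.cmp_src 0 w)
      ((C.dim_d_le _ _ _).trans Nat.one_pos.le) hw, OmegaCat.src_mul]
  | right w x y a hw hx hy _ h =>
    rw [OmegaCat.src_of_mul hx, W.L_R _ _ ((C.dim_d_le _ _ _).trans Nat.one_pos.le) hw, h]

theorem Span.unit_right {x y : C} {a : W.A} (h : W.Span x y a) : W.R (C.d true 0 x) a = a := by
  induction h with
  | gen x hx =>
    rw [OmegaCat.d_zero_d_one, ← W.cl_R _ _ (OmegaCat.cmp_tgt 0 x)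
      ((C.dim_d_le _ _ _).trans Nat.one_pos.le) hx, OmegaCat.mul_tgt]
  | comp x y z a b h _ h1 h2 => rw [map_add, h1, h.parallel, h2]
  | inv x y a h h' => rw [map_neg, ← h.parallel, h']
  | left w x y a hw hx hy _ h =>
    rw [OmegaCat.tgt_of_mul hx, ← W.L_R _ _ hw ((C.dim_d_le _ _ _).trans Nat.one_pos.le), h]
  | right w x y a hw hx hy _ h =>
    rw [OmegaCat.tgt_of_mul hx, ← W.R_mul _ _ (OmegaCat.cmp_tgt 0 w) hw
      ((C.dim_d_le _ _ _).trans Nat.one_pos.le), OmegaCat.mul_tgt]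

/-- If a generator has a `0`-dimensional end, then it is itself `0`-dimensional because `C` is
non-contracting, and its class vanishes. For whiskerings, `UnitFree` passes from the composite end
to the end of the inner span. -/
theorem Span.of_dim_zero (hC : C.NonContracting) (hu : C.UnitFree) (hn : 1 ≤ n) {x y : C}
    {a : W.A} (h : W.Span x y a) (h0 : C.dim x = 0 ∨ C.dim y = 0) : x = y ∧ a = 0 := by
  induction h with
  | gen x hx =>
    have hx0 : C.dim x = 0 := by
      by_contra hne
      have h1 := hC x (by omega)
      omega
    rw [OmegaCat.d_eq_self (hx0.le.trans Nat.one_pos.le),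
      OmegaCat.d_eq_self (hx0.le.trans Nat.one_pos.le)]
    exact ⟨rfl, W.cl_low x (by omega)⟩
  | comp x y z a b _ _ h1 h2 =>
    rcases h0 with h0 | h0
    · obtain ⟨rfl, rfl⟩ := h1 (Or.inl h0)
      obtain ⟨rfl, rfl⟩ := h2 (Or.inl h0)
      exact ⟨rfl, add_zero _⟩
    · obtain ⟨rfl, rfl⟩ := h2 (Or.inr h0)
      obtain ⟨rfl, rfl⟩ := h1 (Or.inr h0)
      exact ⟨rfl, add_zero _⟩
  | inv x y a _ h =>
    obtain ⟨rfl, rfl⟩ := h h0.symm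
    exact ⟨rfl, neg_zero⟩
  | left w x y a hw hx hy _ h =>
    obtain ⟨rfl, rfl⟩ := h (h0.imp (fun h => (hu _ _ hx h).2) (fun h => (hu _ _ hy h).2))
    exact ⟨rfl, map_zero _⟩
  | right w x y a hw hx hy _ h =>
    obtain ⟨rfl, rfl⟩ := h (h0.imp (fun h => (hu _ _ hx h).1) (fun h => (hu _ _ hy h).1))
    exact ⟨rfl, map_zero _⟩

/-- The `2`-dimensional source of a generator has the same ends, and its class is zero as soon as
`n` exceeds `2`. For `n = 2` the label zero need not occur between given ends. -/
theorem Span.zero (hn : 3 ≤ n) {x y : C} {a : W.A} (h : W.Span x y a) : W.Span x y 0 := by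
  induction h with
  | gen x hx =>
    have h1 := Span.gen (W := W) (C.d false 2 x) ((C.dim_d_le _ _ _).trans (by omega))
    rwa [C.d_d_lt _ _ _ _ (by omega), C.d_d_lt _ _ _ _ (by omega),
      W.cl_low _ ((C.dim_d_le _ _ _).trans_lt (by omega))] at h1
  | comp x y z a b _ _ h1 h2 => simpa using h1.comp _ _ _ _ _ h2
  | inv x y a _ h => simpa using h.inv
  | left w x y a hw hx hy _ h => simpa using h.left _ _ _ _ hw hx hy
  | right w x y a hw hx hy _ h => simpa using h.right _ _ _ _ hw hx hy

/-- The zigzag `x → y → x → y` with labels `a`, `-0`, `b`. -/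
theorem Span.add (hn : 3 ≤ n) {x y : C} {a b : W.A} (h : W.Span x y a) (h' : W.Span x y b) :
    W.Span x y (a + b) := by
  simpa using (h.comp _ _ _ _ _ (h.zero hn).inv).comp _ _ _ _ _ h'

theorem Span.id {x : C} (hn : 2 ≤ n) (hx : C.dim x ≤ 1) : W.Span x x 0 := by
  have := Span.gen (W := W) x (by omega)
  rwa [OmegaCat.d_eq_self hx, OmegaCat.d_eq_self hx, W.cl_low x (by omega)] at this

/-- When the span is the class of a morphism `y`, both sides are the class of `z *_0 y`, computed by
`mul_exchange` and by `mul_exchange'`. The general case is an induction on the span in which `z` has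
to vary. -/
theorem Span.comm_gen (hn : 2 ≤ n) {x' y' : C} {b : W.A} (h' : W.Span x' y' b) (z : C)
    (hz : C.dim z ≤ n) (hc : C.Cmp 0 z x') :
    W.R x' (W.cl z) + W.L (C.d true 1 z) b = W.L (C.d false 1 z) b + W.R y' (W.cl z) := by
  have dz : ∀ α, C.dim (C.d α 1 z) ≤ 1 := fun α => C.dim_d_le _ _ _
  induction h' generalizing z with
  | gen y hy =>
    have hc' : C.Cmp 0 z y := Eq.trans hc (OmegaCat.d_zero_d_one _ _ _)
    have dy : ∀ α, C.dim (C.d α 1 y) ≤ 1 := fun α => C.dim_d_le _ _ _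
    have e1 := W.cl_mul 1 _ _ (OmegaCat.cmp_exchange hc') le_rfl (by omega)
      (OmegaCat.dim_mul_le (OmegaCat.cmp_d_one_right hc' _) hz ((dy _).trans (by omega)))
      (OmegaCat.dim_mul_le (OmegaCat.cmp_d_one_left hc' _) ((dz _).trans (by omega)) hy)
    have e2 := W.cl_mul 1 _ _ (OmegaCat.cmp_exchange' hc') le_rfl (by omega)
      (OmegaCat.dim_mul_le (OmegaCat.cmp_d_one_left hc' _) ((dz _).trans (by omega)) hy)
      (OmegaCat.dim_mul_le (OmegaCat.cmp_d_one_right hc' _) hz ((dy _).trans (by omega)))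
    rw [OmegaCat.mul_exchange hc', W.cl_R _ _ (OmegaCat.cmp_d_one_right hc' _) (dy _) hz,
      W.cl_L _ _ (OmegaCat.cmp_d_one_left hc' _) (dz _) hy] at e1
    rw [OmegaCat.mul_exchange' hc', W.cl_R _ _ (OmegaCat.cmp_d_one_right hc' _) (dy _) hz,
      W.cl_L _ _ (OmegaCat.cmp_d_one_left hc' _) (dz _) hy] at e2
    exact e1.symm.trans e2
  | comp x y t a b h1 h2 ih1 ih2 =>
    have i1 := ih1 z hz hc dz
    have i2 := ih2 z hz (Eq.trans hc (h1.parallel false)) dz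
    rw [map_add, map_add, ← add_assoc, i1, add_assoc, i2, add_assoc]
  | inv x y a h ih =>
    have i := ih z hz (Eq.trans hc (h.parallel false).symm) dz
    rw [map_neg, map_neg, ← sub_eq_add_neg, sub_eq_iff_eq_add, add_assoc, i]
    abel
  | left w x y a hw hx hy h ih =>
    have hzw : C.Cmp 0 z w := Eq.trans hc (OmegaCat.src_of_mul hx)
    -- The whiskering morphism `w` stands between `z` and the span. It is moved to `z`.
    have i := ih (C.mul 0 z w) (OmegaCat.dim_mul_le hzw hz (hw.trans (by omega)))
      (hzw.mul_left hx) (fun α => C.dim_d_le _ _ _)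
    rw [OmegaCat.d_mul hzw (by omega), OmegaCat.d_mul hzw (by omega), OmegaCat.d_eq_self hw,
      OmegaCat.d_eq_self hw, W.cl_R _ _ hzw hw hz,
      W.L_mul _ _ (OmegaCat.cmp_d_one_left hzw _) (dz _) hw,
      W.L_mul _ _ (OmegaCat.cmp_d_one_left hzw _) (dz _) hw] at i
    rw [W.R_mul _ _ hx hw h.dim_le.1, W.R_mul _ _ hy hw h.dim_le.2]
    exact i
  | right w x y a hw hx hy h ih =>
    have i := ih z hz (Eq.trans hc (OmegaCat.src_of_mul hx)) dz
    rw [W.R_mul _ _ hx h.dim_le.1 hw, W.R_mul _ _ hy h.dim_le.2 hw, W.L_R _ _ (dz _) hw,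
      W.L_R _ _ (dz _) hw, ← map_add, ← map_add, i]

/-- This is the interchange law between `*_0` and `*_1` at the level of labels. It is false for
arbitrary elements of `A`, and it is the reason why cells of the model carry spans. The induction is
on the first span, with `comm_gen` as its base. -/
theorem Span.comm (hn : 2 ≤ n) {x y x' y' : C} {a b : W.A} (h : W.Span x y a)
    (h' : W.Span x' y' b) (hc : C.Cmp 0 x x') :
    W.R x' a + W.L y b = W.L x b + W.R y' a := by
  induction h generalizing x' y' b with
  | gen z hz => exact h'.comm_gen hn z hz (Eq.trans (OmegaCat.d_zero_d_one _ _ _).symm hc)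
  | comp x y t a c h1 h2 ih1 ih2 =>
    have i1 := ih1 h' hc
    have i2 := ih2 h' (Eq.trans (h1.parallel true).symm hc)
    rw [map_add, map_add, add_assoc, i2, ← add_assoc, i1, add_assoc]
  | inv x y a h ih =>
    have i := ih h' (Eq.trans (h.parallel true) hc)
    rw [map_neg, map_neg, neg_add_eq_iff_eq_add, ← add_assoc, ← sub_eq_add_neg,
      eq_sub_iff_add_eq, ← i.symm]
  | left w x y a hw hx hy h ih =>
    have hc' : C.Cmp 0 x x' := Eq.trans (OmegaCat.tgt_of_mul hx).symm hc
    have i := congrArg (W.L w) (ih h' hc')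
    rw [map_add, map_add, W.L_R _ _ hw h'.dim_le.1, W.L_R _ _ hw h'.dim_le.2,
      ← W.L_mul _ _ hx hw h.dim_le.1, ← W.L_mul _ _ hy hw h.dim_le.2] at i
    exact i
  | right w x y a hw hx hy h ih =>
    have hc' : C.Cmp 0 w x' := Eq.trans (OmegaCat.tgt_of_mul hx).symm hc
    have hc2 : C.Cmp 0 w y' := Eq.trans hc' (h'.parallel false)
    -- A morphism `w` whiskering the first span on the right becomes a left whiskering of the second
    -- span, which is why the induction hypothesis must allow every second span.
    have i := ih (h'.left _ _ _ _ hw hc' hc2) (Eq.trans hx (OmegaCat.src_of_mul hc').symm)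
    rw [W.R_mul _ _ hc' hw h'.dim_le.1, W.R_mul _ _ hc2 hw h'.dim_le.2,
      ← W.L_mul _ _ hx h.dim_le.1 hw, ← W.L_mul _ _ hy h.dim_le.2 hw] at i
    exact i

end Whiskering

end

end HDA

namespace HDA

noncomputable section

/-! ### The model of a whiskering structure -/

namespace Whiskering

variable {C : OmegaCat.{u}} {n : ℕ}

/-- The morphisms of the `ω`-category built from `W`: two `1`-morphisms, the `1`-dimensional source
and target, and two elements of `A`, the classes of the `n`-dimensional source and target. -/
@[ext]
structure Cell (W : Whiskering C n) where
  x : C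
  y : C
  a : W.A
  b : W.A
  ha : W.Span x y a
  hb : W.Span x y b

namespace Cell

variable {W : Whiskering C n}

/-- `s_k` and `t_k`. -/
def d (hn : 2 ≤ n) (α : Bool) (k : ℕ) (p : W.Cell) : W.Cell where
  -- The ends of a span are parallel, so the `0`-faces of the cell can be computed from `p.x` alone.
  x := if k = 0 then C.d α 0 p.x else if k = 1 then cond α p.y p.x else p.x
  y := if k = 0 then C.d α 0 p.x else if k = 1 then cond α p.y p.x else p.y
  -- Faces below level `n` carry zero labels, level `n` selects one of the two labels, and above it
  -- nothing changes. Cells thus have dimension at most `n + 1`.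
  a := if k < n then 0 else if k = n then cond α p.b p.a else p.a
  b := if k < n then 0 else if k = n then cond α p.b p.a else p.b
  ha := by
    rcases k with _ | _ | k
    · simpa [show 0 < n by omega] using Span.id hn ((C.dim_d_le _ _ _).trans Nat.one_pos.le)
    · cases α
      · simpa [show 1 < n by omega] using Span.id hn p.ha.dim_le.1
      · simpa [show 1 < n by omega] using Span.id hn p.ha.dim_le.2
    · rcases lt_trichotomy (k + 2) n with h | h | h
      -- An index `k + 2` below `n` exists only if `n ≥ 3`, which is exactly when the label zero is
      -- known to be a span between `p.x` and `p.y`.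
      · simpa [h] using p.ha.zero (by omega)
      · cases α
        · simpa [h, show n ≠ 0 by omega, show n ≠ 1 by omega] using p.ha
        · simpa [h, show n ≠ 0 by omega, show n ≠ 1 by omega] using p.hb
      · simpa [h.not_gt, h.ne'] using p.ha
  hb := by
    rcases k with _ | _ | k
    · simpa [show 0 < n by omega] using Span.id hn ((C.dim_d_le _ _ _).trans Nat.one_pos.le)
    · cases α
      · simpa [show 1 < n by omega] using Span.id hn p.ha.dim_le.1
      · simpa [show 1 < n by omega] using Span.id hn p.ha.dim_le.2
    · rcases lt_trichotomy (k + 2) n with h | h | h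
      · simpa [h] using p.ha.zero (by omega)
      · cases α
        · simpa [h, show n ≠ 0 by omega, show n ≠ 1 by omega] using p.ha
        · simpa [h, show n ≠ 0 by omega, show n ≠ 1 by omega] using p.hb
      · simpa [h.not_gt, h.ne'] using p.hb

/-! ### Composability and composition of cells. -/

variable {hn : 2 ≤ n} {p q : W.Cell}

theorem cmp_zero (h : p.d hn true 0 = q.d hn false 0) : C.Cmp 0 p.x q.x := by
  simpa [d] using congrArg x h

theorem cmp_one (h : p.d hn true 1 = q.d hn false 1) : p.y = q.x := by
  simpa [d] using congrArg x h

theorem cmp_two_le {k : ℕ} (h : p.d hn true (k + 2) = q.d hn false (k + 2)) :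
    p.x = q.x ∧ p.y = q.y := by
  constructor
  · simpa [d] using congrArg x h
  · simpa [d] using congrArg y h

theorem d_of_lt {α : Bool} {k : ℕ} (hk : n < k) : p.d hn α k = p := by
  apply Cell.ext <;> simp [d, show k ≠ 0 by omega, show k ≠ 1 by omega, hk.not_gt, hk.ne']

theorem cmp_of_lt {k : ℕ} (hk : n < k) (h : p.d hn true k = q.d hn false k) : p = q := by
  rwa [d_of_lt hk, d_of_lt hk] at h

/-- First whisker the first span by `x'` on the right, going from `x *_0 x'` to `y *_0 x'`, and then
the second span by `y` on the left, going on to `y *_0 y'`. This is the decomposition of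
`mul_exchange`. -/
theorem span_mul {x y x' y' : C} {a b : W.A} (h : W.Span x y a) (h' : W.Span x' y' b)
    (hc : C.Cmp 0 x x') : W.Span (C.mul 0 x x') (C.mul 0 y y') (W.R x' a + W.L y b) := by
  have hc1 : C.Cmp 0 y x' := Eq.trans (h.parallel true).symm hc
  exact (h.right _ _ _ _ h'.dim_le.1 hc hc1).comp _ _ _ _ _
    (h'.left _ _ _ _ h.dim_le.2 hc1 (Eq.trans hc1 (h'.parallel false)))

/-- The composition laws. -/
def comp (k : ℕ) (p q : W.Cell) (h : p.d hn true k = q.d hn false k) : W.Cell where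
  x := if k = 0 then C.mul 0 p.x q.x else p.x
  y := if k = 0 then C.mul 0 p.y q.y else if k = 1 then q.y else p.y
  -- For `k = n` the composite keeps the source label of `p` and the target label of `q`. For `k >
  -- n` composable cells are equal.
  a := if k = 0 then W.R q.x p.a + W.L p.y q.a else if k < n then p.a + q.a else p.a
  b := if k = 0 then W.R q.x p.b + W.L p.y q.b else if k < n then p.b + q.b else q.b
  ha := by
    rcases k with _ | _ | k
    · simpa using span_mul p.ha q.ha (cmp_zero h)
    · have := p.ha
      rw [cmp_one h] at this
      simpa [show 1 < n by omega] using this.comp _ _ _ _ _ q.ha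
    · have := q.ha
      rw [← (cmp_two_le h).1, ← (cmp_two_le h).2] at this
      by_cases hk : k + 2 < n
      · simpa [hk] using p.ha.add (by omega) this
      · simpa [hk] using p.ha
  hb := by
    rcases k with _ | _ | k
    · simpa using span_mul p.hb q.hb (cmp_zero h)
    · have := p.hb
      rw [cmp_one h] at this
      simpa [show 1 < n by omega] using this.comp _ _ _ _ _ q.hb
    · have := q.hb
      rw [← (cmp_two_le h).1, ← (cmp_two_le h).2] at this
      by_cases hk : k + 2 < n
      · simpa [hk] using p.hb.add (by omega) this
      · simpa [hk] using this

/-! ### The axioms of an `ω`-category for cells. -/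

theorem d_d_lt (α β : Bool) (m k : ℕ) (hmk : m < k) (p : W.Cell) :
    (p.d hn α k).d hn β m = p.d hn β m := by
  obtain ⟨k, rfl⟩ : ∃ k', k = k' + 1 := ⟨k - 1, by omega⟩
  rcases m with _ | _ | m
  · rcases k with _ | k
    · have := p.ha.parallel β
      cases α <;> apply Cell.ext <;> simp [d, this, show 0 < n by omega]
    · apply Cell.ext <;> simp [d, show 0 < n by omega]
  · obtain ⟨k, rfl⟩ : ∃ k', k = k' + 1 := ⟨k - 1, by omega⟩
    apply Cell.ext <;> simp [d, show 1 < n by omega]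
  · obtain ⟨k, rfl⟩ : ∃ k', k = k' + 1 := ⟨k - 1, by omega⟩
    apply Cell.ext
    · simp [d]
    · simp [d]
    all_goals
      simp only [d]
      split_ifs <;> first | rfl | omega

theorem d_d_ge (α β : Bool) (m k : ℕ) (hmk : k ≤ m) (p : W.Cell) :
    (p.d hn α k).d hn β m = p.d hn α k := by
  apply Cell.ext
  · simp only [d]
    split_ifs <;> first | rfl | omega | exact OmegaCat.d_d_same _ _ _ _ | (cases β <;> rfl)
  · simp only [d]
    split_ifs <;> first | rfl | omega | exact OmegaCat.d_d_same _ _ _ _ | (cases β <;> rfl)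
  · simp only [d]
    split_ifs <;> first | rfl | omega | (cases β <;> rfl)
  · simp only [d]
    split_ifs <;> first | rfl | omega | (cases β <;> rfl)

theorem cmp_y (h : C.Cmp 0 p.x q.x) : C.Cmp 0 p.y q.x ∧ C.Cmp 0 p.x q.y ∧ C.Cmp 0 p.y q.y := by
  have h1 : C.Cmp 0 p.y q.x := Eq.trans (p.ha.parallel true).symm h
  exact ⟨h1, Eq.trans h (q.ha.parallel false), Eq.trans h1 (q.ha.parallel false)⟩

/-- For `*_0` the left identity has zero labels and acts on those of `p` by `s_0`, so the law is
`Span.unit_left`. For `1 ≤ k < n` a zero label is added. -/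
theorem id_comp (k : ℕ) (p : W.Cell) (h : (p.d hn false k).d hn true k = p.d hn false k) :
    comp k (p.d hn false k) p h = p := by
  rcases k with _ | _ | k
  · have h1 : C.mul 0 (C.d false 0 p.x) p.y = p.y := by
      rw [p.ha.parallel, OmegaCat.src_mul]
    apply Cell.ext <;> simp [comp, d, OmegaCat.src_mul, h1, show 0 < n by omega,
      p.ha.unit_left, p.hb.unit_left]
  · apply Cell.ext <;> simp [comp, d, show 1 < n by omega]
  · rcases lt_trichotomy (k + 2) n with h | h | h
    · apply Cell.ext <;> simp [comp, d, h]
    · apply Cell.ext <;> simp [comp, d, h, show n ≠ 0 by omega, show n ≠ 1 by omega]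
    · apply Cell.ext <;> simp [comp, d, h.not_gt, h.ne']

theorem comp_id (k : ℕ) (p : W.Cell) (h : p.d hn true k = (p.d hn true k).d hn false k) :
    comp k p (p.d hn true k) h = p := by
  rcases k with _ | _ | k
  · have h1 : C.mul 0 p.y (C.d true 0 p.x) = p.y := by
      rw [p.ha.parallel, OmegaCat.mul_tgt]
    apply Cell.ext <;> simp [comp, d, OmegaCat.mul_tgt, h1, show 0 < n by omega,
      p.ha.unit_right, p.hb.unit_right]
  · apply Cell.ext <;> simp [comp, d, show 1 < n by omega]
  · rcases lt_trichotomy (k + 2) n with h | h | h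
    · apply Cell.ext <;> simp [comp, d, h]
    · apply Cell.ext <;> simp [comp, d, h, show n ≠ 0 by omega, show n ≠ 1 by omega]
    · apply Cell.ext <;> simp [comp, d, h.not_gt, h.ne']

theorem src_comp (k : ℕ) (p q : W.Cell) (h : p.d hn true k = q.d hn false k) :
    (comp k p q h).d hn false k = p.d hn false k := by
  rcases k with _ | _ | k
  · have := OmegaCat.src_of_mul (cmp_zero h)
    apply Cell.ext <;> simp [comp, d, this, show 0 < n by omega]
  · apply Cell.ext <;> simp [comp, d, show 1 < n by omega]
  · rcases lt_trichotomy (k + 2) n with h1 | h1 | h1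
    · apply Cell.ext <;> simp [comp, d, h1]
    · apply Cell.ext <;> simp [comp, d, h1, show n ≠ 0 by omega, show n ≠ 1 by omega]
    · obtain rfl := cmp_of_lt h1 h
      apply Cell.ext <;> simp [comp, d, h1.not_gt, h1.ne']

theorem tgt_comp (k : ℕ) (p q : W.Cell) (h : p.d hn true k = q.d hn false k) :
    (comp k p q h).d hn true k = q.d hn true k := by
  rcases k with _ | _ | k
  · have := OmegaCat.tgt_of_mul (cmp_zero h)
    apply Cell.ext <;> simp [comp, d, this, show 0 < n by omega]
  · apply Cell.ext <;> simp [comp, d, show 1 < n by omega]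
  · have h2 := cmp_two_le h
    rcases lt_trichotomy (k + 2) n with h1 | h1 | h1
    · apply Cell.ext <;> simp [comp, d, h1, h2]
    · apply Cell.ext <;> simp [comp, d, h1, h2, show n ≠ 0 by omega, show n ≠ 1 by omega]
    · obtain rfl := cmp_of_lt h1 h
      apply Cell.ext <;> simp [comp, d, h1.not_gt, h1.ne']

theorem d_comp (α : Bool) (m k : ℕ) (hmk : m ≠ k) (p q : W.Cell)
    (h : p.d hn true k = q.d hn false k)
    (h' : (p.d hn α m).d hn true k = (q.d hn α m).d hn false k) :
    (comp k p q h).d hn α m = comp k (p.d hn α m) (q.d hn α m) h' := by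
  -- Above level `n` composability forces `p = q`, and the composite is `p`.
  rcases lt_or_ge n k with h1 | h1
  · obtain rfl := cmp_of_lt h1 h
    apply Cell.ext
    · simp only [comp, d]
      split_ifs <;> first | rfl | omega
    · simp only [comp, d]
      split_ifs <;> first | rfl | omega
    · simp only [comp, d]
      split_ifs <;> first | rfl | omega
    · simp only [comp, d]
      split_ifs <;> first | rfl | omega
  rcases k with _ | _ | k
  · obtain ⟨m, rfl⟩ : ∃ m', m = m' + 1 := ⟨m - 1, by omega⟩
    rcases m with _ | m
    · cases α <;> apply Cell.ext <;> simp [comp, d, show 1 < n by omega]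
    · rcases lt_trichotomy (m + 2) n with h1 | h1 | h1
      · apply Cell.ext <;> simp [comp, d, h1]
      · cases α <;> apply Cell.ext <;> simp [comp, d, h1, show n ≠ 0 by omega, show n ≠ 1 by omega]
      · apply Cell.ext <;> simp [comp, d, h1.not_gt, h1.ne']
  · have h2 := cmp_one h
    rcases m with _ | _ | m
    · have h3 : C.d α 0 q.x = C.d α 0 p.x := by rw [← h2, p.ha.parallel]
      apply Cell.ext <;> simp [comp, d, h3, show 0 < n by omega, show 1 < n by omega]
    · omega
    · rcases lt_trichotomy (m + 2) n with h1 | h1 | h1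
      · apply Cell.ext <;> simp [comp, d, h1, show 1 < n by omega]
      · cases α <;> apply Cell.ext <;> simp [comp, d, h1, show 1 < n by omega, show n ≠ 0 by omega, show n ≠ 1 by omega]
      · apply Cell.ext <;> simp [comp, d, h1.not_gt, h1.ne', show 1 < n by omega]
  -- For composition at levels from `2` to `n` both cells have the same `1`-dimensional faces, so
  -- only the labels have to be compared, level by level.
  · apply Cell.ext
    · simp [comp, d]
    · simp [comp, d]
    · simp only [comp, d]
      split_ifs <;> first | rfl | omega | simp | (cases α <;> rfl)
    · simp only [comp, d]
      split_ifs <;> first | rfl | omega | simp | (cases α <;> rfl)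

/-- For `*_0` the three labels are acted on from the right only, from both sides, and from the left
only. The three action laws `R_mul`, `L_R` and `L_mul` deal with them. -/
theorem assoc (k : ℕ) (p q r : W.Cell) (hpq : p.d hn true k = q.d hn false k)
    (hqr : q.d hn true k = r.d hn false k)
    (h : (comp k p q hpq).d hn true k = r.d hn false k)
    (h' : p.d hn true k = (comp k q r hqr).d hn false k) :
    comp k (comp k p q hpq) r h = comp k p (comp k q r hqr) h' := by
  rcases k with _ | k
  · have c1 := cmp_zero hpq
    have c2 := cmp_zero hqr
    have e1 := OmegaCat.mul_assoc c1 c2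
    have e2 := OmegaCat.mul_assoc (cmp_y c1).2.2 (cmp_y c2).2.2
    have e3 := W.R_mul _ _ c2 q.ha.dim_le.1 r.ha.dim_le.1
    have e4 := W.L_mul _ _ (cmp_y c1).2.2 p.ha.dim_le.2 q.ha.dim_le.2
    have e5 := W.L_R _ _ p.ha.dim_le.2 r.ha.dim_le.1
    apply Cell.ext <;> simp [comp, e1, e2, e3, e4, e5, add_assoc]
  · by_cases hk : k = 0
    · subst hk
      apply Cell.ext <;> simp [comp, show 1 < n by omega, add_assoc]
    · by_cases hk' : k + 1 < n
      · apply Cell.ext <;> simp [comp, hk, hk', add_assoc]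
      · apply Cell.ext <;> simp [comp, hk, hk']

/-- The substance is in the case `k = 1`, where the two orders of composition differ by exchanging
the middle cells `q` and `r`. For `k ≥ 2` the `1`-dimensional faces agree and the actions are
additive. -/
theorem interchange_zero (k : ℕ) (hk : k ≠ 0) (p q r s : W.Cell)
    (hpq : p.d hn true k = q.d hn false k) (hrs : r.d hn true k = s.d hn false k)
    (hpr : p.d hn true 0 = r.d hn false 0) (hqs : q.d hn true 0 = s.d hn false 0)
    (h : (comp k p q hpq).d hn true 0 = (comp k r s hrs).d hn false 0)
    (h' : (comp 0 p r hpr).d hn true k = (comp 0 q s hqs).d hn false k) :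
    comp 0 (comp k p q hpq) (comp k r s hrs) h = comp k (comp 0 p r hpr) (comp 0 q s hqs) h' := by
  obtain ⟨k, rfl⟩ : ∃ k', k = k' + 1 := ⟨k - 1, by omega⟩
  rcases k with _ | k
  · have e1 := cmp_one hpq
    have e2 := cmp_one hrs
    have hc : C.Cmp 0 q.x r.x := by
      have := (cmp_y (cmp_zero hpr)).1
      rwa [e1] at this
    -- `Span.comm` for `q` and `r`, rewritten with `p.y = q.x` and `r.y = s.x`.
    have e3 : ∀ (a : W.A) (_ : W.Span q.x q.y a) (b : W.A) (_ : W.Span r.x r.y b),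
        W.R r.x a + W.L q.y b = W.L p.y b + W.R s.x a := by
      intro a ha b hb
      rw [ha.comm hn hb hc, e1, e2]
    have e4 : ∀ (a c a' c' : W.A) (_ : W.Span q.x q.y a) (_ : W.Span r.x r.y c),
        W.R r.x (a' + a) + W.L q.y (c + c') =
          W.R r.x a' + W.L p.y c + (W.R s.x a + W.L q.y c') := by
      intro a c a' c' ha hc
      rw [map_add, map_add, add_assoc, ← add_assoc (W.R r.x a), e3 a ha c hc]
      abel
    apply Cell.ext
    · simp [comp]
    · simp [comp]
    · simpa [comp, show 1 < n by omega] using e4 q.a r.a p.a s.a q.ha r.ha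
    · simpa [comp, show 1 < n by omega] using e4 q.b r.b p.b s.b q.hb r.hb
  · have e1 := cmp_two_le hpq
    have e2 := cmp_two_le hrs
    by_cases hk : k + 2 < n
    · apply Cell.ext <;> simp [comp, hk, e1, e2] <;> abel
    · apply Cell.ext <;> simp [comp, hk, e1, e2]

theorem interchange (m k : ℕ) (hmk : m ≠ k) (p q r s : W.Cell)
    (hpq : p.d hn true k = q.d hn false k) (hrs : r.d hn true k = s.d hn false k)
    (hpr : p.d hn true m = r.d hn false m) (hqs : q.d hn true m = s.d hn false m)
    (h : (comp k p q hpq).d hn true m = (comp k r s hrs).d hn false m)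
    (h' : (comp m p r hpr).d hn true k = (comp m q s hqs).d hn false k) :
    comp m (comp k p q hpq) (comp k r s hrs) h = comp k (comp m p r hpr) (comp m q s hqs) h' := by
  by_cases hm : m = 0
  · subst hm
    exact interchange_zero k (Ne.symm hmk) p q r s hpq hrs hpr hqs h h'
  by_cases hk : k = 0
  · subst hk
    exact (interchange_zero m hm p r q s hpr hqs hpq hrs h' h).symm
  -- With both levels positive the actions do not occur, and interchange reduces to commutativity of
  -- the addition of labels.
  apply Cell.ext
  · simp [comp, hm, hk]
  · simp only [comp]
    split_ifs <;> first | rfl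
  · simp only [comp]
    split_ifs <;> first | rfl | exact add_add_add_comm _ _ _ _
  · simp only [comp]
    split_ifs <;> first | rfl | exact add_add_add_comm _ _ _ _

theorem d_succ (α : Bool) (p : W.Cell) : p.d hn α (n + 1) = p := d_of_lt (Nat.lt_succ_self n)

end Cell

/-- The `ω`-category built from a whiskering structure. -/
def model (W : Whiskering C n) (hn : 2 ≤ n) : OmegaCat.{u} where
  carrier := W.Cell
  d := Cell.d hn
  comp := Cell.comp
  d_d_lt := Cell.d_d_lt
  d_d_ge := Cell.d_d_ge
  id_comp := Cell.id_comp
  comp_id := Cell.comp_id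
  src_comp := Cell.src_comp
  tgt_comp := Cell.tgt_comp
  d_comp := Cell.d_comp
  assoc := Cell.assoc
  interchange := Cell.interchange
  finite_dim p := ⟨n + 1, Cell.d_succ _ p, Cell.d_succ _ p⟩

/-! ### The model as a target for `Ĉ`, and the functor to it. -/

variable {W : Whiskering C n} (hn : 2 ≤ n)

/-- The zigzag `x → y → x → y` with labels `0`, `-a`, `0`. -/
theorem Span.neg (hn : 3 ≤ n) {x y : C} {a : W.A} (h : W.Span x y a) : W.Span x y (-a) := by
  simpa using ((h.zero hn).comp _ _ _ _ _ h.inv).comp _ _ _ _ _ (h.zero hn)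

/-- For `*_1` the inverse exchanges the ends and negates the labels. For `*_r` with `2 ≤ r < n` it
only negates the labels. For `*_n`, where a cell is an arrow from its first label to its second, it
exchanges them. Above `n` every cell is an identity, hence its own inverse. -/
theorem model_exists_inverse (p : W.model hn) (r : ℕ) (hr : 1 ≤ r) :
    ∃ q, (W.model hn).IsInverse r p q := by
  change W.Cell at p
  obtain ⟨r, rfl⟩ : ∃ k', r = k' + 1 := ⟨r - 1, by omega⟩
  rcases r with _ | r
  · refine ⟨(⟨p.y, p.x, -p.a, -p.b, p.ha.inv, p.hb.inv⟩ : W.Cell), ?_, ?_, ?_, ?_⟩ <;>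
      apply Cell.ext <;> simp [model, Cell.d, Cell.comp, show 1 < n by omega]
  · rcases lt_trichotomy (r + 2) n with h | h | h
    · refine ⟨(⟨p.x, p.y, -p.a, -p.b, p.ha.neg (by omega), p.hb.neg (by omega)⟩ : W.Cell),
        ?_, ?_, ?_, ?_⟩ <;>
      apply Cell.ext <;> simp [model, Cell.d, Cell.comp, h]
    · refine ⟨(⟨p.x, p.y, p.b, p.a, p.hb, p.ha⟩ : W.Cell), ?_, ?_, ?_, ?_⟩ <;>
      apply Cell.ext <;> simp [model, Cell.d, Cell.comp, h, show n ≠ 0 by omega, show n ≠ 1 by omega]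
    · refine ⟨p, ?_, ?_, ?_, ?_⟩ <;>
      apply Cell.ext <;> simp [model, Cell.d, Cell.comp, h.not_gt, h.ne']

/-- If the `1`-dimensional source or target of a cell collapses to an object, then
`Span.of_dim_zero` makes the two ends equal and both labels zero, so the whole cell is
`0`-dimensional. -/
theorem model_nc (hC : C.NonContracting) (hu : C.UnitFree) : (W.model hn).NonContracting := by
  intro p hp
  have key : ∀ α, (W.model hn).dim ((W.model hn).d α 1 p) = 1 := by
    intro α
    refine le_antisymm (OmegaCat.dim_d_le _ α 1 p) (Nat.pos_of_ne_zero fun h => ?_)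
    change W.Cell at p
    have h1 : Cell.d hn false 0 (Cell.d hn α 1 p) = Cell.d hn α 1 p :=
      OmegaCat.d_eq_self (C := W.model hn) h.le
    have h2 : C.dim p.x = 0 ∨ C.dim p.y = 0 := by
      have h3 : C.d false 0 (cond α p.y p.x) = cond α p.y p.x := by
        simpa [Cell.d] using congrArg Cell.x h1
      have h4 := (C.dim_le_iff _ _ _).2 h3
      cases α
      · exact Or.inl (Nat.le_zero.1 h4)
      · exact Or.inr (Nat.le_zero.1 h4)
    obtain ⟨e, ha⟩ := p.ha.of_dim_zero hC hu (by omega) h2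
    have hb := (p.hb.of_dim_zero hC hu (by omega) h2).2
    have h5 : C.d false 0 p.x = p.x := by
      rw [← e, or_self] at h2
      exact OmegaCat.d_eq_self h2.le
    have h6 : Cell.d hn false 0 p = p := by
      apply Cell.ext <;> simp [Cell.d, ha, hb, ← e, h5]
    have h7 := ((W.model hn).dim_le_iff false 0 p).2 h6
    omega
  exact ⟨key false, key true⟩

theorem model_path_isGroupoid (hD : (W.model hn).NonContracting) :
    ((W.model hn).path hD).IsGroupoid := by
  rintro ⟨p, hp⟩ - r
  obtain ⟨q, h1, h2, h3, h4⟩ := model_exists_inverse hn p (r + 1) (by omega)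
  -- The inverse shares the positive-dimensional face `t_{r+1} p = s_{r+1} q` with `p`.
  have hq : 1 ≤ (W.model hn).dim q := by
    refine OmegaCat.one_le_dim_of_d (α := false) (n := r + 1) ?_
    rw [← h1]
    exact hD.one_le_dim_d hp true r
  exact ⟨⟨q, hq⟩, Subtype.ext h1, Subtype.ext h2, Subtype.ext h3, Subtype.ext h4⟩

/-- The functor to the model. -/
def toModel (W : Whiskering C n) : OmegaCat.Functor C (W.model hn) where
  map z :=
    { x := C.d false 1 z
      y := C.d true 1 z
      a := W.cl (C.d false n z)
      b := W.cl (C.d true n z)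
      ha := by
        have := Span.gen (W := W) _ (C.dim_d_le false n z)
        rwa [C.d_d_lt _ _ _ _ (by omega), C.d_d_lt _ _ _ _ (by omega)] at this
      hb := by
        have := Span.gen (W := W) _ (C.dim_d_le true n z)
        rwa [C.d_d_lt _ _ _ _ (by omega), C.d_d_lt _ _ _ _ (by omega)] at this }
  map_d α k z := by
    have h0 : ∀ α k, k < n → W.cl (C.d α k z) = 0 := fun α k hk =>
      W.cl_low _ ((C.dim_d_le _ _ _).trans_lt hk)
    rcases k with _ | _ | k
    · have h1 : ∀ β k, C.d β k (C.d α 0 z) = C.d α 0 z := fun β k => C.d_d_ge _ _ _ _ k.zero_le z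
      apply Cell.ext <;> simp [model, Cell.d, h1, h0, show 0 < n by omega, OmegaCat.d_zero_d_one]
    · have h1 : ∀ β, C.d β 1 (C.d α 1 z) = C.d α 1 z := fun β => OmegaCat.d_d_same _ _ _ _
      have h2 : ∀ β, C.d β n (C.d α 1 z) = C.d α 1 z := fun β => C.d_d_ge _ _ _ _ (by omega) z
      cases α <;> apply Cell.ext <;> simp [model, Cell.d, h1, h2, h0, show 1 < n by omega]
    · have h1 : ∀ β, C.d β 1 (C.d α (k + 2) z) = C.d β 1 z := fun β => C.d_d_lt _ _ _ _ (by omega) z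
      rcases lt_trichotomy (k + 2) n with h | h | h
      · have h2 : ∀ β, C.d β n (C.d α (k + 2) z) = C.d α (k + 2) z :=
          fun β => C.d_d_ge _ _ _ _ (by omega) z
        apply Cell.ext <;> simp [model, Cell.d, h1, h2, h0, h]
      · have h2 : ∀ β, C.d β n (C.d α n z) = C.d α n z := fun β => C.d_d_ge _ _ _ _ le_rfl z
        rw [h] at h1
        cases α <;> apply Cell.ext <;> simp [model, Cell.d, h1, h2, h, show n ≠ 0 by omega, show n ≠ 1 by omega]
      · have h2 : ∀ β, C.d β n (C.d α (k + 2) z) = C.d β n z := fun β => C.d_d_lt _ _ _ _ h z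
        apply Cell.ext <;> simp [model, Cell.d, h1, h2, h.not_gt, h.ne']
  map_comp k z w h h' := by
    rw [OmegaCat.comp_eq_mul h]
    have dz : ∀ α, C.dim (C.d α 1 z) ≤ 1 := fun α => C.dim_d_le _ _ _
    have dw : ∀ α, C.dim (C.d α 1 w) ≤ 1 := fun α => C.dim_d_le _ _ _
    have ez : ∀ α, C.dim (C.d α n z) ≤ n := fun α => C.dim_d_le _ _ _
    have ew : ∀ α, C.dim (C.d α n w) ≤ n := fun α => C.dim_d_le _ _ _
    rcases k with _ | k
    · have e1 : ∀ α, C.d α 1 (C.mul 0 z w) = C.mul 0 (C.d α 1 z) (C.d α 1 w) :=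
        fun α => OmegaCat.d_mul h (by omega) α
      -- The `n`-dimensional face of `z *_0 w` is split for `*_1` by the exchange law. The class is
      -- additive there because `1 < n`.
      have e2 : ∀ α, W.cl (C.d α n (C.mul 0 z w)) =
          W.R (C.d false 1 w) (W.cl (C.d α n z)) + W.L (C.d true 1 z) (W.cl (C.d α n w)) := by
        intro α
        have hc : C.Cmp 0 (C.d α n z) (C.d α n w) := OmegaCat.Cmp.face h (by omega) _ _ (Or.inl rfl)
        have e := W.cl_mul 1 _ _ (OmegaCat.cmp_exchange hc) le_rfl (by omega)
          (OmegaCat.dim_mul_le (OmegaCat.cmp_d_one_right hc _) (ez _)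
            ((C.dim_d_le _ _ _).trans (by omega)))
          (OmegaCat.dim_mul_le (OmegaCat.cmp_d_one_left hc _)
            ((C.dim_d_le _ _ _).trans (by omega)) (ew _))
        rw [OmegaCat.mul_exchange hc, W.cl_R _ _ (OmegaCat.cmp_d_one_right hc _)
          (C.dim_d_le _ _ _) (ez _), W.cl_L _ _ (OmegaCat.cmp_d_one_left hc _)
          (C.dim_d_le _ _ _) (ew _), C.d_d_lt _ _ _ _ (by omega),
          C.d_d_lt _ _ _ _ (by omega)] at e
        rw [OmegaCat.d_mul h (by omega), e]
      apply Cell.ext <;> simp [model, Cell.comp, e1, e2]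
    · have e2 : ∀ α, k + 1 < n → W.cl (C.d α n (C.mul (k + 1) z w)) =
          W.cl (C.d α n z) + W.cl (C.d α n w) := by
        intro α hk
        rw [OmegaCat.d_mul h (by omega), W.cl_mul _ _ _
          (OmegaCat.Cmp.face h (by omega) _ _ (Or.inl rfl)) (by omega) hk (ez _) (ew _)]
      have e3 : ∀ α, k + 1 > n → C.d α n (C.mul (k + 1) z w) = C.d α n w :=
        fun α hk => (OmegaCat.d_mul_lt h hk α).trans (OmegaCat.Cmp.d_lt h hk α)
      have e4 : C.d false 1 (C.mul (k + 1) z w) = C.d false 1 z := by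
        rcases Nat.eq_zero_or_pos k with rfl | hk
        · exact OmegaCat.src_of_mul h
        · exact OmegaCat.d_mul_lt h (by omega) _
      -- The law is `*_{k+1}`: for `k = 0` it is `*_1`, whose target comes from `w`, while for
      -- larger `k` the `1`-dimensional faces of `z` and `w` agree.
      have e5 : C.d true 1 (C.mul (k + 1) z w) = if k = 0 then C.d true 1 w else C.d true 1 z := by
        rcases Nat.eq_zero_or_pos k with rfl | hk
        · exact OmegaCat.tgt_of_mul h
        · rw [if_neg (by omega)]
          exact OmegaCat.d_mul_lt h (by omega) _
      rcases lt_trichotomy (k + 1) n with hk | hk | hk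
      · apply Cell.ext <;> simp [model, Cell.comp, e2 _ hk, e4, e5, hk]
      · have e6 := OmegaCat.src_of_mul h
        have e7 := OmegaCat.tgt_of_mul h
        rw [hk] at e6 e7 e4 e5
        apply Cell.ext <;> simp [model, Cell.comp, e6, e7, e4, e5, hk, show n ≠ 0 by omega, show n ≠ 1 by omega, show k ≠ 0 by omega]
      · have e6 := (OmegaCat.Cmp.d_lt h hk false)
        apply Cell.ext <;> simp [model, Cell.comp, e3 _ hk, e6, e4, e5, hk.not_gt]

/-- The first component of the image of a `1`-morphism `z` is `z` itself, so if the image were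
`0`-dimensional, then `z = s_0 z`. -/
theorem toModel_nc : (W.toModel hn).NonContracting := by
  intro z hz
  refine le_antisymm (hz ▸ (W.toModel hn).dim_map_le z) (Nat.pos_of_ne_zero fun h => ?_)
  have h1 : Cell.d hn false 0 ((W.toModel hn).map z) = (W.toModel hn).map z :=
    OmegaCat.d_eq_self (C := W.model hn) h.le
  have h2 : C.d false 0 (C.d false 1 z) = C.d false 1 z := congrArg Cell.x h1
  rw [OmegaCat.d_eq_self hz.le] at h2
  have h3 := (C.dim_le_iff false 0 z).2 h2
  omega

end Whiskering

end

end HDA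

namespace HDA

noncomputable section

/-! ### Whiskering on both sides -/

namespace OmegaCat

variable {C : OmegaCat.{u}}

/-- The composite `u *_0 x *_0 v`. -/
def whisk (u x v : C) : C := C.mul 0 u (C.mul 0 x v)

theorem dim_whisk_le {k : ℕ} {u x v : C} (hux : C.Cmp 0 u x) (hxv : C.Cmp 0 x v)
    (hu : C.dim u ≤ k) (hx : C.dim x ≤ k) (hv : C.dim v ≤ k) : C.dim (whisk u x v) ≤ k :=
  dim_mul_le (hux.mul_right hxv) hu (dim_mul_le hxv hx hv)

theorem Cmp.whisk {p : ℕ} (hp : 1 ≤ p) {u x y v : C} (h : C.Cmp p x y) (hux : C.Cmp 0 u x)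
    (hxv : C.Cmp 0 x v) (hu : C.dim u ≤ 1) (hv : C.dim v ≤ 1) :
    C.Cmp p (whisk u x v) (whisk u y v) :=
  (h.whisker_right hp hxv hv).whisker_left hp (hux.mul_right hxv) hu

theorem whisk_mul {p : ℕ} (hp : 1 ≤ p) {u x y v : C} (h : C.Cmp p x y) (hux : C.Cmp 0 u x)
    (hxv : C.Cmp 0 x v) (hu : C.dim u ≤ 1) (hv : C.dim v ≤ 1) :
    whisk u (C.mul p x y) v = C.mul p (whisk u x v) (whisk u y v) := by
  unfold OmegaCat.whisk
  rw [whisker_right_mul hp h hxv hv, whisker_left_mul hp (h.whisker_right hp hxv hv)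
    (hux.mul_right hxv) hu]

theorem Functor.map_whisk {D : OmegaCat.{v}} (F : Functor C D) {u x v : C} (hux : C.Cmp 0 u x)
    (hxv : C.Cmp 0 x v) : F.map (whisk u x v) = whisk (F.map u) (F.map x) (F.map v) := by
  unfold OmegaCat.whisk
  rw [F.map_mul (hux.mul_right hxv), F.map_mul hxv]

theorem isInverse_iff {r : ℕ} {x y : C} : C.IsInverse r x y ↔ C.Cmp r x y ∧ C.Cmp r y x ∧
    C.mul r x y = C.d false r x ∧ C.mul r y x = C.d false r y := by
  constructor
  · rintro ⟨h, h', h1, h2⟩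
    rw [comp_eq_mul h] at h1
    rw [comp_eq_mul h'] at h2
    exact ⟨h, h', h1, h2⟩
  · rintro ⟨h, h', h1, h2⟩
    rw [← comp_eq_mul h] at h1
    rw [← comp_eq_mul h'] at h2
    exact ⟨h, h', h1, h2⟩

end OmegaCat

/-! ### The `ω`-category with inverses -/

section Hat

variable {C : NCat.{u}}

/-- Induction on the morphisms of the `ω`-category with inverses. -/
theorem hat_induction {Q : (hat C).cat → Prop} (gen : ∀ x, Q ((hatFunctor C).map x))
    (d : ∀ α n q, Q q → Q ((hat C).cat.d α n q))
    (mul : ∀ n p q, (hat C).cat.Cmp n p q → Q p → Q q → Q ((hat C).cat.mul n p q))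
    (inv : ∀ r p q, 1 ≤ r → (hat C).cat.IsInverse r p q → Q p → Q q) (q : (hat C).cat) : Q q := by
  let P := hatPresentation C
  suffices h : ∀ (t : Term P.X) (ht : P.Valid t), Q (Quotient.mk P.setoid ⟨t, ht⟩) by
    obtain ⟨⟨t, ht⟩, rfl⟩ := Quotient.exists_rep (s := P.setoid) q
    exact h t ht
  intro t ht
  induction t with
  | gen x => exact gen x
  | d α n t ih =>
    have e : (Quotient.mk P.setoid ⟨.d α n t, ht⟩ : P.Carrier) =
        Presentation.dd α n (Quotient.mk P.setoid ⟨t, ht⟩) :=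
      Presentation.ev_ext fun D f hf =>
        (Presentation.ev_dd hf α n (Quotient.mk P.setoid ⟨t, ht⟩)).symm
    rw [e]
    exact d α n _ (ih ht)
  | comp n s t ihs iht =>
    have h : (hat C).cat.Cmp n (Quotient.mk P.setoid ⟨s, ht.1⟩)
        (Quotient.mk P.setoid ⟨t, ht.2.1⟩) :=
      Presentation.ev_ext fun D f hf => (Presentation.ev_dd hf true n _).trans
        ((ht.2.2 D f hf).trans
          (Presentation.ev_dd hf false n (Quotient.mk P.setoid ⟨t, ht.2.1⟩)).symm)
    have e : (Quotient.mk P.setoid ⟨.comp n s t, ht⟩ : P.Carrier) =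
        (hat C).cat.mul n (Quotient.mk P.setoid ⟨s, ht.1⟩) (Quotient.mk P.setoid ⟨t, ht.2.1⟩) := by
      rw [← OmegaCat.comp_eq_mul h]
      exact Presentation.ev_ext fun D f hf =>
        Eq.trans (dif_pos (ht.2.2 D f hf)) (Presentation.ev_cc hf n _ _ h).symm
    rw [e]
    exact mul n _ _ h (ihs _) (iht _)
  | inv r t ih =>
    refine inv r (Quotient.mk P.setoid ⟨t, ht.1⟩) _ ht.2.2 ?_ (ih ht.1)
    -- In each model a formal inverse is evaluated to a chosen genuine inverse. Equations in `Ĉ` are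
    -- tested in all models, so the formal inverse is an inverse in `Ĉ`.
    have key : ∀ (D : OmegaCat.{u}) (f : P.X → D) (hf : P.IsModel D f), D.IsInverse r
        (Presentation.ev hf (Quotient.mk P.setoid ⟨t, ht.1⟩))
        (Presentation.ev hf (Quotient.mk P.setoid ⟨.inv r t, ht⟩)) := by
      intro D f hf
      have h := P.exists_inverse ht.2.1 D f hf (P.eval D f t) r ht.2.2
      have e : Presentation.ev hf (Quotient.mk P.setoid ⟨.inv r t, ht⟩) = h.choose := dif_pos h
      rw [e]
      exact h.choose_spec
    have h1 : (hat C).cat.d true r (Quotient.mk P.setoid ⟨t, ht.1⟩) =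
        (hat C).cat.d false r (Quotient.mk P.setoid ⟨.inv r t, ht⟩) :=
      Presentation.ev_ext fun D f hf => (Presentation.ev_dd hf true r _).trans
        ((key D f hf).1.trans (Presentation.ev_dd hf false r _).symm)
    have h2 : (hat C).cat.d true r (Quotient.mk P.setoid ⟨.inv r t, ht⟩) =
        (hat C).cat.d false r (Quotient.mk P.setoid ⟨t, ht.1⟩) :=
      Presentation.ev_ext fun D f hf => (Presentation.ev_dd hf true r _).trans
        ((key D f hf).2.1.trans (Presentation.ev_dd hf false r _).symm)
    refine ⟨h1, h2, ?_, ?_⟩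
    · exact Presentation.ev_ext fun D f hf => (Presentation.ev_cc hf r _ _ h1).trans
        ((key D f hf).2.2.1.trans (Presentation.ev_dd hf false r _).symm)
    · exact Presentation.ev_ext fun D f hf => (Presentation.ev_cc hf r _ _ h2).trans
        ((key D f hf).2.2.2.trans (Presentation.ev_dd hf false r _).symm)

/-- The functor from the `ω`-category with inverses to the model of a whiskering structure. -/
def hatToModel (hu : C.cat.UnitFree) {n : ℕ} (hn : 2 ≤ n) (W : Whiskering C.cat n) :
    OmegaCat.Functor (hat C).cat (W.model hn) :=
  Presentation.toModel (P := hatPresentation C) (f := (W.toModel hn).map)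
    ⟨Whiskering.model_nc hn C.nc hu, Whiskering.model_path_isGroupoid hn _, W.toModel hn,
      Whiskering.toModel_nc hn, fun _ => rfl⟩

/-! ### Comparison of `C` and `Ĉ` in dimension at most one. -/

/-- The whiskering structure on the trivial group. -/
def trivialWhiskering (C : OmegaCat.{u}) (n : ℕ) : Whiskering C n where
  A := PUnit.{u + 1}
  cl _ := 0
  L _ := 0
  R _ := 0
  cl_low _ _ := rfl
  cl_mul _ _ _ _ _ _ _ _ := rfl
  cl_L _ _ _ _ _ := rfl
  cl_R _ _ _ _ _ := rfl
  L_mul _ _ _ _ _ _ := rfl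
  R_mul _ _ _ _ _ _ := rfl
  L_R _ _ _ _ _ := rfl

/-- A retraction on the morphisms of dimension at most `1`. -/
def hatRetract (hu : C.cat.UnitFree) (q : (hat C).cat) : C.cat :=
  Whiskering.Cell.x ((hatToModel hu le_rfl (trivialWhiskering C.cat 2)).map q)

/-- By definition `hatToModel` restricts along `hatFunctor` to `toModel`, whose first component is
`s_1`. -/
theorem hatRetract_map (hu : C.cat.UnitFree) {x : C.cat} (hx : C.cat.dim x ≤ 1) :
    hatRetract hu ((hatFunctor C).map x) = x := OmegaCat.d_eq_self hx

theorem hatFunctor_injective (hu : C.cat.UnitFree) {x y : C.cat} (hx : C.cat.dim x ≤ 1)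
    (hy : C.cat.dim y ≤ 1) (h : (hatFunctor C).map x = (hatFunctor C).map y) : x = y := by
  rw [← hatRetract_map hu hx, h, hatRetract_map hu hy]

/-- Injectivity in dimension at most one reflects the equation `s_k x = x`. -/
theorem hatFunctor_dim (hu : C.cat.UnitFree) {x : C.cat} (hx : C.cat.dim x ≤ 1) :
    (hat C).cat.dim ((hatFunctor C).map x) = C.cat.dim x := by
  refine le_antisymm ((hatFunctor C).dim_map_le x) ?_
  have h := (hat C).cat.d_dim false ((hatFunctor C).map x)
  rw [← (hatFunctor C).map_d] at h
  exact (C.cat.dim_le_iff false _ x).2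
    (hatFunctor_injective hu ((C.cat.dim_d_le_dim _ _ _).trans hx) hx h)

theorem hatFunctor_cmp (hu : C.cat.UnitFree) {x y : C.cat}
    (h : (hat C).cat.Cmp 0 ((hatFunctor C).map x) ((hatFunctor C).map y)) : C.cat.Cmp 0 x y := by
  unfold OmegaCat.Cmp at h
  rw [← (hatFunctor C).map_d, ← (hatFunctor C).map_d] at h
  exact hatFunctor_injective hu ((C.cat.dim_d_le _ _ _).trans Nat.one_pos.le)
    ((C.cat.dim_d_le _ _ _).trans Nat.one_pos.le) h

/-- Inverses for `*_1` exchange the `1`-dimensional source and target, and inverses for `*_r` with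
`r > 1` keep them. For `*_0` the `1`-dimensional faces are composed, and their composability in `Ĉ`
descends to `C` by `hatFunctor_cmp`. -/
theorem hat_exists_d_one (hu : C.cat.UnitFree) (q : (hat C).cat) :
    ∀ α, ∃ x : C.cat, C.cat.dim x ≤ 1 ∧ (hatFunctor C).map x = (hat C).cat.d α 1 q := by
  induction q using hat_induction with
  | gen x => exact fun α => ⟨C.cat.d α 1 x, C.cat.dim_d_le _ _ _, (hatFunctor C).map_d α 1 x⟩
  | d β k q ih =>
    intro α
    rcases lt_trichotomy 1 k with hk | rfl | hk
    · rw [OmegaCat.d_d_lt _ _ _ _ _ hk]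
      exact ih α
    · rw [OmegaCat.d_d_same]
      exact ih β
    · obtain rfl : k = 0 := by omega
      obtain ⟨x, -, hx⟩ := ih true
      refine ⟨C.cat.d β 0 x, (C.cat.dim_d_le _ _ _).trans Nat.one_pos.le, ?_⟩
      rw [(hatFunctor C).map_d, hx, OmegaCat.d_d_ge _ _ _ _ _ zero_le_one, OmegaCat.d_zero_d_one]
  | mul k p q h ihp ihq =>
    intro α
    rcases k with _ | _ | k
    · obtain ⟨x, hx, hx'⟩ := ihp α
      obtain ⟨y, hy, hy'⟩ := ihq α
      have h' := OmegaCat.cmp_d_one_left (OmegaCat.cmp_d_one_right h α) α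
      rw [OmegaCat.d_mul h (by omega), ← hx', ← hy']
      rw [← hx', ← hy'] at h'
      have hc := hatFunctor_cmp hu h'
      exact ⟨C.cat.mul 0 x y, OmegaCat.dim_mul_le hc hx hy, (hatFunctor C).map_mul hc⟩
    · cases α
      · rw [OmegaCat.src_of_mul h]
        exact ihp _
      · rw [OmegaCat.tgt_of_mul h]
        exact ihq _
    · rw [OmegaCat.d_mul_lt h (by omega)]
      exact ihp α
  | inv r p q hr h ih =>
    intro α
    obtain ⟨h1, h2, -⟩ := OmegaCat.isInverse_iff.1 h
    rcases lt_or_eq_of_le hr with hr | rfl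
    · rw [← h1.d_lt hr α]
      exact ih α
    · cases α
      · rw [← h1]
        exact ih _
      · rw [h2]
        exact ih _

theorem hat_exists (hu : C.cat.UnitFree) {q : (hat C).cat} (hq : (hat C).cat.dim q ≤ 1) :
    ∃ x : C.cat, C.cat.dim x = (hat C).cat.dim q ∧ (hatFunctor C).map x = q := by
  obtain ⟨x, hx, hx'⟩ := hat_exists_d_one hu q false
  rw [OmegaCat.d_eq_self hq] at hx'
  exact ⟨x, by rw [← hx', hatFunctor_dim hu hx], hx'⟩

/-! ### Generation of the classes of `Ĉ` by those of `C`. -/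

/-- The statement is made strong enough for induction on `q` in two ways. All whiskerings are
allowed, because a composite for `*_0` whiskers each factor by a `1`-dimensional face of the other.
Both `n`-dimensional faces are included, because `*_n` and its inverses mix source and target. -/
theorem hat_whisk_mem (hu : C.cat.UnitFree) {B : Type*} [AddCommGroup B] (I : AddSubgroup B)
    {n : ℕ} (hn : 2 ≤ n) (cl : (hat C).cat → B)
    (low : ∀ x, (hat C).cat.dim x < n → cl x = 0)
    (mul : ∀ p x y, (hat C).cat.Cmp p x y → 1 ≤ p → p < n → (hat C).cat.dim x ≤ n →
      (hat C).cat.dim y ≤ n → cl ((hat C).cat.mul p x y) = cl x + cl y)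
    (gen : ∀ x, C.cat.dim x ≤ n → cl ((hatFunctor C).map x) ∈ I) (q : (hat C).cat) :
    ∀ α u v, (hat C).cat.dim u ≤ 1 → (hat C).cat.dim v ≤ 1 → (hat C).cat.Cmp 0 u q →
      (hat C).cat.Cmp 0 q v → cl (OmegaCat.whisk u ((hat C).cat.d α n q) v) ∈ I := by
  have hn0 : 0 < n := by omega
  -- Whiskering by `1`-morphisms keeps the dimension below `n`, because `n - 1 ≥ 1`.
  have small : ∀ k u x v, k < n → (hat C).cat.dim x ≤ k → (hat C).cat.dim u ≤ 1 →
      (hat C).cat.dim v ≤ 1 → (hat C).cat.Cmp 0 u x → (hat C).cat.Cmp 0 x v →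
      cl (OmegaCat.whisk u x v) = 0 := by
    intro k u x v hk hx hu hv h h'
    exact low _ ((OmegaCat.dim_whisk_le (k := n - 1) h h' (by omega) (by omega)
      (by omega)).trans_lt (by omega))
  have cmpR : ∀ (α : Bool) (k : ℕ) (x y : (hat C).cat), 0 < k → (hat C).cat.Cmp 0 x y →
      (hat C).cat.Cmp 0 ((hat C).cat.d α k x) y := fun α k x y hk h =>
    ((hat C).cat.d_d_lt _ _ _ _ hk _).trans h
  have cmpL : ∀ (α : Bool) (k : ℕ) (x y : (hat C).cat), 0 < k → (hat C).cat.Cmp 0 x y →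
      (hat C).cat.Cmp 0 x ((hat C).cat.d α k y) := fun α k x y hk h =>
    Eq.trans h ((hat C).cat.d_d_lt _ _ _ _ hk _).symm
  have add : ∀ p u x y v, (hat C).cat.Cmp p x y → 1 ≤ p → p < n → (hat C).cat.dim x ≤ n →
      (hat C).cat.dim y ≤ n → (hat C).cat.dim u ≤ 1 → (hat C).cat.dim v ≤ 1 →
      (hat C).cat.Cmp 0 u x → (hat C).cat.Cmp 0 x v →
      cl (OmegaCat.whisk u ((hat C).cat.mul p x y) v) =
        cl (OmegaCat.whisk u x v) + cl (OmegaCat.whisk u y v) := by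
    intro p u x y v h hp hpn hx hy hu hv h1 h2
    rw [OmegaCat.whisk_mul hp h h1 h2 hu hv]
    refine mul p _ _ (h.whisk hp h1 h2 hu hv) hp hpn
      (OmegaCat.dim_whisk_le h1 h2 (by omega) hx (by omega))
      (OmegaCat.dim_whisk_le (Eq.trans h1 (h.d_lt hp _)) (Eq.trans (h.d_lt hp _).symm h2)
        (by omega) hy (by omega))
  induction q using hat_induction with
  | gen x =>
    intro α u v hu' hv' h1 h2
    -- The whiskering morphisms come from `C`, so the whole whiskered composite does.
    obtain ⟨u, hu1, rfl⟩ := hat_exists hu hu'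
    obtain ⟨v, hv1, rfl⟩ := hat_exists hu hv'
    have h1' : C.cat.Cmp 0 u (C.cat.d α n x) :=
      Eq.trans (hatFunctor_cmp hu h1) (C.cat.d_d_lt _ _ _ _ hn0 _).symm
    have h2' : C.cat.Cmp 0 (C.cat.d α n x) v :=
      (C.cat.d_d_lt _ _ _ _ hn0 _).trans (hatFunctor_cmp hu h2)
    rw [← (hatFunctor C).map_d, ← (hatFunctor C).map_whisk h1' h2']
    exact gen _ (OmegaCat.dim_whisk_le h1' h2' (by omega) (C.cat.dim_d_le _ _ _) (by omega))
  | d β k q ih =>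
    intro α u v hu' hv' h1 h2
    rcases lt_or_ge k n with hk | hk
    · rw [OmegaCat.d_d_ge _ _ _ _ _ hk.le, small k _ _ _ hk (OmegaCat.dim_d_le _ _ _ _) hu' hv' h1 h2]
      exact I.zero_mem
    · have h1' : (hat C).cat.Cmp 0 u q := Eq.trans h1 ((hat C).cat.d_d_lt _ _ _ _ (by omega) _)
      have h2' : (hat C).cat.Cmp 0 q v := Eq.trans ((hat C).cat.d_d_lt _ _ _ _ (by omega) _).symm h2
      rcases eq_or_lt_of_le hk with rfl | hk
      · rw [OmegaCat.d_d_same]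
        exact ih β u v hu' hv' h1' h2'
      · rw [OmegaCat.d_d_lt _ _ _ _ _ hk]
        exact ih α u v hu' hv' h1' h2'
  | mul k p q h ihp ihq =>
    intro α u v hu' hv' h1 h2
    have dp := OmegaCat.dim_d_le (hat C).cat α n p
    have dq := OmegaCat.dim_d_le (hat C).cat α n q
    rcases Nat.eq_zero_or_pos k with rfl | hk0
    · have up : (hat C).cat.Cmp 0 u p := Eq.trans h1 (OmegaCat.src_of_mul h)
      have qv : (hat C).cat.Cmp 0 q v := Eq.trans (OmegaCat.tgt_of_mul h).symm h2
      have up' := cmpL α n _ _ hn0 up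
      have qv' := cmpR α n _ _ hn0 qv
      have hpq := cmpL α n _ _ hn0 (cmpR α n _ _ hn0 h)
      have pq1 := OmegaCat.cmp_d_one_right hpq false
      have pq2 := OmegaCat.cmp_d_one_left hpq true
      have d1q := OmegaCat.dim_d_le (hat C).cat false 1 ((hat C).cat.d α n q)
      have d1p := OmegaCat.dim_d_le (hat C).cat true 1 ((hat C).cat.d α n p)
      have q1v := cmpR false 1 _ _ Nat.one_pos qv'
      have up1 := cmpL true 1 _ _ Nat.one_pos up'
      rw [OmegaCat.d_mul h (by omega), ← OmegaCat.mul_exchange hpq,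
        add 1 _ _ _ _ (OmegaCat.cmp_exchange hpq) le_rfl (by omega)
          (OmegaCat.dim_mul_le pq1 dp (by omega)) (OmegaCat.dim_mul_le pq2 (by omega) dq) hu' hv'
          (up'.mul_right pq1) (pq1.mul_left q1v)]
      -- Associativity moves the `1`-dimensional face of one factor into the morphism that whiskers
      -- the other.
      have e1 : OmegaCat.whisk u ((hat C).cat.mul 0 ((hat C).cat.d α n p)
          ((hat C).cat.d false 1 ((hat C).cat.d α n q))) v = OmegaCat.whisk u
          ((hat C).cat.d α n p) ((hat C).cat.mul 0 ((hat C).cat.d false 1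
            ((hat C).cat.d α n q)) v) := by
        unfold OmegaCat.whisk
        rw [OmegaCat.mul_assoc pq1 q1v]
      have e2 : OmegaCat.whisk u ((hat C).cat.mul 0 ((hat C).cat.d true 1
          ((hat C).cat.d α n p)) ((hat C).cat.d α n q)) v = OmegaCat.whisk ((hat C).cat.mul 0 u
          ((hat C).cat.d true 1 ((hat C).cat.d α n p))) ((hat C).cat.d α n q) v := by
        unfold OmegaCat.whisk
        rw [OmegaCat.mul_assoc pq2 qv', OmegaCat.mul_assoc up1 (pq2.mul_right qv')]
      rw [e1, e2]
      refine I.add_mem (ihp α _ _ hu' (OmegaCat.dim_mul_le q1v d1q hv') up ?_)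
        (ihq α _ _ (OmegaCat.dim_mul_le up1 hu' d1p) hv' ?_ qv)
      · refine OmegaCat.Cmp.mul_right ?_ q1v
        exact cmpL _ _ _ _ Nat.one_pos (cmpL _ _ _ _ hn0 h)
      · refine OmegaCat.Cmp.mul_left up1 ?_
        exact cmpR _ _ _ _ Nat.one_pos (cmpR _ _ _ _ hn0 h)
    · have up : (hat C).cat.Cmp 0 u p := Eq.trans h1 (OmegaCat.d_mul_lt h hk0 _)
      have pv : (hat C).cat.Cmp 0 p v := Eq.trans (OmegaCat.d_mul_lt h hk0 _).symm h2
      have uq : (hat C).cat.Cmp 0 u q := Eq.trans up (h.d_lt hk0 _)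
      have qv : (hat C).cat.Cmp 0 q v := Eq.trans (h.d_lt hk0 _).symm pv
      rcases lt_trichotomy k n with hk | rfl | hk
      · rw [OmegaCat.d_mul h (by omega), add k _ _ _ _ (h.face (by omega) _ _ (Or.inl rfl)) hk0 hk
          dp dq hu' hv' (cmpL _ _ _ _ hn0 up) (cmpR _ _ _ _ hn0 pv)]
        exact I.add_mem (ihp α u v hu' hv' up pv) (ihq α u v hu' hv' uq qv)
      · cases α
        · rw [OmegaCat.src_of_mul h]
          exact ihp _ u v hu' hv' up pv
        · rw [OmegaCat.tgt_of_mul h]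
          exact ihq _ u v hu' hv' uq qv
      · rw [OmegaCat.d_mul_lt h hk]
        exact ihp _ u v hu' hv' up pv
  | inv r p q hr h ih =>
    intro α u v hu' hv' h1 h2
    obtain ⟨c1, c2, h3, -⟩ := OmegaCat.isInverse_iff.1 h
    have up : (hat C).cat.Cmp 0 u p := Eq.trans h1 (c1.d_lt hr _).symm
    have pv : (hat C).cat.Cmp 0 p v := Eq.trans (c1.d_lt hr _) h2
    rcases lt_trichotomy r n with hk | rfl | hk
    -- For `r < n` the composite `p *_r q` is an `r`-dimensional face and has class zero, so the
    -- class of `q` is the opposite of that of `p`. For `r = n` the faces are exchanged, and for `r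
    -- > n` they are equal.
    · have e := add r u _ _ v (c1.face (m := n) (by omega) α α (Or.inl rfl)) hr hk
        (OmegaCat.dim_d_le _ _ _ _) (OmegaCat.dim_d_le _ _ _ _) hu' hv' (cmpL _ _ _ _ hn0 up)
        (cmpR _ _ _ _ hn0 pv)
      rw [← OmegaCat.d_mul c1 (by omega), h3, OmegaCat.d_d_ge _ _ _ _ _ hk.le,
        small r _ _ _ hk (OmegaCat.dim_d_le _ _ _ _) hu' hv' (cmpL _ _ _ _ hr up)
          (cmpR _ _ _ _ hr pv)] at e
      rw [← neg_eq_of_add_eq_zero_right e.symm]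
      exact I.neg_mem (ih α u v hu' hv' up pv)
    · cases α
      · rw [← c1]
        exact ih _ u v hu' hv' up pv
      · rw [c2]
        exact ih _ u v hu' hv' up pv
    · rw [← c1.d_lt hk]
      exact ih _ u v hu' hv' up pv

/-- The classes of the morphisms of `C` generate the classes of the morphisms with inverses. -/
theorem hat_class_mem (hu : C.cat.UnitFree) {B : Type*} [AddCommGroup B] (I : AddSubgroup B)
    {n : ℕ} (hn : 2 ≤ n) (cl : (hat C).cat → B)
    (low : ∀ x, (hat C).cat.dim x < n → cl x = 0)
    (mul : ∀ p x y, (hat C).cat.Cmp p x y → 1 ≤ p → p < n → (hat C).cat.dim x ≤ n →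
      (hat C).cat.dim y ≤ n → cl ((hat C).cat.mul p x y) = cl x + cl y)
    (gen : ∀ x, C.cat.dim x ≤ n → cl ((hatFunctor C).map x) ∈ I) (q : (hat C).cat)
    (hq : (hat C).cat.dim q ≤ n) : cl q ∈ I := by
  -- The whiskering morphisms are taken to be the identities `s_0 q` and `t_0 q`.
  have := hat_whisk_mem hu I hn cl low mul gen q false ((hat C).cat.d false 0 q)
    ((hat C).cat.d true 0 q) ((OmegaCat.dim_d_le _ _ _ _).trans Nat.one_pos.le)
    ((OmegaCat.dim_d_le _ _ _ _).trans Nat.one_pos.le) (OmegaCat.cmp_src 0 q)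
    (OmegaCat.cmp_tgt 0 q)
  rwa [OmegaCat.d_eq_self hq, OmegaCat.whisk, OmegaCat.mul_tgt, OmegaCat.src_mul] at this

end Hat

end

end HDA

namespace HDA

noncomputable section

/-! ### Classes in the formal complexes -/

/-- In a non-contracting `ω`-category the `p`-dimensional faces, `p ≥ 1`, of a morphism of positive
dimension have positive dimension, and `x` and `y` share such a face. -/
theorem NCat.one_le_dim_of_cmp (C : NCat.{u}) {p : ℕ} (hp : 1 ≤ p) {x y : C.cat}
    (h : C.cat.Cmp p x y) : 1 ≤ C.cat.dim x ↔ 1 ≤ C.cat.dim y := by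
  obtain ⟨p, rfl⟩ : ∃ k, p = k + 1 := ⟨p - 1, by omega⟩
  constructor
  · intro hx
    have := C.nc.one_le_dim_d hx true p
    rw [h] at this
    exact OmegaCat.one_le_dim_of_d this
  · intro hy
    have := C.nc.one_le_dim_d hy false p
    rw [← h] at this
    exact OmegaCat.one_le_dim_of_d this

theorem NCat.one_le_dim_mul (C : NCat.{u}) {p : ℕ} (hp : 1 ≤ p) {x y : C.cat}
    (h : C.cat.Cmp p x y) (hx : 1 ≤ C.cat.dim x) : 1 ≤ C.cat.dim (C.cat.mul p x y) := by
  obtain ⟨p, rfl⟩ : ∃ k, p = k + 1 := ⟨p - 1, by omega⟩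
  rw [← OmegaCat.comp_eq_mul h]
  exact C.nc.one_le_dim_comp hx p h

/-- The formal complex in degree `m + 1`. -/
abbrev FormalA (κ : Kind) (C : NCat.{u}) (m : ℕ) : Type u :=
  (FormalG κ C (m + 1) →₀ ℤ) ⧸ formalSpan κ C (m + 1)

variable {κ : Kind} {C : NCat.{u}} {m : ℕ}

/-- The class of a generator of degree `m + 1`. -/
def formalMk (x : FormalG κ C (m + 1)) : FormalA κ C m :=
  (formalSpan κ C (m + 1)).mkQ (Finsupp.single x 1)

variable (κ m) in
/-- The class of a morphism in degree `m + 1`. -/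
def formalClass (x : C.cat) : FormalA κ C m :=
  -- Identities of objects are not generators. Giving them the class zero extends the rule that
  -- morphisms of dimension at most `m` vanish.
  if h : 1 ≤ C.cat.dim x ∧ C.cat.dim x ≤ m + 1 then
    formalMk (⟨x, h⟩ : {x : C.cat // 1 ≤ C.cat.dim x ∧ C.cat.dim x ≤ m + 1}) else 0

theorem formalClass_of_mem (x : FormalG κ C (m + 1)) : formalClass κ m x.1 = formalMk x :=
  dif_pos x.2

theorem formalClass_low {x : C.cat} (hx : C.cat.dim x ≤ m) : formalClass κ m x = 0 := by
  unfold formalClass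
  split_ifs with h
  · refine (Submodule.Quotient.mk_eq_zero _).2 (Submodule.subset_span (Or.inl ⟨_, hx, rfl⟩))
  · rfl

theorem formalClass_mul {p : ℕ} {x y : C.cat} (h : C.cat.Cmp p x y) (hp : 1 ≤ p) (hpm : p ≤ m)
    (hx : C.cat.dim x ≤ m + 1) (hy : C.cat.dim y ≤ m + 1) :
    formalClass κ m (C.cat.mul p x y) = formalClass κ m x + formalClass κ m y := by
  have hxy := C.one_le_dim_of_cmp hp h
  by_cases hx0 : 1 ≤ C.cat.dim x
  · have hz := C.one_le_dim_mul hp h hx0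
    have hz' := OmegaCat.dim_mul_le h hx hy
    have e := (Submodule.Quotient.mk_eq_zero _).2 (Submodule.subset_span (R := ℤ)
      (s := formalRel κ C m) (Or.inr (Or.inl ⟨⟨x, hx0, hx⟩, ⟨y, hxy.1 hx0, hy⟩, ⟨_, hz, hz'⟩,
        ⟨p, hp, hpm, h, (OmegaCat.comp_eq_mul h).symm⟩, rfl⟩)))
    rw [Submodule.Quotient.mk_sub, Submodule.Quotient.mk_sub, sub_sub, sub_eq_zero] at e
    unfold formalClass
    rw [dif_pos ⟨hz, hz'⟩, dif_pos ⟨hx0, hx⟩, dif_pos ⟨hxy.1 hx0, hy⟩]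
    exact e
  -- If `x` is `0`-dimensional, so is `y`. Then the two are equal to each other and to the
  -- composite, and all classes are zero.
  · have hy0 := fun h => hx0 (hxy.2 h)
    rw [OmegaCat.eq_of_cmp_of_dim_le h (by omega) (by omega), formalClass_low (x := x) (by omega),
      formalClass_low (x := y) (by omega), add_zero]

/-- `UnitFree` makes the composite a generator. Both factors must have positive dimension: if `x` is
an identity, then `x *_0 y = y`, whereas the branching relation would give the class of `x`, and
symmetrically for the merging one. -/
theorem formalClass_mul_zero {α : Bool} (hu : C.cat.UnitFree) {x y : C.cat}
    (h : C.cat.Cmp 0 x y) (hx0 : 1 ≤ C.cat.dim x) (hy0 : 1 ≤ C.cat.dim y)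
    (hx : C.cat.dim x ≤ m + 1) (hy : C.cat.dim y ≤ m + 1) :
    formalClass (.corner α) m (C.cat.mul 0 x y) =
      formalClass (.corner α) m (if α then y else x) := by
  have hz : 1 ≤ C.cat.dim (C.cat.mul 0 x y) := by
    by_contra hz
    have := (hu x y h (by omega)).1
    omega
  have hz' := OmegaCat.dim_mul_le h hx hy
  have e := (Submodule.Quotient.mk_eq_zero _).2 (Submodule.subset_span (R := ℤ)
    (s := formalRel (.corner α) C m) (Or.inr (Or.inr ⟨α, rfl, ⟨x, hx0, hx⟩, ⟨y, hy0, hy⟩,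
      ⟨_, hz, hz'⟩, ⟨h, (OmegaCat.comp_eq_mul h).symm⟩, rfl⟩)))
  rw [Submodule.Quotient.mk_sub, sub_eq_zero] at e
  cases α
  · change _ = formalClass _ m x
    unfold formalClass
    rw [dif_pos ⟨hz, hz'⟩, dif_pos ⟨hx0, hx⟩]
    exact e
  · change _ = formalClass _ m y
    unfold formalClass
    rw [dif_pos ⟨hz, hz'⟩, dif_pos ⟨hy0, hy⟩]
    exact e

/-! ### Homomorphisms out of the formal groups. -/

/-- The maps of morphisms that respect the relations of the formal complex in degree `m + 1`. -/
structure Respects (κ : Kind) (m : ℕ) {B : Type v} [AddCommGroup B] (f : C.cat → B) : Prop where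
  low : ∀ x, C.cat.dim x ≤ m → f x = 0
  mul : ∀ p x y, C.cat.Cmp p x y → 1 ≤ p → p ≤ m → C.cat.dim x ≤ m + 1 → C.cat.dim y ≤ m + 1 →
    f (C.cat.mul p x y) = f x + f y
  mul_zero : ∀ α, κ = .corner α → ∀ x y, C.cat.Cmp 0 x y → 1 ≤ C.cat.dim x → 1 ≤ C.cat.dim y →
    C.cat.dim x ≤ m + 1 → C.cat.dim y ≤ m + 1 → f (C.cat.mul 0 x y) = f (if α then y else x)

/-- The homomorphism on the formal complex induced by a map that respects the relations. -/
def Respects.lift {B : Type v} [AddCommGroup B] {f : C.cat → B} (hf : Respects κ m f) :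
    FormalA κ C m →+ B :=
  (Submodule.liftQ (formalSpan κ C (m + 1))
    (Finsupp.linearCombination ℤ (fun x : FormalG κ C (m + 1) => f x.1)) (by
      refine Submodule.span_le.2 ?_
      rintro v (⟨x, hx, rfl⟩ | ⟨x, y, z, ⟨p, hp, hpm, h, hz⟩, rfl⟩ |
        ⟨α, hα, x, y, z, ⟨h, hz⟩, rfl⟩)
      · rw [SetLike.mem_coe, LinearMap.mem_ker, Finsupp.linearCombination_single, one_smul]
        exact hf.low _ hx
      · rw [SetLike.mem_coe, LinearMap.mem_ker, map_sub, map_sub,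
          Finsupp.linearCombination_single, Finsupp.linearCombination_single,
          Finsupp.linearCombination_single, one_smul, one_smul, one_smul, hz,
          OmegaCat.comp_eq_mul h, hf.mul p _ _ h hp hpm x.2.2 y.2.2]
        abel
      · rw [SetLike.mem_coe, LinearMap.mem_ker, map_sub,
          Finsupp.linearCombination_single, Finsupp.linearCombination_single, one_smul, one_smul,
          hz, OmegaCat.comp_eq_mul h, hf.mul_zero α hα _ _ h x.2.1 y.2.1 x.2.2 y.2.2]
        cases α <;> exact sub_self _)).toAddMonoidHom

theorem Respects.lift_mk {B : Type v} [AddCommGroup B] {f : C.cat → B} (hf : Respects κ m f)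
    (x : FormalG κ C (m + 1)) : hf.lift (formalMk x) = f x.1 := by
  change Finsupp.linearCombination ℤ (fun x : FormalG κ C (m + 1) => f x.1)
    (Finsupp.single x 1) = f x.1
  rw [Finsupp.linearCombination_single, one_smul]

theorem Respects.lift_class {B : Type v} [AddCommGroup B] {f : C.cat → B} (hf : Respects κ m f)
    {x : C.cat} (hx : C.cat.dim x ≤ m + 1) : hf.lift (formalClass κ m x) = f x := by
  unfold formalClass
  split_ifs with h
  · exact hf.lift_mk _
  · rw [map_zero, hf.low x (by omega)]

theorem formal_hom_ext {B : Type v} [AddCommGroup B] {f g : FormalA κ C m →+ B}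
    (h : ∀ x, 1 ≤ C.cat.dim x → C.cat.dim x ≤ m + 1 →
      f (formalClass κ m x) = g (formalClass κ m x)) : f = g := by
  have : f.toIntLinearMap = g.toIntLinearMap := by
    refine Submodule.linearMap_qext _ (Finsupp.lhom_ext' fun x => LinearMap.ext_ring ?_)
    have := h x.1 x.2.1 x.2.2
    rwa [formalClass_of_mem] at this
  ext x
  exact LinearMap.congr_fun this x

/-! ### The whiskering structures of the formal complexes -/

open Classical in
-- Composability with `w` depends only on `t_0`, which is common to `x`, `y` and `x *_p y` for `p ≥
-- 1`. Thus either all three terms of a relation are whiskered, and whiskering distributes over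
-- `*_p`, or all three are sent to zero. There is no globular relation for `*_0`.
theorem respects_right (w : C.cat) : Respects .globular (m + 1) (fun x =>
    if C.cat.dim w ≤ 1 ∧ C.cat.Cmp 0 x w then
      formalClass .globular (m + 1) (C.cat.mul 0 x w) else 0) where
  low x hx := by
    split_ifs with h
    · exact formalClass_low (OmegaCat.dim_mul_le h.2 hx (by omega))
    · rfl
  mul p x y h hp hpm hx hy := by
    have e1 : C.cat.Cmp 0 y w ↔ C.cat.Cmp 0 x w := by unfold OmegaCat.Cmp; rw [h.d_lt hp true]
    have e2 : C.cat.Cmp 0 (C.cat.mul p x y) w ↔ C.cat.Cmp 0 x w := by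
      unfold OmegaCat.Cmp; rw [OmegaCat.d_mul_lt h hp]
    rw [e1, e2]
    split_ifs with hw
    · rw [OmegaCat.whisker_right_mul hp h hw.2 hw.1, formalClass_mul
        (h.whisker_right hp hw.2 hw.1) hp hpm (OmegaCat.dim_mul_le hw.2 hx (by omega))
        (OmegaCat.dim_mul_le (e1.2 hw.2) hy (by omega))]
    · rw [add_zero]
  mul_zero α h := nomatch h

open Classical in
theorem respects_left (w : C.cat) : Respects .globular (m + 1) (fun x =>
    if C.cat.dim w ≤ 1 ∧ C.cat.Cmp 0 w x then
      formalClass .globular (m + 1) (C.cat.mul 0 w x) else 0) where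
  low x hx := by
    split_ifs with h
    · exact formalClass_low (OmegaCat.dim_mul_le h.2 (by omega) hx)
    · rfl
  mul p x y h hp hpm hx hy := by
    have e1 : C.cat.Cmp 0 w y ↔ C.cat.Cmp 0 w x := by unfold OmegaCat.Cmp; rw [h.d_lt hp false]
    have e2 : C.cat.Cmp 0 w (C.cat.mul p x y) ↔ C.cat.Cmp 0 w x := by
      unfold OmegaCat.Cmp; rw [OmegaCat.d_mul_lt h hp]
    rw [e1, e2]
    split_ifs with hw
    · rw [OmegaCat.whisker_left_mul hp h hw.2 hw.1, formalClass_mul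
        (h.whisker_left hp hw.2 hw.1) hp hpm (OmegaCat.dim_mul_le hw.2 (by omega) hx)
        (OmegaCat.dim_mul_le (e1.2 hw.2) (by omega) hy)]
    · rw [add_zero]
  mul_zero α h := nomatch h

/-- The identity for morphisms of dimension `0`, and zero otherwise. -/
def unitAction (C : NCat.{u}) (A : Type u) [AddCommGroup A] (w : C.cat) : A →+ A :=
  if C.cat.dim w = 0 then AddMonoidHom.id A else 0

/-- `UnitFree` says that the composite is `0`-dimensional only if both factors are, and the converse
always holds. -/
theorem unitAction_mul (hu : C.cat.UnitFree) {A : Type u} [AddCommGroup A] {w w' : C.cat}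
    (h : C.cat.Cmp 0 w w') (a : A) : unitAction C A (C.cat.mul 0 w w') a =
      unitAction C A w (unitAction C A w' a) := by
  by_cases h0 : C.cat.dim (C.cat.mul 0 w w') = 0
  · obtain ⟨h1, h2⟩ := hu _ _ h h0
    simp [unitAction, h0, h1, h2]
  · have : ¬ (C.cat.dim w = 0 ∧ C.cat.dim w' = 0) := fun h1 =>
      h0 (Nat.le_zero.1 (OmegaCat.dim_mul_le h h1.1.le h1.2.le))
    by_cases h1 : C.cat.dim w = 0
    · simp [unitAction, h0, show C.cat.dim w' ≠ 0 from fun h2 => this ⟨h1, h2⟩]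
    · simp [unitAction, h0, h1]

/-- The left action of the morphisms of dimension at most `1` on the formal complex. -/
def leftAction (C : NCat.{u}) (m : ℕ) :
    (κ : Kind) → C.cat → FormalA κ C (m + 1) →+ FormalA κ C (m + 1)
  | .globular, w => (respects_left w).lift
  -- In the merging complex `w *_0 x` has the class of `x`. In the branching complex it has the
  -- class of `w`, which is zero in degree `m + 2` because `w` has dimension at most one, unless `w`
  -- is an identity.
  | .corner true, _ => AddMonoidHom.id _
  | .corner false, w => unitAction C _ w

/-- The right action of the morphisms of dimension at most `1` on the formal complex. -/
def rightAction (C : NCat.{u}) (m : ℕ) :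
    (κ : Kind) → C.cat → FormalA κ C (m + 1) →+ FormalA κ C (m + 1)
  | .globular, w => (respects_right w).lift
  | .corner true, w => unitAction C _ w
  | .corner false, _ => AddMonoidHom.id _

theorem leftAction_globular {w x : C.cat} (h : C.cat.Cmp 0 w x) (hw : C.cat.dim w ≤ 1)
    (hx : C.cat.dim x ≤ m + 2) : leftAction C m .globular w (formalClass .globular (m + 1) x) =
      formalClass .globular (m + 1) (C.cat.mul 0 w x) :=
  ((respects_left w).lift_class hx).trans (if_pos ⟨hw, h⟩)

theorem rightAction_globular {w x : C.cat} (h : C.cat.Cmp 0 x w) (hw : C.cat.dim w ≤ 1)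
    (hx : C.cat.dim x ≤ m + 2) : rightAction C m .globular w (formalClass .globular (m + 1) x) =
      formalClass .globular (m + 1) (C.cat.mul 0 x w) :=
  ((respects_right w).lift_class hx).trans (if_pos ⟨hw, h⟩)

theorem leftAction_globular_zero {w x : C.cat} (h : ¬ C.cat.Cmp 0 w x)
    (hx : C.cat.dim x ≤ m + 2) :
    leftAction C m .globular w (formalClass .globular (m + 1) x) = 0 :=
  ((respects_left w).lift_class hx).trans (if_neg fun h' => h h'.2)

theorem rightAction_globular_zero {w x : C.cat} (h : ¬ C.cat.Cmp 0 x w)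
    (hx : C.cat.dim x ≤ m + 2) :
    rightAction C m .globular w (formalClass .globular (m + 1) x) = 0 :=
  ((respects_right w).lift_class hx).trans (if_neg fun h' => h h'.2)

/-! ### The laws for the actions. -/

/-- For the corner kinds the relation for `*_0` needs two factors of positive dimension. If `w` is
an identity the composite is `x`. If `x` is an identity the composite is `w`, of class zero since
its dimension is at most one. -/
theorem class_left (hu : C.cat.UnitFree) {w x : C.cat} (h : C.cat.Cmp 0 w x)
    (hw : C.cat.dim w ≤ 1) (hx : C.cat.dim x ≤ m + 2) :
    formalClass κ (m + 1) (C.cat.mul 0 w x) = leftAction C m κ w (formalClass κ (m + 1) x) := by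
  match κ with
  | .globular => exact (leftAction_globular h hw hx).symm
  | .corner α =>
    by_cases hw0 : C.cat.dim w = 0
    · rw [OmegaCat.mul_of_dim_zero_left h hw0.le]
      cases α
      · simp [leftAction, unitAction, hw0]
      · simp [leftAction]
    · by_cases hx0 : C.cat.dim x = 0
      · rw [OmegaCat.mul_of_dim_zero_right h hx0.le, formalClass_low (x := x) (by omega), map_zero,
          formalClass_low (by omega)]
      · rw [formalClass_mul_zero hu h (by omega) (by omega) (by omega) hx]
        cases α
        · simp only [leftAction, unitAction, hw0, if_false, AddMonoidHom.zero_apply]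
          exact formalClass_low (x := w) (by omega)
        · rfl

theorem class_right (hu : C.cat.UnitFree) {w x : C.cat} (h : C.cat.Cmp 0 x w)
    (hw : C.cat.dim w ≤ 1) (hx : C.cat.dim x ≤ m + 2) :
    formalClass κ (m + 1) (C.cat.mul 0 x w) = rightAction C m κ w (formalClass κ (m + 1) x) := by
  match κ with
  | .globular => exact (rightAction_globular h hw hx).symm
  | .corner α =>
    by_cases hw0 : C.cat.dim w = 0
    · rw [OmegaCat.mul_of_dim_zero_right h hw0.le]
      cases α
      · simp [rightAction]
      · simp [rightAction, unitAction, hw0]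
    · by_cases hx0 : C.cat.dim x = 0
      · rw [OmegaCat.mul_of_dim_zero_left h hx0.le, formalClass_low (x := x) (by omega), map_zero,
          formalClass_low (by omega)]
      · rw [formalClass_mul_zero hu h (by omega) (by omega) hx (by omega)]
        cases α
        · rfl
        · simp only [rightAction, unitAction, hw0, if_false, AddMonoidHom.zero_apply]
          exact formalClass_low (x := w) (by omega)

/-- In the globular case it suffices to look at generators `x`. Since `w *_0 w'` and `w'` have the
same `0`-target, they are composable with the same `x`, and outside this case both sides vanish. -/
theorem leftAction_mul (hu : C.cat.UnitFree) {w w' : C.cat} (h : C.cat.Cmp 0 w w')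
    (hw : C.cat.dim w ≤ 1) (hw' : C.cat.dim w' ≤ 1) (a : FormalA κ C (m + 1)) :
    leftAction C m κ (C.cat.mul 0 w w') a = leftAction C m κ w (leftAction C m κ w' a) := by
  match κ with
  | .corner true => rfl
  | .corner false => exact unitAction_mul hu h a
  | .globular =>
    refine DFunLike.congr_fun (g := (leftAction C m .globular w).comp
      (leftAction C m .globular w')) (formal_hom_ext fun x _ hx => ?_) a
    rw [AddMonoidHom.comp_apply]
    by_cases hc : C.cat.Cmp 0 w' x
    · rw [leftAction_globular (h.mul_left hc) (OmegaCat.dim_mul_le h hw hw') hx,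
        leftAction_globular hc hw' hx, leftAction_globular (h.mul_right hc) hw
          (OmegaCat.dim_mul_le hc (by omega) hx), OmegaCat.mul_assoc h hc]
    · rw [leftAction_globular_zero hc hx, map_zero, leftAction_globular_zero _ hx]
      unfold OmegaCat.Cmp
      rwa [OmegaCat.tgt_of_mul h]

theorem rightAction_mul (hu : C.cat.UnitFree) {w w' : C.cat} (h : C.cat.Cmp 0 w w')
    (hw : C.cat.dim w ≤ 1) (hw' : C.cat.dim w' ≤ 1) (a : FormalA κ C (m + 1)) :
    rightAction C m κ (C.cat.mul 0 w w') a = rightAction C m κ w' (rightAction C m κ w a) := by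
  match κ with
  | .corner false => rfl
  | .corner true =>
    refine (unitAction_mul hu h a).trans ?_
    change unitAction C _ w (unitAction C _ w' a) = unitAction C _ w' (unitAction C _ w a)
    unfold unitAction
    split_ifs <;> rfl
  | .globular =>
    refine DFunLike.congr_fun (g := (rightAction C m .globular w').comp
      (rightAction C m .globular w)) (formal_hom_ext fun x _ hx => ?_) a
    rw [AddMonoidHom.comp_apply]
    by_cases hc : C.cat.Cmp 0 x w
    · rw [rightAction_globular (hc.mul_right h) (OmegaCat.dim_mul_le h hw hw') hx,
        rightAction_globular hc hw hx, rightAction_globular (hc.mul_left h) hw'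
          (OmegaCat.dim_mul_le hc hx (by omega)), OmegaCat.mul_assoc hc h]
    · rw [rightAction_globular_zero hc hx, map_zero, rightAction_globular_zero _ hx]
      unfold OmegaCat.Cmp
      rwa [OmegaCat.src_of_mul h]

/-- In the globular case, whiskering on one side does not alter the `0`-face on the other side, so
the two composability conditions are independent and associativity gives the rest. In each corner
kind one of the two actions is trivial. -/
theorem leftAction_rightAction {w w' : C.cat} (hw : C.cat.dim w ≤ 1) (hw' : C.cat.dim w' ≤ 1)
    (a : FormalA κ C (m + 1)) : leftAction C m κ w (rightAction C m κ w' a) =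
      rightAction C m κ w' (leftAction C m κ w a) := by
  match κ with
  | .corner true => rfl
  | .corner false => rfl
  | .globular =>
    refine DFunLike.congr_fun (f := (leftAction C m .globular w).comp
      (rightAction C m .globular w')) (g := (rightAction C m .globular w').comp
      (leftAction C m .globular w)) (formal_hom_ext fun x _ hx => ?_) a
    rw [AddMonoidHom.comp_apply, AddMonoidHom.comp_apply]
    by_cases hc : C.cat.Cmp 0 w x
    · rw [leftAction_globular hc hw hx]
      have hwx := OmegaCat.dim_mul_le (k := m + 2) hc (by omega) hx
      by_cases hc' : C.cat.Cmp 0 x w'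
      · rw [rightAction_globular hc' hw' hx, leftAction_globular (hc.mul_right hc') hw
          (OmegaCat.dim_mul_le hc' hx (by omega)), rightAction_globular (hc.mul_left hc') hw' hwx,
          OmegaCat.mul_assoc hc hc']
      · rw [rightAction_globular_zero hc' hx, map_zero, rightAction_globular_zero _ hwx]
        unfold OmegaCat.Cmp
        rwa [OmegaCat.tgt_of_mul hc]
    · rw [leftAction_globular_zero hc hx, map_zero]
      by_cases hc' : C.cat.Cmp 0 x w'
      · rw [rightAction_globular hc' hw' hx, leftAction_globular_zero _
          (OmegaCat.dim_mul_le hc' hx (by omega))]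
        unfold OmegaCat.Cmp
        rwa [OmegaCat.src_of_mul hc']
      · rw [rightAction_globular_zero hc' hx, map_zero]

/-- The whiskering structure of the formal complex in degree `m + 2`. -/
def formalWhiskering (κ : Kind) (hu : C.cat.UnitFree) (m : ℕ) : Whiskering C.cat (m + 2) where
  A := FormalA κ C (m + 1)
  cl := formalClass κ (m + 1)
  L := leftAction C m κ
  R := rightAction C m κ
  cl_low x hx := formalClass_low (by omega)
  cl_mul p x y h hp hpm hx hy := formalClass_mul h hp (by omega) hx hy
  cl_L w x h hw hx := class_left hu h hw hx
  cl_R x w h hw hx := class_right hu h hw hx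
  L_mul w w' h hw hw' a := leftAction_mul hu h hw hw' a
  R_mul w w' h hw hw' a := rightAction_mul hu h hw hw' a
  L_R w w' hw hw' a := leftAction_rightAction hw hw' a

end

end HDA

namespace HDA

noncomputable section

/-! ### Functoriality of presented complexes -/

theorem PresentedComplex.Induces.map_comp {A B D : PresentedComplex.{u}}
    {φ : (n : ℕ) → A.G n → B.G n} {ψ : (n : ℕ) → B.G n → D.G n} {χ : (n : ℕ) → A.G n → D.G n}
    (hφ : Induces A B φ) (hψ : Induces B D ψ) (hχ : Induces A D χ)
    (h : ∀ n x, ψ n (φ n x) = χ n x) : hφ.map ≫ hψ.map = hχ.map := by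
  refine HomologicalComplex.Hom.ext (funext fun n => ?_)
  refine (ModuleCat.ofHom_comp _ _).symm.trans (congrArg ModuleCat.ofHom ?_)
  refine Submodule.linearMap_qext _ (Finsupp.lhom_ext' fun x => LinearMap.ext_ring ?_)
  change (D.rel n).mkQ (Finsupp.mapDomain (ψ n) (Finsupp.mapDomain (φ n) (Finsupp.single x 1))) =
    (D.rel n).mkQ (Finsupp.mapDomain (χ n) (Finsupp.single x 1))
  rw [Finsupp.mapDomain_single, Finsupp.mapDomain_single, Finsupp.mapDomain_single, h]

theorem PresentedComplex.Induces.comp {A B D : PresentedComplex.{u}}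
    {φ : (n : ℕ) → A.G n → B.G n} {ψ : (n : ℕ) → B.G n → D.G n}
    (hφ : Induces A B φ) (hψ : Induces B D ψ) : Induces A D (fun n x => ψ n (φ n x)) := by
  have e : ∀ n, Finsupp.lmapDomain ℤ ℤ (fun x => ψ n (φ n x)) =
      Finsupp.lmapDomain ℤ ℤ (ψ n) ∘ₗ Finsupp.lmapDomain ℤ ℤ (φ n) :=
    fun n => Finsupp.lmapDomain_comp ℤ ℤ (φ n) (ψ n)
  constructor
  · intro n x hx
    rw [Submodule.mem_comap, e]
    exact hψ.rel n (hφ.rel n hx)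
  · intro n x
    have h1 := hψ.rel n (hφ.comm n x)
    -- Both squares commute only modulo relations. The image under `ψ` of the first error and the
    -- second error add up telescopically to the error of the composite.
    rw [Submodule.mem_comap, map_sub] at h1
    have h2 := Submodule.add_mem _ h1 (hψ.comm n (Finsupp.lmapDomain ℤ ℤ (φ (n + 1)) x))
    rw [sub_add_sub_cancel] at h2
    rw [e, e]
    exact h2

theorem PresentedComplex.Induces.isIso {A B : PresentedComplex.{u}}
    {φ : (n : ℕ) → A.G n → B.G n} (hφ : Induces A B φ)
    (h : ∀ n, Function.Bijective (Submodule.mapQ (A.rel n) (B.rel n)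
      (Finsupp.lmapDomain ℤ ℤ (φ n)) (hφ.rel n))) : IsIso hφ.map := by
  have : ∀ n, IsIso (hφ.map.f n) := fun n =>
    (ConcreteCategory.isIso_iff_bijective _).2 (h n)
  exact HomologicalComplex.Hom.isIso_of_components _

/-! ### Functoriality of the reduced and the formal complexes -/

theorem Nerve.map_bdry {N N' : Nerve.{u}} {φ : (n : ℕ) → N.X n → N'.X n}
    (h : ∀ n i x, φ n (N.face n i x) = N'.face n i (φ (n + 1) x)) (n : ℕ)
    (x : N.X (n + 1) →₀ ℤ) : Finsupp.lmapDomain ℤ ℤ (φ n) (N.bdry n x) =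
      N'.bdry n (Finsupp.lmapDomain ℤ ℤ (φ (n + 1)) x) :=
  sub_eq_zero.1 ((Nerve.induces_map φ h).comm n x)

theorem Nerve.induces_reduced {N N' : Nerve.{u}} {φ : (n : ℕ) → N.X n → N'.X n}
    (h : ∀ n i x, φ n (N.face n i x) = N'.face n i (φ (n + 1) x))
    (ht : ∀ n x, x ∈ N.thin n → φ n x ∈ N'.thin n) :
    PresentedComplex.Induces N.reduced N'.reduced φ where
  rel n := by
    have thin : ∀ n, N.thinSpan n ≤ (N'.thinSpan n).comap (Finsupp.lmapDomain ℤ ℤ (φ n)) := by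
      intro n
      refine Submodule.span_le.2 ?_
      rintro _ ⟨x, hx, rfl⟩
      rw [SetLike.mem_coe, Submodule.mem_comap, Finsupp.lmapDomain_apply,
        Finsupp.mapDomain_single]
      exact Submodule.subset_span ⟨_, ht n x hx, rfl⟩
    refine sup_le (fun x hx => Submodule.mem_sup_left (thin n hx)) ?_
    rintro _ ⟨x, hx, rfl⟩
    have hm : N'.bdry n (Finsupp.lmapDomain ℤ ℤ (φ (n + 1)) x) ∈
        N'.thinSpan n ⊔ (N'.thinSpan (n + 1)).map (N'.bdry n) :=
      Submodule.mem_sup_right (Submodule.mem_map_of_mem (thin (n + 1) hx))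
    rw [← Nerve.map_bdry h] at hm
    exact hm
  comm n x := by
    have h' : Finsupp.lmapDomain ℤ ℤ (φ n) (N.bdry n x) -
        N'.bdry n (Finsupp.lmapDomain ℤ ℤ (φ (n + 1)) x) = 0 :=
      sub_eq_zero.2 (Nerve.map_bdry h n x)
    exact (congrArg (· ∈ N'.reduced.rel n) h').mpr (Submodule.zero_mem _)

theorem nerveMap_thin {C D : NCat.{u}} (F : NFunctor C D) (κ : Kind) (n : ℕ)
    (x : (nerve κ C).X n) (hx : x ∈ (nerve κ C).thin n) :
    nerveMap F κ n x ∈ (nerve κ D).thin n := by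
  match κ, n with
  | .globular, 0 => exact hx.elim
  | .globular, 1 => exact hx.elim
  | .globular, n + 2 =>
    exact (F.P.dim_map_le (OmegaCat.Functor.map (C := (simplex (n + 1)).nu) x
      (simplexTop (n + 1)))).trans hx
  | .corner α, 0 => exact hx.elim
  | .corner α, 1 => exact hx.elim
  | .corner α, n + 2 => exact (F.fn.dim_map_le _).trans hx

theorem induces_reduced (κ : Kind) {C D : NCat.{u}} (F : NFunctor C D) :
    PresentedComplex.Induces (nerve κ C).reduced (nerve κ D).reduced (nerveMap F κ) :=
  Nerve.induces_reduced (nerveMap_face F κ) (nerveMap_thin F κ)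

/-- The morphism of reduced complexes induced by a non-contracting `ω`-functor. -/
def reducedMap (κ : Kind) {C D : NCat.{u}} (F : NFunctor C D) :
    reducedChains κ C ⟶ reducedChains κ D := (induces_reduced κ F).map

/-- The action of a non-contracting `ω`-functor on the generators of the formal complexes. -/
def formalMap (κ : Kind) {C D : NCat.{u}} (F : NFunctor C D) :
    (n : ℕ) → FormalG κ C n → FormalG κ D n
  | 0, x => nerveMap F κ 0 x
  | _ + 1, x => ⟨F.fn.map x.1, F.nc.one_le_dim C.nc x.2.1, (F.fn.dim_map_le _).trans x.2.2⟩

theorem formalMap_aug (κ : Kind) {C D : NCat.{u}} (F : NFunctor C D) (x : FormalG κ C 1) :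
    formalMap κ F 0 (formalAug C κ x) = formalAug D κ (formalMap κ F 1 x) := by
  cases κ with
  | globular => exact Prod.ext (F.onObj_obj false x.1) (F.onObj_obj true x.1)
  | corner α => exact F.onObj_obj α x.1

theorem formalMap_face (κ : Kind) {C D : NCat.{u}} (F : NFunctor C D) (n : ℕ) (β : Bool)
    (x : FormalG κ C (n + 2)) :
    formalMap κ F (n + 1) (formalFace κ C n β x) = formalFace κ D n β (formalMap κ F (n + 2) x) :=
  Subtype.ext (F.fn.map_d β (n + 1) x.1)

theorem formalMap_bdry (κ : Kind) {C D : NCat.{u}} (F : NFunctor C D) (n : ℕ)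
    (x : FormalG κ C (n + 1) →₀ ℤ) :
    Finsupp.lmapDomain ℤ ℤ (formalMap κ F n) (formalBdry κ C n x) =
      formalBdry κ D n (Finsupp.lmapDomain ℤ ℤ (formalMap κ F (n + 1)) x) := by
  have key : Finsupp.lmapDomain ℤ ℤ (formalMap κ F n) ∘ₗ formalBdry κ C n =
      formalBdry κ D n ∘ₗ Finsupp.lmapDomain ℤ ℤ (formalMap κ F (n + 1)) := by
    refine Finsupp.lhom_ext' fun x => LinearMap.ext_ring ?_
    simp only [LinearMap.comp_apply, Finsupp.lsingle_apply]
    rw [Finsupp.lmapDomain_apply, Finsupp.lmapDomain_apply, Finsupp.mapDomain_single]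
    cases n with
    | zero =>
      rw [formalBdry_zero, formalBdry_zero, Finsupp.mapDomain_single, formalMap_aug]
    | succ n =>
      rw [formalBdry_succ, formalBdry_succ, ← Finsupp.lmapDomain_apply ℤ ℤ, map_smul, map_sub,
        Finsupp.lmapDomain_apply, Finsupp.lmapDomain_apply, Finsupp.mapDomain_single,
        Finsupp.mapDomain_single, formalMap_face, formalMap_face]
  exact LinearMap.congr_fun key x

theorem formalMap_rel (κ : Kind) {C D : NCat.{u}} (F : NFunctor C D) (n : ℕ) :
    formalSpan κ C n ≤ (formalSpan κ D n).comap (Finsupp.lmapDomain ℤ ℤ (formalMap κ F n)) := by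
  cases n with
  | zero => exact bot_le
  | succ n =>
    have comp : ∀ p (x y z : FormalG κ C (n + 1)), (∃ h, z.1 = C.cat.comp p x.1 y.1 h) →
        ∃ h, (formalMap κ F (n + 1) z).1 = D.cat.comp p (formalMap κ F (n + 1) x).1
          (formalMap κ F (n + 1) y).1 h := by
      rintro p x y z ⟨h, hz⟩
      refine ⟨F.fn.map_cmp h, ?_⟩
      change F.fn.map z.1 = _
      rw [hz]
      exact F.fn.map_comp p x.1 y.1 h _
    refine Submodule.span_le.2 ?_
    rintro v (⟨x, hx, rfl⟩ | ⟨x, y, z, ⟨p, hp, hpm, h⟩, rfl⟩ | ⟨α, hα, x, y, z, h, rfl⟩)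
    · rw [SetLike.mem_coe, Submodule.mem_comap, Finsupp.lmapDomain_apply, Finsupp.mapDomain_single]
      exact Submodule.subset_span (Or.inl ⟨_, (F.fn.dim_map_le _).trans hx, rfl⟩)
    · rw [SetLike.mem_coe, Submodule.mem_comap, map_sub, map_sub, Finsupp.lmapDomain_apply,
        Finsupp.lmapDomain_apply, Finsupp.lmapDomain_apply, Finsupp.mapDomain_single,
        Finsupp.mapDomain_single, Finsupp.mapDomain_single]
      exact Submodule.subset_span (Or.inr (Or.inl ⟨_, _, _, ⟨p, hp, hpm, comp p x y z h⟩, rfl⟩))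
    · rw [SetLike.mem_coe, Submodule.mem_comap, map_sub, Finsupp.lmapDomain_apply,
        Finsupp.lmapDomain_apply, Finsupp.mapDomain_single, Finsupp.mapDomain_single]
      refine Submodule.subset_span (Or.inr (Or.inr ⟨α, hα, _, _, _, comp 0 x y z h, ?_⟩))
      cases α <;> rfl

theorem induces_formal (κ : Kind) {C D : NCat.{u}} (F : NFunctor C D) :
    PresentedComplex.Induces (formal κ C) (formal κ D) (formalMap κ F) where
  rel := formalMap_rel κ F
  comm n x := (congrArg (· ∈ formalSpan κ D n) (sub_eq_zero.2 (formalMap_bdry κ F n x))).mpr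
    (Submodule.zero_mem _)

/-- A functor out of the globe sends a cell to an iterated source or target of `x`, chosen by the
cell alone, and `F` commutes with sources and targets. -/
theorem nerveMap_box (κ : Kind) {C D : NCat.{u}} (F : NFunctor C D) (n : ℕ)
    (x : FormalG κ C n) : nerveMap F κ n (box C κ n x) = box D κ n (formalMap κ F n x) := by
  match κ, n with
  | .globular, 0 => rfl
  | .corner α, 0 => rfl
  | .globular, n + 1 =>
    refine OmegaCat.Functor.ext (funext fun X => ?_)
    exact F.P.map_d _ _ _
  | .corner α, n + 1 =>
    refine Subtype.ext (OmegaCat.Functor.ext (funext fun X => ?_))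
    exact F.fn.map_d _ _ _

/-- If the formal complexes are mapped quasi-isomorphically and the comparison maps to the formal
complexes are quasi-isomorphisms, then the chain complexes are mapped quasi-isomorphically. -/
theorem quasiIso_chainsMap (κ : Kind) {C D : NCat.{u}} (F : NFunctor C D)
    (hC : QuasiIso (reduceMap κ C)) (hD : QuasiIso (reduceMap κ D))
    (bC : ∃ h : PresentedComplex.Induces (formal κ C) (nerve κ C).reduced (box C κ),
      QuasiIso h.map)
    (bD : ∃ h : PresentedComplex.Induces (formal κ D) (nerve κ D).reduced (box D κ),
      QuasiIso h.map)
    (hF : QuasiIso (induces_formal κ F).map) : QuasiIso (chainsMap κ F) := by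
  obtain ⟨bC, bC'⟩ := bC
  obtain ⟨bD, bD'⟩ := bD
  -- The common diagonal of the square of chain complexes and reduced complexes. Both composites
  -- have the same effect on simplices.
  have diag : PresentedComplex.Induces (nerve κ C).chains (nerve κ D).reduced (nerveMap F κ) :=
    ⟨fun _ => bot_le, (induces_reduced κ F).comm⟩
  have e1 : reduceMap κ C ≫ reducedMap κ F = chainsMap κ F ≫ reduceMap κ D :=
    ((nerve κ C).induces_reduce.map_comp (induces_reduced κ F) diag fun _ _ => rfl).trans
      ((Nerve.induces_map (nerveMap F κ) (nerveMap_face F κ)).map_comp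
        (nerve κ D).induces_reduce diag fun _ _ => rfl).symm
  have diag' := bC.comp (induces_reduced κ F)
  have e2 : bC.map ≫ (induces_reduced κ F).map = (induces_formal κ F).map ≫ bD.map :=
    (bC.map_comp (induces_reduced κ F) diag' fun _ _ => rfl).trans
      ((induces_formal κ F).map_comp bD diag' fun n x => (nerveMap_box κ F n x).symm).symm
  have : QuasiIso (bC.map ≫ (induces_reduced κ F).map) := by
    rw [e2]
    infer_instance
  -- Two out of three is used twice: from the formal to the reduced complexes here, and from the
  -- reduced complexes back to the chains below.
  have : QuasiIso (reducedMap κ F) := quasiIso_of_comp_left bC.map (induces_reduced κ F).map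
  have : QuasiIso (chainsMap κ F ≫ reduceMap κ D) := by
    rw [← e1]
    infer_instance
  exact quasiIso_of_comp_right _ (reduceMap κ D)

/-! ### The formal complexes of the `ω`-category with inverses -/

section FormalIso

variable {C : NCat.{u}} (κ : Kind)

/-- The canonical functor to the `ω`-category with inverses as a non-contracting functor. -/
def hatNFunctor (hu : C.cat.UnitFree) : NFunctor C (hat C) :=
  ⟨hatFunctor C, fun _ hx => (hatFunctor_dim hu hx.le).trans hx⟩

/-- The induced map on the formal complexes in degree `n`. -/
def formalHat (hu : C.cat.UnitFree) (n : ℕ) :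
    ((FormalG κ C n →₀ ℤ) ⧸ formalSpan κ C n) →ₗ[ℤ]
      ((FormalG κ (hat C) n →₀ ℤ) ⧸ formalSpan κ (hat C) n) :=
  Submodule.mapQ _ _ (Finsupp.lmapDomain ℤ ℤ (formalMap κ (hatNFunctor hu) n))
    (formalMap_rel κ (hatNFunctor hu) n)

theorem formalHat_class (hu : C.cat.UnitFree) {m : ℕ} {x : C.cat} (hx : 1 ≤ C.cat.dim x)
    (hx' : C.cat.dim x ≤ m + 1) : formalHat κ hu (m + 1) (formalClass κ m x) =
      formalClass κ m ((hatFunctor C).map x) := by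
  obtain ⟨g, rfl⟩ : ∃ g : FormalG κ C (m + 1), g.1 = x := ⟨⟨x, hx, hx'⟩, rfl⟩
  have h2 : formalClass κ m ((hatFunctor C).map g.1) =
      formalMk (formalMap κ (hatNFunctor hu) (m + 1) g) :=
    formalClass_of_mem (formalMap κ (hatNFunctor hu) (m + 1) g)
  rw [formalClass_of_mem, h2]
  change (formalSpan κ (hat C) (m + 1)).mkQ (Finsupp.mapDomain _ (Finsupp.single g 1)) = _
  rw [Finsupp.mapDomain_single]
  rfl

/-- The homomorphism induced by `f` is a left inverse, as one sees on classes of morphisms of `C`.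
-/
theorem formalHat_injective (hu : C.cat.UnitFree) {m : ℕ} {f : (hat C).cat → FormalA κ C m}
    (hf : Respects κ m f)
    (h : ∀ x, C.cat.dim x ≤ m + 1 → f ((hatFunctor C).map x) = formalClass κ m x) :
    Function.Injective (formalHat κ hu (m + 1)) := by
  have key : hf.lift.comp (formalHat κ hu (m + 1)).toAddMonoidHom = AddMonoidHom.id _ := by
    refine formal_hom_ext fun x hx hx' => ?_
    refine (congrArg hf.lift (formalHat_class κ hu hx hx')).trans ?_
    rw [hf.lift_class (((hatFunctor C).dim_map_le x).trans hx'), h x hx']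
    rfl
  exact (Function.LeftInverse.injective fun a => DFunLike.congr_fun key a)

theorem formalHat_surjective (hu : C.cat.UnitFree) {m : ℕ}
    (h : ∀ q, (hat C).cat.dim q ≤ m + 1 → formalClass κ m q ∈
      (formalHat κ hu (m + 1)).range.toAddSubgroup) :
    Function.Surjective (formalHat κ hu (m + 1)) := by
  intro b
  obtain ⟨b, rfl⟩ := Submodule.mkQ_surjective _ b
  rw [← LinearMap.mem_range]
  induction b using Finsupp.induction_linear with
  | zero => rw [map_zero]; exact Submodule.zero_mem _
  | add b c hb hc => rw [map_add]; exact Submodule.add_mem _ hb hc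
  | single x c =>
    have hx := h x.1 x.2.2
    rw [formalClass_of_mem] at hx
    -- An arbitrary coefficient is a multiple of the coefficient one, for which the element is the
    -- class of a morphism.
    rw [← mul_one c, ← smul_eq_mul, ← Finsupp.smul_single, map_smul]
    exact Submodule.smul_mem _ c hx

/-! ### Left inverses of the map of formal groups. -/

/-- The first class of a morphism of the model, for the formal complex. -/
def modelClass (hu : C.cat.UnitFree) (m : ℕ) (q : (hat C).cat) : FormalA κ C (m + 1) :=
  Whiskering.Cell.a ((hatToModel hu (by omega) (formalWhiskering κ hu m)).map q)

/-- Low-dimensional morphisms go to cells whose label is zero, and `*_p` with `p ≥ 1` adds labels.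
For `*_0` the label is a sum of two whiskered labels. In the branching case the second is multiplied
by the action of a morphism of dimension one, which is zero, and in the merging case the first is.
-/
theorem modelClass_respects (hu : C.cat.UnitFree) (m : ℕ) :
    Respects κ (m + 1) (modelClass κ hu m) where
  low q hq := by
    have h := (hatToModel hu (by omega) (formalWhiskering κ hu m)).map_d false (m + 1) q
    rw [OmegaCat.d_eq_self hq] at h
    have h' := congrArg Whiskering.Cell.a h
    refine h'.trans ?_
    exact if_pos (by omega)
  mul p x y h hp hpm hx hy := by
    let G := hatToModel hu (by omega) (formalWhiskering κ hu m)
    change Whiskering.Cell.a (G.map _) = Whiskering.Cell.a (G.map x) + Whiskering.Cell.a (G.map y)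
    rw [G.map_mul h, ← OmegaCat.comp_eq_mul (G.map_cmp h)]
    refine (if_neg (by omega)).trans ?_
    exact if_pos (by omega)
  mul_zero α hα x y h hx0 hy0 hx hy := by
    subst hα
    let G := hatToModel hu (by omega) (formalWhiskering (.corner α) hu m)
    -- This component is the morphism of `C` that represents `s_1 y`. It is `1`-dimensional because
    -- `Ĉ` is non-contracting.
    have hy' : C.cat.dim (Whiskering.Cell.x (G.map y)) ≠ 0 := by
      obtain ⟨z, hz, hz'⟩ := hat_exists hu ((hat C).cat.dim_d_le false 1 y)
      have e := congrArg Whiskering.Cell.x (G.map_d false 1 y)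
      rw [← hz'] at e
      have e1 : C.cat.d false 1 z = Whiskering.Cell.x (G.map y) := e
      rw [(hat C).nc.dim_d hy0] at hz
      rw [OmegaCat.d_eq_self hz.le] at e1
      rw [← e1, hz]
      exact one_ne_zero
    have hx' : C.cat.dim (Whiskering.Cell.y (G.map x)) ≠ 0 := by
      obtain ⟨z, hz, hz'⟩ := hat_exists hu ((hat C).cat.dim_d_le true 1 x)
      have e := congrArg Whiskering.Cell.x (G.map_d true 1 x)
      rw [← hz'] at e
      have e1 : C.cat.d false 1 z = Whiskering.Cell.y (G.map x) := e
      rw [(hat C).nc.dim_d hx0] at hz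
      rw [OmegaCat.d_eq_self hz.le] at e1
      rw [← e1, hz]
      exact one_ne_zero
    have e : modelClass (.corner α) hu m ((hat C).cat.mul 0 x y) =
        rightAction C m (.corner α) (Whiskering.Cell.x (G.map y)) (Whiskering.Cell.a (G.map x)) +
        leftAction C m (.corner α) (Whiskering.Cell.y (G.map x)) (Whiskering.Cell.a (G.map y)) := by
      change Whiskering.Cell.a (G.map _) = _
      rw [G.map_mul h, ← OmegaCat.comp_eq_mul (G.map_cmp h)]
      rfl
    rw [e]
    cases α
    · simp only [leftAction, rightAction, unitAction, hx', if_false]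
      exact add_zero _
    · simp only [leftAction, rightAction, unitAction, hy', if_false]
      exact zero_add _

theorem modelClass_map (hu : C.cat.UnitFree) (m : ℕ) {x : C.cat} (hx : C.cat.dim x ≤ m + 2) :
    modelClass κ hu m ((hatFunctor C).map x) = formalClass κ (m + 1) x :=
  congrArg (formalClass κ (m + 1)) (OmegaCat.d_eq_self hx)

/-- In degree one there is no law `*_p` with `1 ≤ p ≤ 0`, so only the vanishing of identities and,
for the corner kinds, the relation for `*_0` remain. Both take place among morphisms coming from
`C`. -/
theorem retractClass_respects (hu : C.cat.UnitFree) :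
    Respects κ 0 (fun q => formalClass κ 0 (hatRetract hu q)) where
  low q hq := by
    obtain ⟨x, hx, rfl⟩ := hat_exists hu (hq.trans zero_le_one)
    rw [hatRetract_map hu (by omega), formalClass_low (by omega)]
  mul p x y h hp hpm := by omega
  mul_zero α hα x y h hx0 hy0 hx hy := by
    subst hα
    obtain ⟨x, ex, rfl⟩ := hat_exists hu hx
    obtain ⟨y, ey, rfl⟩ := hat_exists hu hy
    have hc := hatFunctor_cmp hu h
    rw [← (hatFunctor C).map_mul hc, hatRetract_map hu (OmegaCat.dim_mul_le hc (by omega)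
      (by omega)), formalClass_mul_zero hu hc (by omega) (by omega) (by omega) (by omega)]
    cases α
    · exact (congrArg _ (hatRetract_map hu (x := x) (by omega))).symm
    · exact (congrArg _ (hatRetract_map hu (x := y) (by omega))).symm

/-! ### Bijectivity in every degree. -/

theorem hatNFunctor_onObj_bijective (hu : C.cat.UnitFree) :
    Function.Bijective (hatNFunctor hu).onObj := by
  constructor
  · intro x y h
    exact Subtype.ext (hatFunctor_injective hu (x.2.le.trans zero_le_one)
      (y.2.le.trans zero_le_one) (congrArg Subtype.val h))
  · intro q
    obtain ⟨x, hx, hx'⟩ := hat_exists hu (q.2.le.trans zero_le_one)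
    exact ⟨⟨x, hx.trans q.2⟩, Subtype.ext hx'⟩

theorem formalMap_zero_bijective (hu : C.cat.UnitFree) :
    Function.Bijective (formalMap κ (hatNFunctor hu) 0) := by
  cases κ with
  | globular => exact (hatNFunctor_onObj_bijective hu).prodMap (hatNFunctor_onObj_bijective hu)
  | corner α => exact hatNFunctor_onObj_bijective hu

/-- Degree `0` has no relations and follows from the bijection on objects. Degree `1` follows from
the comparison in dimension at most one. In degree at least `2`, injectivity comes from the model
and surjectivity from `hat_class_mem`. -/
theorem formalHat_bijective (hu : C.cat.UnitFree) (n : ℕ) :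
    Function.Bijective (formalHat κ hu n) := by
  match n with
  | 0 =>
    have h := formalMap_zero_bijective κ hu
    constructor
    · rw [← LinearMap.ker_eq_bot, LinearMap.ker_eq_bot']
      intro a ha
      obtain ⟨a, rfl⟩ := Submodule.mkQ_surjective _ a
      have ha' := (Submodule.Quotient.mk_eq_zero _).1 ha
      have ha2 : Finsupp.mapDomain (formalMap κ (hatNFunctor hu) 0) a = 0 := ha'
      have ha3 : a = 0 := Finsupp.mapDomain_injective h.1 (ha2.trans Finsupp.mapDomain_zero.symm)
      rw [ha3, map_zero]
    · intro b
      obtain ⟨b, rfl⟩ := Submodule.mkQ_surjective _ b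
      obtain ⟨a, rfl⟩ := Finsupp.mapDomain_surjective h.2 b
      exact ⟨Submodule.mkQ _ a, rfl⟩
  | 1 =>
    refine ⟨formalHat_injective κ hu (retractClass_respects κ hu) fun x hx => ?_,
      formalHat_surjective κ hu fun q hq => ?_⟩
    · exact congrArg _ (hatRetract_map hu hx)
    · obtain ⟨x, hx, rfl⟩ := hat_exists hu hq
      by_cases hx0 : 1 ≤ C.cat.dim x
      · exact ⟨_, formalHat_class κ hu hx0 (by omega)⟩
      · rw [formalClass_low (by omega)]
        exact AddSubgroup.zero_mem _
  | m + 2 =>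
    refine ⟨formalHat_injective κ hu (modelClass_respects κ hu m) fun x hx =>
      modelClass_map κ hu m hx, formalHat_surjective κ hu fun q hq => ?_⟩
    refine hat_class_mem hu _ (n := m + 2) (by omega) (formalClass κ (m + 1))
      (fun x hx => formalClass_low (by omega))
      (fun p x y h hp hpm hx hy => formalClass_mul h hp (by omega) hx hy) (fun x hx => ?_) q hq
    -- Only morphisms of positive dimension are generators. The images of the others have class
    -- zero.
    by_cases hx0 : 1 ≤ C.cat.dim x
    · exact ⟨_, formalHat_class κ hu hx0 hx⟩
    · rw [formalClass_low (((hatFunctor C).dim_map_le x).trans (by omega))]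
      exact AddSubgroup.zero_mem _

theorem quasiIso_formal_hat (hu : C.cat.UnitFree) :
    QuasiIso (induces_formal κ (hatNFunctor hu)).map := by
  have := (induces_formal κ (hatNFunctor hu)).isIso (formalHat_bijective κ hu)
  infer_instance

end FormalIso

/-! ### The case of `F(K)`. -/

/-- Length is additive for `*_0`, takes natural numbers as values, and vanishes exactly on the
`0`-dimensional morphisms. A sum of two lengths is zero only if both are. -/
theorem free_unitFree (K : PrecubicalSet.{u}) : (free K).cat.UnitFree := by
  intro x y h hxy
  have h1 := (lengthFunctor_eq_zero K _).2 hxy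
  have e : (lengthFunctor K).map ((free K).cat.mul 0 x y) = natCat.mul 0 _ _ :=
    (lengthFunctor K).map_mul h
  rw [e, ← OmegaCat.comp_eq_mul ((lengthFunctor K).map_cmp h), natCat_dim_zero] at h1
  have h2 : ((lengthFunctor K).map x).down + ((lengthFunctor K).map y).down = 0 := h1
  exact ⟨(lengthFunctor_eq_zero K x).1 (natCat_dim_zero.2 (by omega)),
    (lengthFunctor_eq_zero K y).1 (natCat_dim_zero.2 (by omega))⟩

end

end HDA

theorem mainTheorem10 (K : HDA.PrecubicalSet.{u})
    (hthin : HDA.ThinElementsConjecture (HDA.free K))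
    (hthin' : HDA.ThinElementsConjecture (HDA.hat (HDA.free K)))
    (hfold : HDA.FoldingConjecture (HDA.free K))
    (hfold' : HDA.FoldingConjecture (HDA.hat (HDA.free K))) :
    QuasiIso (HDA.chainsMap HDA.Kind.globular (HDA.toHat K)) ∧
      ∀ α : Bool, QuasiIso (HDA.chainsMap (HDA.Kind.corner α) (HDA.toHat K)) := by
  have key : ∀ κ, QuasiIso (HDA.chainsMap κ (HDA.toHat K)) := fun κ =>
    -- `toHat K` and `hatNFunctor` have the same underlying functor and differ only in the proof of
    -- non-contraction, so the result for the latter applies as it stands.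
    HDA.quasiIso_chainsMap κ (HDA.toHat K) (hthin κ) (hthin' κ) (hfold κ) (hfold' κ)
      (HDA.quasiIso_formal_hat κ (HDA.free_unitFree K))
  exact ⟨key _, fun α => key _⟩
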